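/- Let $\mathfrak M$ be a complex manifold of complex dimension $n\ge 1$, countable at infinity, with a metric compatible with its topology that is locally, in holomorphic coordinates, bi-Lipschitz equivalent to the Euclidean metric (for example the distance of a Riemannian metric). Let $\Omega=\bigcap_{j=1}^N\Omega_j$ be a relatively compact domain in $\mathfrak M$ with generic corners, that is, each $\Omega_j$ is a domain in $\mathfrak M$ with $\mathcal C^\infty$ boundary, and for each $S\subset\{1,\dots,N\}$ the set $B_S=\bigcap_{j\in S}\partial\Omega_j$, if non-empty, is a generic CR manifold of CR-dimension $n-|S|$; equivalently, $\bigwedge_{j\in S}\overline\partial r_j\neq 0$ at every point of $B_S$ for local defining functions $r_j$ of $\Omega_j$. Let $f\in\mathcal A^{-\infty}(\Omega)$, i.e. $f$ is holomorphic on $\Omega$ and there are $C>0$ and $k\ge 0$ with $|f(z)|\le C\,\mathrm{dist}(z,\partial\Omega)^{-k}$ for all $z\in\Omega$. Then there is a unique distribution $\mathsf{ce} f\in\mathcal D'_0(\mathfrak M)$, the canonical extension of $f$, such that: (1) $(\mathsf{ce} f)|_\Omega=f$; (2) if $U$ is a coordinate neighborhood, $\phi$ is a smooth $(n,n)$-form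 with compact support in $U$, and $v\in\mathbb C^n$ is a vector that, in the coordinates on $U$, points outward from $\Omega_j$ at each point of $\partial\Omega_j\cap\operatorname{supp}\phi$ for every $j$, then $$\langle \mathsf{ce} f,\phi\rangle=\lim_{\epsilon\downarrow 0}\int_\Omega f(z-\epsilon v)\,\phi(z);$$ (3) if $f$ extends continuously to $\overline\Omega$, then $\mathsf{ce} f$ is integration of $f$ over $\overline\Omega$. Moreover, the boundary current $\mathsf{bc} f:=-\overline\partial(\mathsf{ce} f)\in\mathcal D'_{0,1}(\mathfrak M)$, i.e. $\langle\mathsf{bc} f,\omega\rangle=\langle\mathsf{ce} f,\overline\partial\omega\rangle$, satisfies the Weinstock orthogonality condition with respect to $\Omega$: for every smooth compactly supported $(n,n-1)$-form $\omega$ on $\mathfrak M$ with $\overline\partial\omega=0$ on $\overline\Omega$, one has $\langle\mathsf{bc} f,\omega\rangle=0$. -/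

import Mathlib

open Set Filter Topology MeasureTheory
open scoped Manifold ContDiff

namespace BoundaryCurrents

noncomputable section

/-- The model space `ℂⁿ`. Its `volume` is the Lebesgue measure `dx₁ dy₁ … dxₙ dyₙ`. -/
abbrev Cn (n : ℕ) : Type := Fin n → ℂ

section Flat

variable {E F : Type*} [NormedAddCommGroup E] [NormedSpace ℝ E] [NormedAddCommGroup F]
  [NormedSpace ℝ F]

lemma two_le_infty : (2 : WithTop ℕ∞) ≤ ∞ := by
  exact WithTop.coe_le_coe.2 (le_top : (2 : ℕ∞) ≤ ⊤)

lemma contDiffOn_extDeriv {k : ℕ} {α : E → E [⋀^Fin k]→L[ℝ] F} {s : Set E} (hs : IsOpen s)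
    (hα : ContDiffOn ℝ ∞ α s) : ContDiffOn ℝ ∞ (extDeriv α) s :=
  (ContinuousAlternatingMap.alternatizeUncurryFinCLM ℝ E F).contDiff.comp_contDiffOn
    (hα.fderiv_of_isOpen hs (by simp))

lemma norm_iteratedFDeriv_extDeriv_le {k : ℕ} {α : E → E [⋀^Fin k]→L[ℝ] F} {s : Set E}
    (hs : IsOpen s) (hα : ContDiffOn ℝ ∞ α s) {y : E} (hy : y ∈ s) (m : ℕ) :
    ‖iteratedFDeriv ℝ m (extDeriv α) y‖ ≤ (k + 1) * ‖iteratedFDeriv ℝ (m + 1) α y‖ := by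
  have hcd : ContDiffAt ℝ m (fderiv ℝ α) y := by
    have h1 : ContDiffOn ℝ ∞ (fderiv ℝ α) s := hα.fderiv_of_isOpen hs (by simp)
    exact (h1.contDiffAt (hs.mem_nhds hy)).of_le (by exact_mod_cast le_top)
  have hle := (ContinuousAlternatingMap.alternatizeUncurryFinCLM
    (n := k) ℝ E F).norm_iteratedFDeriv_comp_left hcd (n := m) le_rfl
  rw [norm_iteratedFDeriv_fderiv] at hle
  refine hle.trans ?_
  gcongr
  exact ContinuousAlternatingMap.norm_alternatizeUncurryFinCLM_le

end Flat

section Forms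

variable (n : ℕ) (M : Type*) [TopologicalSpace M] [ChartedSpace (Cn n) M]

/-- The holomorphic charts of `M` (coordinate neighbourhoods with their coordinates). -/
abbrev holoCharts : Set (OpenPartialHomeomorph M (Cn n)) :=
  IsManifold.maximalAtlas 𝓘(ℂ, Cn n) ω M

/-- Complex valued (not necessarily continuous) differential `k`-forms on `M`. As always in
Mathlib, the tangent space of `M` at `x` is identified with `ℂⁿ` through the preferred chart
`chartAt _ x`; the value at `x` is an `ℝ`-multilinear alternating map on the tangent space. -/
abbrev DiffForm (k : ℕ) : Type _ := M → Cn n [⋀^Fin k]→L[ℝ] ℂ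

variable {n M}

/-- The expression `(e⁻¹)^* α` of a form `α` in the chart `e`. Since `α x` is written in the chart
`chartAt _ x`, the derivative of the coordinate change from `e` to `chartAt _ x` enters. -/
def inChart {k : ℕ} (α : DiffForm n M k) (e : OpenPartialHomeomorph M (Cn n)) (y : Cn n) :
    Cn n [⋀^Fin k]→L[ℝ] ℂ :=
  (α (e.symm y)).compContinuousLinearMap
    (fderiv ℝ (chartAt (Cn n) (e.symm y) ∘ e.symm) y)

/-- `α` is `C^∞` : its expression in every holomorphic chart is `C^∞` (over `ℝ`). -/
def IsSmoothForm {k : ℕ} (α : DiffForm n M k) : Prop :=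
  ∀ e ∈ holoCharts n M, ContDiffOn ℝ ∞ (inChart α e) e.target

/-- `α` is of bidegree `(p, q)`. For a form of degree `p + q` this is equivalent to
being a combination of terms `dz_I ∧ dz̄_J` with `|I| = p`, `|J| = q`. -/
def IsOfType {k : ℕ} (p q : ℕ) (α : DiffForm n M k) : Prop :=
  ∀ (x : M) (c : ℂ) (v : Fin k → Cn n),
    α x (fun i => c • v i) = c ^ p * (starRingEnd ℂ c) ^ q * α x v

lemma inChart_add {k : ℕ} (α β : DiffForm n M k) (e : OpenPartialHomeomorph M (Cn n)) :
    inChart (α + β) e = inChart α e + inChart β e := by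
  funext y; ext v; simp [inChart]

lemma inChart_smul {k : ℕ} (c : ℂ) (α : DiffForm n M k) (e : OpenPartialHomeomorph M (Cn n)) :
    inChart (c • α) e = c • inChart α e := by
  funext y; ext v; simp [inChart]

variable (n M)

/-- `𝒟^k(M)`: the smooth compactly supported `k`-forms. -/
def testForms (k : ℕ) : Submodule ℂ (DiffForm n M k) where
  carrier := {α | IsSmoothForm α ∧ ∃ K : Set M, IsCompact K ∧ ∀ x ∉ K, α x = 0}
  zero_mem' := by
    refine ⟨fun e _ => ?_, ∅, isCompact_empty, fun x _ => rfl⟩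
    have : inChart (0 : DiffForm n M k) e = 0 := by funext y; ext v; simp [inChart]
    rw [this]; exact contDiffOn_const
  add_mem' := by
    rintro α β ⟨hα, K, hK, hαK⟩ ⟨hβ, L, hL, hβL⟩
    refine ⟨fun e he => ?_, K ∪ L, hK.union hL, fun x hx => ?_⟩
    · rw [inChart_add]; exact (hα e he).add (hβ e he)
    · simp only [mem_union, not_or] at hx
      simp [hαK x hx.1, hβL x hx.2]
  smul_mem' := by
    rintro c α ⟨hα, K, hK, hαK⟩
    refine ⟨fun e he => ?_, K, hK, fun x hx => by simp [hαK x hx]⟩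
    rw [inChart_smul]; exact (hα e he).const_smul c

/-- `𝒟^{p,q}(M)`: the smooth compactly supported `(p,q)`-forms. -/
def testFormsOfType (p q : ℕ) : Submodule ℂ (DiffForm n M (p + q)) where
  carrier := {α | α ∈ testForms n M (p + q) ∧ IsOfType p q α}
  zero_mem' := ⟨Submodule.zero_mem _, fun x c v => by simp⟩
  add_mem' := by
    rintro α β ⟨hα, tα⟩ ⟨hβ, tβ⟩
    refine ⟨Submodule.add_mem _ hα hβ, fun x c v => ?_⟩
    have h1 := tα x c v
    have h2 := tβ x c v
    simp only [Pi.add_apply, ContinuousAlternatingMap.add_apply, h1, h2]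
    ring
  smul_mem' := by
    rintro a α ⟨hα, tα⟩
    refine ⟨Submodule.smul_mem _ _ hα, fun x c v => ?_⟩
    have h1 := tα x c v
    simp only [Pi.smul_apply, ContinuousAlternatingMap.smul_apply, h1, smul_eq_mul]
    ring

variable {n M}

/-- Convergence to `0` in the space of test forms: the supports lie in a common compact set and, in
every chart, all derivatives tend to `0` uniformly on compact sets. -/
def TendstoZero {k : ℕ} (α : ℕ → DiffForm n M k) : Prop :=
  (∃ K : Set M, IsCompact K ∧ ∀ ν, ∀ x ∉ K, α ν x = 0) ∧
  ∀ e ∈ holoCharts n M, ∀ L ⊆ e.target, IsCompact L → ∀ m : ℕ,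
    TendstoUniformlyOn (fun ν => iteratedFDeriv ℝ m (inChart (α ν) e)) 0 atTop L

/-- The continuous linear functionals on a space `V` of test forms. (Spaces of test forms being
inductive limits of Fréchet spaces, continuity is sequential continuity.) -/
structure Current {k : ℕ} (V : Submodule ℂ (DiffForm n M k)) where
  toLinearMap : V →ₗ[ℂ] ℂ
  seqContinuous : ∀ α : ℕ → V, TendstoZero (fun ν => (α ν : DiffForm n M k)) →
    Tendsto (fun ν => toLinearMap (α ν)) atTop (𝓝 0)

/-- The exterior derivative of a form, computed at `x` in the chart `chartAt _ x`. -/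
def extDer {k : ℕ} (α : DiffForm n M k) : DiffForm n M (k + 1) := fun x =>
  extDeriv (inChart α (chartAt (Cn n) x)) (chartAt (Cn n) x x)

lemma contDiffOn_transition {e e' : OpenPartialHomeomorph M (Cn n)}
    (he : e ∈ holoCharts n M) (he' : e' ∈ holoCharts n M) :
    ContDiffOn ℝ ∞ (e' ∘ e.symm) (e.symm.trans e').source := by
  have h := StructureGroupoid.compatible_of_mem_maximalAtlas he he'
  have h1 := (mem_groupoid_of_pregroupoid.1 h).1
  have h2 : ContDiffOn ℂ ω (e' ∘ e.symm) (e.symm.trans e').source := by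
    simpa [contDiffPregroupoid] using h1
  exact (h2.restrict_scalars ℝ).of_le le_top

lemma inChart_eq_pullback [IsManifold 𝓘(ℂ, Cn n) ω M] {k : ℕ} (α : DiffForm n M k) {e e' : OpenPartialHomeomorph M (Cn n)}
    (he : e ∈ holoCharts n M) (he' : e' ∈ holoCharts n M) {y : Cn n}
    (hy : y ∈ (e.symm.trans e').source) :
    inChart α e y = (inChart α e' ((e' ∘ e.symm) y)).compContinuousLinearMap
      (fderiv ℝ (e' ∘ e.symm) y) := by
  have hy1 : y ∈ e.target := by simpa using hy.1
  have hy2 : e.symm y ∈ e'.source := by simpa using hy.2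
  have hx : e'.symm ((e' ∘ e.symm) y) = e.symm y := e'.left_inv hy2
  have hc : chartAt (Cn n) (e.symm y) ∈ holoCharts n M := IsManifold.chart_mem_maximalAtlas _
  have hg : DifferentiableAt ℝ (e' ∘ e.symm) y :=
    ((contDiffOn_transition he he').contDiffAt
      ((e.symm.trans e').open_source.mem_nhds hy)).differentiableAt (by simp)
  have hs : (e' ∘ e.symm) y ∈ (e'.symm.trans (chartAt (Cn n) (e.symm y))).source := by
    have h1 : e' (e.symm y) ∈ e'.target := e'.map_source hy2
    have h2 : e'.symm (e' (e.symm y)) = e.symm y := e'.left_inv hy2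
    simp [h1, h2]
  have hf : DifferentiableAt ℝ (chartAt (Cn n) (e.symm y) ∘ e'.symm) ((e' ∘ e.symm) y) :=
    ((contDiffOn_transition he' hc).contDiffAt
      ((e'.symm.trans _).open_source.mem_nhds hs)).differentiableAt (by simp)
  have heq : (chartAt (Cn n) (e.symm y) ∘ e.symm) =ᶠ[𝓝 y]
      ((chartAt (Cn n) (e.symm y) ∘ e'.symm) ∘ (e' ∘ e.symm)) := by
    filter_upwards [(e.symm.trans e').open_source.mem_nhds hy] with z hz
    have hz2 : e.symm z ∈ e'.source := by simpa using hz.2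
    simp [e'.left_inv hz2]
  have hd : fderiv ℝ (chartAt (Cn n) (e.symm y) ∘ e.symm) y =
      (fderiv ℝ (chartAt (Cn n) (e.symm y) ∘ e'.symm) ((e' ∘ e.symm) y)).comp
        (fderiv ℝ (e' ∘ e.symm) y) := by
    rw [heq.fderiv_eq, fderiv_comp _ hf hg]
  ext v
  simp only [inChart, hx]
  rw [hd]
  rfl

lemma inChart_extDer [IsManifold 𝓘(ℂ, Cn n) ω M] {k : ℕ} {α : DiffForm n M k} (hα : IsSmoothForm α)
    {e : OpenPartialHomeomorph M (Cn n)} (he : e ∈ holoCharts n M) {y : Cn n}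
    (hy : y ∈ e.target) : inChart (extDer α) e y = extDeriv (inChart α e) y := by
  set c := chartAt (Cn n) (e.symm y) with hcdef
  have hc : c ∈ holoCharts n M := IsManifold.chart_mem_maximalAtlas _
  have hs : y ∈ (e.symm.trans c).source := by
    simp [hy, hcdef]
  have hcs : (c ∘ e.symm) y ∈ c.target := c.map_source (mem_chart_source _ _)
  have heq : inChart α e =ᶠ[𝓝 y] fun z => (inChart α c ((c ∘ e.symm) z)).compContinuousLinearMap
      (fderiv ℝ (c ∘ e.symm) z) := by
    filter_upwards [(e.symm.trans c).open_source.mem_nhds hs] with z hz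
    exact inChart_eq_pullback α he hc hz
  have hd : DifferentiableAt ℝ (inChart α c) ((c ∘ e.symm) y) :=
    ((hα c hc).contDiffAt (c.open_target.mem_nhds hcs)).differentiableAt (by simp)
  have hg : ContDiffAt ℝ ∞ (c ∘ e.symm) y :=
    (contDiffOn_transition he hc).contDiffAt ((e.symm.trans c).open_source.mem_nhds hs)
  rw [heq.extDeriv_eq, extDeriv_pullback hd hg (by simpa using two_le_infty)]
  rfl

lemma extDer_apply_eq_zero {k : ℕ} {α : DiffForm n M k} {K : Set M} (hK : IsClosed K)
    (hα : ∀ x ∉ K, α x = 0) {x : M} (hx : x ∉ K) : extDer α x = 0 := by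
  have h1 : inChart α (chartAt (Cn n) x) =ᶠ[𝓝 (chartAt (Cn n) x x)] fun _ => 0 := by
    have hc : ContinuousAt (chartAt (Cn n) x).symm (chartAt (Cn n) x x) :=
      (chartAt (Cn n) x).continuousAt_symm (mem_chart_target _ x)
    have hm : Kᶜ ∈ 𝓝 ((chartAt (Cn n) x).symm (chartAt (Cn n) x x)) := by
      rw [(chartAt (Cn n) x).left_inv (mem_chart_source _ x)]
      exact hK.isOpen_compl.mem_nhds hx
    filter_upwards [hc hm] with y hy
    ext v
    simp [inChart, hα _ hy]
  rw [extDer, h1.extDeriv_eq, extDeriv]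
  ext v
  simp [ContinuousAlternatingMap.alternatizeUncurryFin_apply]

lemma extDer_mem [IsManifold 𝓘(ℂ, Cn n) ω M] [T2Space M] {k : ℕ} {α : DiffForm n M k} (hα : α ∈ testForms n M k) :
    extDer α ∈ testForms n M (k + 1) := by
  obtain ⟨hs, K, hK, hαK⟩ := hα
  refine ⟨fun e he => ?_, K, hK, fun x hx => extDer_apply_eq_zero hK.isClosed hαK hx⟩
  exact (contDiffOn_extDeriv e.open_target (hs e he)).congr fun _ hy => inChart_extDer hs he hy

lemma differentiableAt_inChart [IsManifold 𝓘(ℂ, Cn n) ω M] {k : ℕ} {α : DiffForm n M k} (hα : IsSmoothForm α) (x : M) :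
    DifferentiableAt ℝ (inChart α (chartAt (Cn n) x)) (chartAt (Cn n) x x) :=
  ((hα _ (IsManifold.chart_mem_maximalAtlas x)).contDiffAt
    ((chartAt (Cn n) x).open_target.mem_nhds (mem_chart_target _ x))).differentiableAt (by simp)

lemma TendstoZero.extDer [IsManifold 𝓘(ℂ, Cn n) ω M] [T2Space M] {k : ℕ} {α : ℕ → DiffForm n M k} (hs : ∀ ν, IsSmoothForm (α ν))
    (hα : TendstoZero α) : TendstoZero (fun ν => extDer (α ν)) := by
  obtain ⟨⟨K, hK, hαK⟩, hu⟩ := hα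
  refine ⟨⟨K, hK, fun ν x hx => extDer_apply_eq_zero hK.isClosed (hαK ν) hx⟩, ?_⟩
  intro e he L hL hLc m
  have h := hu e he L hL hLc (m + 1)
  rw [Metric.tendstoUniformlyOn_iff] at h ⊢
  intro ε hε
  filter_upwards [h (ε / (k + 1)) (by positivity)] with ν hν y hy
  have hy' := hν y hy
  simp only [Pi.zero_apply, dist_zero_left] at hy' ⊢
  have heq : inChart (BoundaryCurrents.extDer (α ν)) e =ᶠ[𝓝 y] extDeriv (inChart (α ν) e) := by
    filter_upwards [e.open_target.mem_nhds (hL hy)] with z hz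
    exact inChart_extDer (hs ν) he hz
  rw [(Filter.EventuallyEq.iteratedFDeriv ℝ heq m).self_of_nhds]
  calc _ ≤ (k + 1) * ‖iteratedFDeriv ℝ (m + 1) (inChart (α ν) e) y‖ :=
        norm_iteratedFDeriv_extDeriv_le e.open_target (hs ν e he) (hL hy) m
    _ < (k + 1) * (ε / (k + 1)) := by gcongr
    _ = ε := by field_simp

end Forms

section Operators

variable (n : ℕ) (M : Type*) [TopologicalSpace M] [ChartedSpace (Cn (n + 1)) M]

/-- `𝒟'_0(M)`, the distributions (`0`-currents) on a manifold of complex dimension `n + 1`: the dual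
of the space of test forms of top degree `2(n + 1)`. -/
abbrev Distribution0 : Type _ := Current (testForms (n + 1) M (n + 1 + n + 1))

/-- `𝒟'_{0,1}(M)`, the `(0,1)`-currents on a manifold of complex dimension `n + 1`: the dual of the
space of test forms of bidegree `(n + 1, n)`. -/
abbrev Current01 : Type _ := Current (testFormsOfType (n + 1) M (n + 1) n)

variable [IsManifold 𝓘(ℂ, Cn (n + 1)) ω M] [T2Space M]

/-- The operator `∂̄` from `(n + 1, n)`-forms to `(n + 1, n + 1)`-forms on a manifold of complex
dimension `n + 1`. Here `∂̄ = d`, as `∂` vanishes on forms of bidegree `(n + 1, n)`; and all forms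
of top degree are of bidegree `(n + 1, n + 1)`. -/
def dbar :
    testFormsOfType (n + 1) M (n + 1) n →ₗ[ℂ] testForms (n + 1) M (n + 1 + n + 1) where
  toFun α := ⟨extDer α.1, extDer_mem α.2.1⟩
  map_add' := by
    rintro ⟨α, hα, _⟩ ⟨β, hβ, _⟩
    apply Subtype.ext
    funext x
    simp only [extDer, inChart_add, Submodule.coe_add, Pi.add_apply]
    exact extDeriv_add (differentiableAt_inChart hα.1 x) (differentiableAt_inChart hβ.1 x)
  map_smul' := by
    rintro c ⟨α, hα, _⟩
    apply Subtype.ext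
    funext x
    simp only [extDer, inChart_smul, Submodule.coe_smul, Pi.smul_apply, RingHom.id_apply]
    rw [extDeriv, extDeriv, fderiv_const_smul (differentiableAt_inChart hα.1 x)]
    ext v
    simp [ContinuousAlternatingMap.alternatizeUncurryFin_apply, Finset.mul_sum]

variable {n M}

/-- `∂̄` of a `0`-current `T`, the `(0,1)`-current given by `⟨∂̄T, ψ⟩ = -⟨T, ∂̄ψ⟩`. -/
def dbarCurrent (T : Distribution0 n M) : Current01 n M where
  toLinearMap := -(T.toLinearMap ∘ₗ dbar n M)
  seqContinuous := by
    intro α hα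
    have h := T.seqContinuous (fun ν => dbar n M (α ν)) (hα.extDer fun ν => (α ν).2.1.1)
    simpa using h.neg

/-- The boundary current `bc f = -∂̄ (ce f)` obtained from the canonical extension `T = ce f`. -/
def boundaryCurrent (T : Distribution0 n M) : Current01 n M where
  toLinearMap := -(dbarCurrent T).toLinearMap
  seqContinuous := fun α hα => by simpa using ((dbarCurrent T).seqContinuous α hα).neg

/-- The Weinstock orthogonality condition for `γ` with respect to `Ω`: one has `⟨γ, ψ⟩ = 0` for all
`(n + 1, n)`-test forms `ψ` on `M` with `∂̄ψ = 0` on the closure of `Ω`. -/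
def WeinstockCondition (Ω : Set M) (γ : Current01 n M) : Prop :=
  ∀ ψ : testFormsOfType (n + 1) M (n + 1) n,
    (∀ x ∈ closure Ω, (dbar n M ψ : DiffForm (n + 1) M (n + 1 + n + 1)) x = 0) →
      γ.toLinearMap ψ = 0

end Operators

section Domains

variable (n : ℕ) {M : Type*}

/-- The metric of `M` is, locally and in holomorphic coordinates, bi-Lipschitz equivalent to the
Euclidean one. Distances of Riemannian metrics have this property. -/
def IsLocallyEuclideanMetric (M : Type*) [MetricSpace M] [ChartedSpace (Cn n) M] : Prop :=
  ∀ p : M, ∃ U ∈ 𝓝 p, ∃ K : ℝ, ∀ x ∈ U, ∀ y ∈ U,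
    dist (chartAt (Cn n) p x) (chartAt (Cn n) p y) ≤ K * dist x y ∧
    dist x y ≤ K * dist (chartAt (Cn n) p x) (chartAt (Cn n) p y)

/-- `f ∈ 𝒜^{-∞}(Ω)`: the function `f` is holomorphic on `Ω` and of polynomial growth,
`|f(z)| ≤ C / dist(z, ∂Ω)^k` on `Ω` for some `C` and `k`. (Values off `Ω` are irrelevant.) -/
def HolomorphicOfPolynomialGrowth [MetricSpace M] [ChartedSpace (Cn n) M]
    (Ω : Set M) (f : M → ℂ) : Prop :=
  MDifferentiableOn 𝓘(ℂ, Cn n) 𝓘(ℂ, ℂ) f Ω ∧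
  ∃ (C : ℝ) (k : ℕ), ∀ z ∈ Ω, ‖f z‖ * Metric.infDist z (frontier Ω) ^ k ≤ C

variable [TopologicalSpace M] [ChartedSpace (Cn n) M]

/-- `r` is a local defining function of `D` at `p` : near `p` it is a real `C^∞` function with
`D = {r < 0}`, and `dr ≠ 0` at `p`. -/
def IsLocalDefiningFunction (D : Set M) (p : M) (r : M → ℝ) : Prop :=
  (∃ U : Set M, IsOpen U ∧ p ∈ U ∧ ContMDiffOn 𝓘(ℝ, Cn n) 𝓘(ℝ, ℝ) ∞ r U ∧
    ∀ x ∈ U, x ∈ D ↔ r x < 0) ∧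
  fderiv ℝ (r ∘ (chartAt (Cn n) p).symm) (chartAt (Cn n) p p) ≠ 0

/-- A smoothly bounded domain: open, connected, non-empty, with a local defining function at each
boundary point. It need not be relatively compact. -/
structure IsSmoothDomain (D : Set M) : Prop where
  isOpen : IsOpen D
  isConnected : IsConnected D
  smooth : ∀ p ∈ frontier D, ∃ r : M → ℝ, IsLocalDefiningFunction n D p r

/-- The complex tangent space at `p` of the hypersurface `∂D`, i.e. the largest complex subspace of
its real tangent space `ker dr`, where `r` is a local defining function. (The kernel does
not depend on `r`.) It is written in the chart `chartAt _ p`. -/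
def complexTangentSpace (D : Set M) (p : M) : Submodule ℂ (Cn n) where
  carrier := {w | ∀ r : M → ℝ, IsLocalDefiningFunction n D p r → ∀ c : ℂ,
    fderiv ℝ (r ∘ (chartAt (Cn n) p).symm) (chartAt (Cn n) p p) (c • w) = 0}
  zero_mem' := fun r _ c => by simp
  add_mem' := fun {a b} ha hb r hr c => by
    rw [smul_add, map_add, ha r hr c, hb r hr c, add_zero]
  smul_mem' := fun a w hw r hr c => by
    rw [smul_smul]; exact hw r hr (c * a)

/-- `Ω = D₁ ∩ … ∩ D_N` is a (relatively compact) domain with generic corners in the manifold `M` of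
complex dimension `n`: the `D_j` are smoothly bounded domains, and each non-empty intersection
`B_S` of the boundaries `∂D_j`, `j ∈ S`, is a generic CR manifold of CR dimension `n - |S|`.

The latter means that at each point of `B_S` the intersection of the complex tangent spaces of the
`∂D_j`, `j ∈ S`, has complex dimension `n - |S|`, in other words that the `∂̄r_j` are linearly
independent over `ℂ` for local defining functions `r_j`. (Then the `dr_j` are linearly
independent over `ℝ`, so `B_S` is a submanifold of real codimension `|S|`, and this intersection is
its complex tangent space.) -/
structure IsDomainWithGenericCorners {N : ℕ} (D : Fin N → Set M) (Ω : Set M) : Prop where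
  eq_iInter : Ω = ⋂ j, D j
  isConnected : IsConnected Ω
  isCompact_closure : IsCompact (closure Ω)
  isSmoothDomain : ∀ j, IsSmoothDomain n (D j)
  generic : ∀ (S : Finset (Fin N)) (p : M), (∀ j ∈ S, p ∈ frontier (D j)) →
    Module.finrank ℂ (⨅ j ∈ S, complexTangentSpace n (D j) p : Submodule ℂ (Cn n)) + S.card = n

/-- The vector `v`, in the coordinates of `e`, points outward from `D` at `p ∈ ∂D`: one has
`dr(v) > 0` for a local defining function `r` of `D` at `p`. -/
def PointsOutward (D : Set M) (e : OpenPartialHomeomorph M (Cn n)) (v : Cn n) (p : M) : Prop :=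
  ∃ r : M → ℝ, IsLocalDefiningFunction n D p r ∧ 0 < fderiv ℝ (r ∘ e.symm) (e p) v

end Domains

section CanonicalExtension

variable {n : ℕ} {M : Type*} [TopologicalSpace M] [ChartedSpace (Cn (n + 1)) M]

/-- The frame `∂/∂x₁, ∂/∂y₁, ∂/∂x₂, ∂/∂y₂, …` of `ℂⁿ⁺¹`. -/
def realFrame (n : ℕ) (i : Fin (n + 1 + n + 1)) : Cn (n + 1) :=
  Pi.single ⟨i.val / 2, by omega⟩ (if i.val % 2 = 0 then 1 else Complex.I)

/-- The coefficient `φ₀` in `φ = φ₀ dx₁ ∧ dy₁ ∧ dx₂ ∧ dy₂ ∧ …` of a form of top degree in the chart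
`e`. Thus if `φ` has support in the domain of `e`, then the integral of `φ` over `M` (with the
orientation given by the complex structure) is the Lebesgue integral of `φ₀` over `e.target`. -/
def topCoeff (φ : DiffForm (n + 1) M (n + 1 + n + 1)) (e : OpenPartialHomeomorph M (Cn (n + 1)))
    (y : Cn (n + 1)) : ℂ :=
  inChart φ e y (realFrame n)

/-- `T` is the canonical extension `ce f` of the function `f` on the domain `Ω = ⋂ D_j`. -/
structure IsCanonicalExtension {N : ℕ} (D : Fin N → Set M) (Ω : Set M) (f : M → ℂ)
    (T : Distribution0 n M) : Prop where
  /-- `T` restricted to `Ω` is `f`. (Equality of distributions on `Ω` being a local property, it is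
  tested on forms with support in `Ω` and in a coordinate neighbourhood.) -/
  restrict_eq : ∀ e ∈ holoCharts (n + 1) M, ∀ φ : testForms (n + 1) M (n + 1 + n + 1),
    tsupport φ.1 ⊆ Ω ∩ e.source →
    T.toLinearMap φ = ∫ y in e.target, f (e.symm y) * topCoeff φ.1 e y
  /-- `⟨T, φ⟩ = lim_{ε ↓ 0} ∫_Ω f(z - εv) φ(z)` if `φ` is supported in the coordinate neighbourhood
  of `e` and, in its coordinates, `v` points outward from `D_j` along `∂D_j ∩ supp φ` for
  all `j`. -/
  tendsto : ∀ e ∈ holoCharts (n + 1) M, ∀ φ : testForms (n + 1) M (n + 1 + n + 1),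
    ∀ v : Cn (n + 1), tsupport φ.1 ⊆ e.source →
    (∀ j, ∀ p ∈ frontier (D j) ∩ tsupport φ.1,
      PointsOutward (n + 1) (D j) e v p) →
    Tendsto (fun ε : ℝ => ∫ y in e.target ∩ e.symm ⁻¹' Ω,
      f (e.symm (y - ε • v)) * topCoeff φ.1 e y) (𝓝[>] 0) (𝓝 (T.toLinearMap φ))
  /-- If `f` extends continuously to the closure of `Ω`, then `T` is integration of (the extension
  of) `f` over the closure of `Ω`. -/
  eq_of_continuousOn : ∀ g : M → ℂ, ContinuousOn g (closure Ω) → EqOn g f Ω →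
    ∀ e ∈ holoCharts (n + 1) M, ∀ φ : testForms (n + 1) M (n + 1 + n + 1),
    tsupport φ.1 ⊆ e.source →
    T.toLinearMap φ = ∫ y in e.target ∩ e.symm ⁻¹' (closure Ω), g (e.symm y) * topCoeff φ.1 e y

end CanonicalExtension

end

end BoundaryCurrents

/-!
Near a point where the boundaries of `D_j`, `j ∈ S`, meet, genericity provides vector fields `X_j`
of type `(0,1)` with `X_j r_i = δ_ij`. If `h` is holomorphic and bounded on `Ω` and `u` is a test
function, then `∫_Ω h u = -∫_Ω h r_j div(u X_j)`: no derivative falls on `h`, and there are no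
boundary terms because `r_j` vanishes on one face and `X_j` is tangential to the others. Iteration
gives `∫_Ω h u = ∫_Ω h (∏ r_j)^K Q_K u` with a differential operator `Q_K`, due to S. Bell.

For `f` of polynomial growth and large `K` the right-hand side makes sense with `h = f`, and by
means of a partition of unity it defines the canonical extension. The translates of `f` along an
outward vector are bounded near the closure of `Ω`, so they satisfy Bell's identity, and the limit
formula follows by dominated convergence. Every test form is a sum of forms to which the limit
formula applies. Hence the extension is unique, and it annihilates the forms that vanish on `Ω`,
among them `∂̄ω` if `∂̄ω = 0` on the closure of `Ω`.
-/

namespace BoundaryCurrents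

noncomputable section

section AntilinearDerivative

variable {E : Type*} [NormedAddCommGroup E] [NormedSpace ℝ E] [NormedSpace ℂ E]

/-- Twice the antilinear part of the real derivative of `u` at `y`, applied to `w`; in `ℂⁿ` this is
`2 ∑ₗ w̄ₗ ∂u/∂z̄ₗ`. -/
def dbarDir (w : E) (u : E → ℂ) (y : E) : ℂ :=
  fderiv ℝ u y w + Complex.I * fderiv ℝ u y (Complex.I • w)

variable {w y : E} {u v : E → ℂ}

lemma dbarDir_add (hu : DifferentiableAt ℝ u y) (hv : DifferentiableAt ℝ v y) :
    dbarDir w (u + v) y = dbarDir w u y + dbarDir w v y := by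
  simp only [dbarDir, fderiv_add hu hv, add_apply]
  ring

lemma dbarDir_mul (hu : DifferentiableAt ℝ u y) (hv : DifferentiableAt ℝ v y) :
    dbarDir w (u * v) y = u y * dbarDir w v y + v y * dbarDir w u y := by
  simp only [dbarDir, fderiv_mul hu hv, add_apply, smul_apply, smul_eq_mul]
  ring

lemma dbarDir_const_smul (a : ℂ) (hu : DifferentiableAt ℝ u y) :
    dbarDir w (a • u) y = a * dbarDir w u y := by
  simp only [dbarDir, fderiv_const_smul hu, smul_apply, smul_eq_mul]
  ring

lemma dbarDir_eq_zero_of_eventuallyEq_const {a : ℂ} (h : u =ᶠ[𝓝 y] fun _ => a) :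
    dbarDir w u y = 0 := by
  simp [dbarDir, h.fderiv_eq]

lemma dbarDir_eq_zero_of_differentiableAt [IsScalarTower ℝ ℂ E] (hu : DifferentiableAt ℂ u y) :
    dbarDir w u y = 0 := by
  simp only [dbarDir, hu.fderiv_restrictScalars ℝ, ContinuousLinearMap.coe_restrictScalars',
    map_smul, smul_eq_mul, ← mul_assoc, Complex.I_mul_I]
  ring

lemma dbarDir_real_comp {r : E → ℝ} {k : ℝ → ℝ} (hr : DifferentiableAt ℝ r y)
    (hk : DifferentiableAt ℝ k (r y)) :
    dbarDir w (fun z => (k (r z) : ℂ)) y =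
      ((deriv k (r y) : ℝ) : ℂ) * dbarDir w (fun z => (r z : ℂ)) y := by
  have h_r : HasFDerivAt (fun z => (r z : ℂ)) (Complex.ofRealCLM.comp (fderiv ℝ r y)) y :=
    Complex.ofRealCLM.hasFDerivAt.comp y hr.hasFDerivAt
  have h_kr : HasFDerivAt (fun z => (k (r z) : ℂ))
      (Complex.ofRealCLM.comp (deriv k (r y) • fderiv ℝ r y)) y :=
    Complex.ofRealCLM.hasFDerivAt.comp y (hk.hasDerivAt.comp_hasFDerivAt y hr.hasFDerivAt)
  simp only [dbarDir, h_r.fderiv, h_kr.fderiv, ContinuousLinearMap.comp_apply, smul_apply,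
    smul_eq_mul, Complex.ofRealCLM_apply, Complex.ofReal_mul]
  ring

lemma contDiff_dbarDir (hu : ContDiff ℝ ∞ u) : ContDiff ℝ ∞ (dbarDir w u) := by
  have h : ContDiff ℝ ∞ (fderiv ℝ u) := hu.fderiv_right (by simp)
  unfold dbarDir
  exact (h.clm_apply contDiff_const).add (contDiff_const.mul (h.clm_apply contDiff_const))

lemma tsupport_dbarDir_subset : tsupport (dbarDir w u) ⊆ tsupport u :=
  closure_minimal (fun _ hy => by_contra fun h =>
    hy (dbarDir_eq_zero_of_eventuallyEq_const (notMem_tsupport_iff_eventuallyEq.1 h)))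
    (isClosed_tsupport u)

end AntilinearDerivative

section IntegrationByParts

lemma exists_bound_fderiv_of_isCompact {E F : Type*} [NormedAddCommGroup E] [NormedSpace ℂ E]
    [ProperSpace E] [NormedAddCommGroup F] [NormedSpace ℂ F] {h : E → F} {O L : Set E}
    (hO : IsOpen O) (hh : DifferentiableOn ℂ h O) (hL : IsCompact L) (hLO : L ⊆ O) :
    ∃ C, ∀ y ∈ L, ‖fderiv ℂ h y‖ ≤ C := by
  obtain ⟨ρ, hρ, hρO⟩ := hL.exists_cthickening_subset_open hO hLO
  obtain ⟨C, hC⟩ := hL.cthickening.exists_bound_of_continuousOn (hh.continuousOn.mono hρO)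
  refine ⟨2 * C / ρ, fun y hy => ?_⟩
  have hball : Metric.ball y ρ ⊆ Metric.cthickening ρ L :=
    Metric.ball_subset_closedBall.trans (Metric.closedBall_subset_cthickening hy ρ)
  refine Complex.norm_fderiv_le_div_of_mapsTo_ball (hh.mono (hball.trans hρO)) (fun z hz => ?_) hρ
  rw [Metric.mem_closedBall, dist_eq_norm]
  linarith [norm_sub_le (h z) (h y), hC z (hball hz), hC y (hball (Metric.mem_ball_self hρ))]

lemma integrable_mul_of_bound_on_tsupport {X : Type*} [TopologicalSpace X] [MeasurableSpace X]
    [OpensMeasurableSpace X] {μ : Measure X} [IsFiniteMeasureOnCompacts μ] {h g : X → ℂ} {C : ℝ}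
    (hh : AEStronglyMeasurable h μ) (hg : Continuous g) (hgc : HasCompactSupport g)
    (hC : ∀ y ∈ tsupport g, ‖h y‖ ≤ C) : Integrable (fun y => h y * g y) μ := by
  rw [← integrableOn_iff_integrable_of_support_subset (s := tsupport g)
    ((Function.support_mul_subset_right h g).trans (subset_tsupport g))]
  exact (hg.integrable_of_hasCompactSupport hgc).integrableOn.bdd_mul hh.restrict
    (ae_restrict_of_forall_mem (isClosed_tsupport g).measurableSet hC)

lemma integrable_mul_of_continuousOn {X : Type*} [TopologicalSpace X] [MeasurableSpace X]
    [OpensMeasurableSpace X] {μ : Measure X} [IsFiniteMeasureOnCompacts μ] {h g : X → ℂ}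
    {O : Set X} (hO : IsOpen O) (hh : ContinuousOn h O) (hg : Continuous g)
    (hgc : HasCompactSupport g) (hgO : tsupport g ⊆ O) : Integrable (fun y => h y * g y) μ := by
  have hcont : Continuous (h * g) := continuous_of_tsupport fun y hy =>
    (hh.continuousAt (hO.mem_nhds (hgO (tsupport_mul_subset_right hy)))).mul hg.continuousAt
  exact hcont.integrable_of_hasCompactSupport hgc.mul_left

lemma integrableOn_mul_of_continuousOn_of_bound {X : Type*} [TopologicalSpace X]
    [MeasurableSpace X] [OpensMeasurableSpace X] {μ : Measure X} [IsFiniteMeasureOnCompacts μ]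
    {h g : X → ℂ} {s : Set X} {C : ℝ} (hs : MeasurableSet s) (hh : ContinuousOn h (s ∩ tsupport g))
    (hg : Continuous g) (hgc : HasCompactSupport g) (hC : ∀ y ∈ s ∩ tsupport g, ‖h y‖ ≤ C) :
    IntegrableOn (fun y => h y * g y) s μ := by
  have h_meas : MeasurableSet (s ∩ tsupport g) := hs.inter (isClosed_tsupport g).measurableSet
  refine IntegrableOn.of_forall_sdiff_eq_zero (s := s ∩ tsupport g) ?_ hs fun y hy => ?_
  · exact (hg.integrable_of_hasCompactSupport hgc).integrableOn.bdd_mul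
      (hh.aestronglyMeasurable h_meas) (ae_restrict_of_forall_mem h_meas hC)
  · rw [image_eq_zero_of_notMem_tsupport fun hyg => hy.2 ⟨hy.1, hyg⟩, mul_zero]

lemma integral_fderiv_apply_eq_zero {E : Type*} [NormedAddCommGroup E] [NormedSpace ℝ E]
    [FiniteDimensional ℝ E] [MeasurableSpace E] [BorelSpace E] {μ : Measure E} [μ.IsAddHaarMeasure]
    {F : E → ℂ} (hF : Differentiable ℝ F) (hFi : Integrable F μ) (w : E)
    (hF' : Integrable (fun y => fderiv ℝ F y w) μ) : ∫ y, fderiv ℝ F y w ∂μ = 0 := by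
  simpa using integral_mul_fderiv_eq_neg_fderiv_mul_of_integrable (μ := μ) (f := fun _ => (1 : ℂ))
    (g := F) (v := w) (by simp) (by simpa using hF') (by simpa using hFi)
    (fun _ _ => differentiableAt_const _) fun y _ => hF y

variable {E : Type*} [NormedAddCommGroup E] [NormedSpace ℝ E] [NormedSpace ℂ E]
  [IsScalarTower ℝ ℂ E] {h g : E → ℂ} {O : Set E} {y : E}

lemma hasFDerivAt_mul_of_tsupport_subset (hO : IsOpen O) (hh : DifferentiableOn ℂ h O)
    (hg : Differentiable ℝ g) (hgO : tsupport g ⊆ O) :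
    HasFDerivAt (h * g) (h y • fderiv ℝ g y + g y • fderiv ℝ h y) y := by
  by_cases hy : y ∈ tsupport g
  · have hhy := (hh.differentiableAt (hO.mem_nhds (hgO hy))).restrictScalars ℝ
    exact hhy.hasFDerivAt.mul (hg y).hasFDerivAt
  · have hg0 := notMem_tsupport_iff_eventuallyEq.1 hy
    have hhg0 : h * g =ᶠ[𝓝 y] 0 := by filter_upwards [hg0] with z hz; simp [hz]
    have h_zero : h y • fderiv ℝ g y + g y • fderiv ℝ h y = 0 := by
      ext
      simp [hg0.fderiv_eq, hg0.self_of_nhds]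
    rw [h_zero]
    exact (hasFDerivAt_const (0 : ℂ) y).congr_of_eventuallyEq hhg0

variable [MeasurableSpace E] [BorelSpace E] [FiniteDimensional ℝ E] {μ : Measure E}
  [μ.IsAddHaarMeasure]

lemma integrable_fderiv_mul_apply (hO : IsOpen O) (hh : DifferentiableOn ℂ h O)
    (hg : ContDiff ℝ 1 g) (hgc : HasCompactSupport g) (hgO : tsupport g ⊆ O) (w : E) :
    Integrable (fun y => fderiv ℝ (h * g) y w) μ := by
  have : ProperSpace E := FiniteDimensional.proper ℝ E
  obtain ⟨C, hC⟩ := exists_bound_fderiv_of_isCompact hO hh hgc hgO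
  have h_left : Integrable (fun y => h y * fderiv ℝ g y w) μ :=
    integrable_mul_of_continuousOn hO hh.continuousOn
      ((hg.continuous_fderiv (by simp)).clm_apply continuous_const) (hgc.fderiv_apply ℝ w)
      ((tsupport_fderiv_apply_subset ℝ w).trans hgO)
  have h_right : Integrable (fun y => fderiv ℝ h y w * g y) μ := by
    refine integrable_mul_of_bound_on_tsupport (C := C * ‖w‖)
      (measurable_fderiv_apply_const ℝ h w).aestronglyMeasurable hg.continuous hgc fun y hy => ?_
    rw [(hh.differentiableAt (hO.mem_nhds (hgO hy))).fderiv_restrictScalars ℝ]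
    exact (fderiv ℂ h y).le_of_opNorm_le (hC y hy) w
  refine (h_left.add h_right).congr (Eventually.of_forall fun y => ?_)
  have h_fderiv := (hasFDerivAt_mul_of_tsupport_subset (y := y) hO hh
    (hg.differentiable (by simp)) hgO).fderiv
  simp [h_fderiv, mul_comm]

lemma integral_mul_dbarDir_eq_zero (hO : IsOpen O) (hh : DifferentiableOn ℂ h O)
    (hg : ContDiff ℝ 1 g) (hgc : HasCompactSupport g) (hgO : tsupport g ⊆ O) (w : E) :
    ∫ y, h y * dbarDir w g y ∂μ = 0 := by
  have hgd : Differentiable ℝ g := hg.differentiable (by simp)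
  have h_dbar : ∀ y, h y * dbarDir w g y = dbarDir w (h * g) y := by
    intro y
    have h_hol : g y * dbarDir w h y = 0 := by
      by_cases hy : y ∈ tsupport g
      · rw [dbarDir_eq_zero_of_differentiableAt (hh.differentiableAt (hO.mem_nhds (hgO hy))),
          mul_zero]
      · rw [image_eq_zero_of_notMem_tsupport hy, zero_mul]
    simp only [dbarDir, (hasFDerivAt_mul_of_tsupport_subset hO hh hgd hgO).fderiv, add_apply,
      smul_apply, smul_eq_mul] at h_hol ⊢
    linear_combination -h_hol
  have hdiff : Differentiable ℝ (h * g) := fun y =>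
    (hasFDerivAt_mul_of_tsupport_subset hO hh hgd hgO).differentiableAt
  have hint : Integrable (h * g) μ :=
    integrable_mul_of_continuousOn hO hh.continuousOn hg.continuous hgc hgO
  have hint' := integrable_fderiv_mul_apply (μ := μ) hO hh hg hgc hgO
  simp only [h_dbar]
  unfold dbarDir
  rw [integral_add (hint' w) ((hint' _).const_mul _), integral_const_mul,
    integral_fderiv_apply_eq_zero hdiff hint _ (hint' w),
    integral_fderiv_apply_eq_zero hdiff hint _ (hint' _), mul_zero, add_zero]

end IntegrationByParts

/-- A smooth vector field of type `(0,1)`, encoded as a combination `∑ₗ cₗ ∂̄_{wₗ}` of constant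
ones, `∂̄_w` being `dbarDir w`. -/
structure AntiholomorphicField (E : Type*) [NormedAddCommGroup E] [NormedSpace ℝ E]
    (ι : Type*) where
  coeff : ι → E → ℂ
  dir : ι → E
  contDiff_coeff : ∀ l, ContDiff ℝ ∞ (coeff l)

namespace AntiholomorphicField

variable {E : Type*} [NormedAddCommGroup E] [NormedSpace ℝ E] [NormedSpace ℂ E]
  {ι : Type*} [Fintype ι] (X : AntiholomorphicField E ι) {u v : E → ℂ} {y : E}

/-- The field as a derivation. -/
def lieDeriv (u : E → ℂ) (y : E) : ℂ := ∑ l, X.coeff l y * dbarDir (X.dir l) u y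

/-- Minus the formal transpose of the derivation `X.lieDeriv`. -/
def divMul (u : E → ℂ) (y : E) : ℂ := ∑ l, dbarDir (X.dir l) (X.coeff l * u) y

lemma contDiff_divMul (hu : ContDiff ℝ ∞ u) : ContDiff ℝ ∞ (X.divMul u) := by
  unfold divMul
  exact ContDiff.sum fun l _ => contDiff_dbarDir ((X.contDiff_coeff l).mul hu)

lemma tsupport_divMul_subset : tsupport (X.divMul u) ⊆ tsupport u := by
  refine closure_minimal (fun y hy => by_contra fun h => hy ?_) (isClosed_tsupport u)
  exact Finset.sum_eq_zero fun l _ => image_eq_zero_of_notMem_tsupport fun h' =>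
    h (tsupport_mul_subset_right (tsupport_dbarDir_subset h'))

lemma lieDeriv_mul (hu : DifferentiableAt ℝ u y) (hv : DifferentiableAt ℝ v y) :
    X.lieDeriv (u * v) y = u y * X.lieDeriv v y + v y * X.lieDeriv u y := by
  simp only [lieDeriv, dbarDir_mul hu hv, Finset.mul_sum, ← Finset.sum_add_distrib]
  exact Finset.sum_congr rfl fun l _ => by ring

lemma lieDeriv_const (a : ℂ) : X.lieDeriv (fun _ => a) y = 0 :=
  Finset.sum_eq_zero fun l _ => by
    rw [dbarDir_eq_zero_of_eventuallyEq_const (EventuallyEq.refl _ _), mul_zero]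

lemma lieDeriv_real_comp {r : E → ℝ} {k : ℝ → ℝ} (hr : DifferentiableAt ℝ r y)
    (hk : DifferentiableAt ℝ k (r y)) : X.lieDeriv (fun z => (k (r z) : ℂ)) y =
      ((deriv k (r y) : ℝ) : ℂ) * X.lieDeriv (fun z => (r z : ℂ)) y := by
  simp only [lieDeriv, dbarDir_real_comp hr hk, Finset.mul_sum]
  exact Finset.sum_congr rfl fun l _ => by ring

lemma lieDeriv_prod_eq_zero {α : Type*} {F : α → E → ℂ} (A : Finset α)
    (hF : ∀ i ∈ A, DifferentiableAt ℝ (F i) y) (h : ∀ i ∈ A, X.lieDeriv (F i) y = 0) :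
    X.lieDeriv (∏ i ∈ A, F i) y = 0 := by
  classical
  induction A using Finset.induction_on with
  | empty => exact X.lieDeriv_const 1
  | insert a A ha ih =>
    rw [Finset.forall_mem_insert] at hF h
    have hd : DifferentiableAt ℝ (∏ i ∈ A, F i) y := Finset.prod_fn A F ▸
      (HasFDerivAt.finsetProd fun i hi => (hF.2 i hi).hasFDerivAt).differentiableAt
    rw [Finset.prod_insert ha, X.lieDeriv_mul hF.1 hd, ih hF.2 h.2, h.1, mul_zero, mul_zero,
      add_zero]

lemma divMul_mul (hu : DifferentiableAt ℝ u y) (hv : DifferentiableAt ℝ v y) :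
    X.divMul (u * v) y = u y * X.divMul v y + v y * X.lieDeriv u y := by
  simp only [lieDeriv, divMul, Finset.mul_sum, ← Finset.sum_add_distrib]
  refine Finset.sum_congr rfl fun l _ => ?_
  have hc : DifferentiableAt ℝ (X.coeff l) y := (X.contDiff_coeff l).differentiable (by simp) y
  rw [mul_left_comm (X.coeff l) u v, dbarDir_mul hu (hc.mul hv), Pi.mul_apply]
  ring

lemma divMul_add (hu : Differentiable ℝ u) (hv : Differentiable ℝ v) :
    X.divMul (u + v) = X.divMul u + X.divMul v := by
  funext y
  simp only [divMul, mul_add, Pi.add_apply, ← Finset.sum_add_distrib]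
  have hc l : Differentiable ℝ (X.coeff l) := (X.contDiff_coeff l).differentiable (by simp)
  exact Finset.sum_congr rfl fun l _ => dbarDir_add ((hc l).mul hu y) ((hc l).mul hv y)

lemma divMul_const_smul (a : ℂ) (hu : Differentiable ℝ u) :
    X.divMul (a • u) = a • X.divMul u := by
  funext y
  simp only [divMul, mul_smul_comm, Pi.smul_apply, Finset.smul_sum]
  have hc l : Differentiable ℝ (X.coeff l) := (X.contDiff_coeff l).differentiable (by simp)
  exact Finset.sum_congr rfl fun l _ => dbarDir_const_smul a ((hc l).mul hu y)

lemma integral_mul_divMul_eq_zero [IsScalarTower ℝ ℂ E] [MeasurableSpace E] [BorelSpace E]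
    [FiniteDimensional ℝ E] {μ : Measure E} [μ.IsAddHaarMeasure] {h g : E → ℂ} {O : Set E}
    (hO : IsOpen O) (hh : DifferentiableOn ℂ h O) (hg : ContDiff ℝ ∞ g)
    (hgc : HasCompactSupport g) (hgO : tsupport g ⊆ O) : ∫ y, h y * X.divMul g y ∂μ = 0 := by
  have hs l : tsupport (X.coeff l * g) ⊆ O := tsupport_mul_subset_right.trans hgO
  have hc l : ContDiff ℝ ∞ (X.coeff l * g) := (X.contDiff_coeff l).mul hg
  have hcc l : HasCompactSupport (X.coeff l * g) := hgc.mul_left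
  simp only [divMul, Finset.mul_sum]
  rw [integral_finsetSum]
  · exact Finset.sum_eq_zero fun l _ => integral_mul_dbarDir_eq_zero hO hh
      ((hc l).of_le (by exact_mod_cast le_top)) (hcc l) (hs l) _
  · intro l _
    exact integrable_mul_of_continuousOn hO hh.continuousOn (contDiff_dbarDir (hc l)).continuous
      ((hcc l).mono' ((subset_tsupport _).trans tsupport_dbarDir_subset))
      (tsupport_dbarDir_subset.trans (hs l))

end AntiholomorphicField

section Cutoff

/-- A smooth function on `ℝ` that equals `1` on `(-∞, -2]` and vanishes on `[-1, ∞)`. -/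
def negCutoff (t : ℝ) : ℝ := Real.smoothTransition (-1 - t)

lemma contDiff_negCutoff : ContDiff ℝ ∞ negCutoff :=
  Real.smoothTransition.contDiff.comp (contDiff_const.sub contDiff_id)

lemma abs_negCutoff_le_one (t : ℝ) : |negCutoff t| ≤ 1 :=
  (abs_of_nonneg (Real.smoothTransition.nonneg _)).trans_le (Real.smoothTransition.le_one _)

lemma negCutoff_of_le {t : ℝ} (ht : t ≤ -2) : negCutoff t = 1 :=
  Real.smoothTransition.one_of_one_le (by linarith)

lemma negCutoff_of_ge {t : ℝ} (ht : -1 ≤ t) : negCutoff t = 0 :=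
  Real.smoothTransition.zero_of_nonpos (by linarith)

/-- A smooth function on `ℝ` that equals the identity on `(-∞, -2]` and vanishes on `[-1, ∞)`. -/
def cutId (t : ℝ) : ℝ := t * negCutoff t

lemma contDiff_cutId : ContDiff ℝ ∞ cutId := contDiff_id.mul contDiff_negCutoff

lemma cutId_of_le {t : ℝ} (ht : t ≤ -2) : cutId t = t := by rw [cutId, negCutoff_of_le ht, mul_one]

lemma cutId_of_ge {t : ℝ} (ht : -1 ≤ t) : cutId t = 0 := by rw [cutId, negCutoff_of_ge ht, mul_zero]

lemma abs_cutId_le (t : ℝ) : |cutId t| ≤ |t| := by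
  rw [cutId, abs_mul]
  exact mul_le_of_le_one_right (abs_nonneg _) (abs_negCutoff_le_one t)

lemma deriv_cutId_of_lt {t : ℝ} (ht : t < -2) : deriv cutId t = 1 := by
  have h : cutId =ᶠ[𝓝 t] id := by
    filter_upwards [Iio_mem_nhds ht] with s hs using cutId_of_le hs.le
  rw [h.deriv_eq, deriv_id]

lemma deriv_cutId_of_gt {t : ℝ} (ht : -1 < t) : deriv cutId t = 0 := by
  have h : cutId =ᶠ[𝓝 t] fun _ => 0 := by
    filter_upwards [Ioi_mem_nhds ht] with s hs using cutId_of_ge hs.le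
  rw [h.deriv_eq, deriv_const]

lemma exists_bound_deriv_cutId : ∃ C, ∀ t, |deriv cutId t| ≤ C := by
  obtain ⟨C, hC⟩ := (isCompact_Icc (a := (-2 : ℝ)) (b := -1)).exists_bound_of_continuousOn
    (contDiff_cutId.continuous_deriv (by simp)).continuousOn
  refine ⟨max C 1, fun t => ?_⟩
  rcases lt_or_ge t (-2) with h | h
  · simp [deriv_cutId_of_lt h]
  rcases lt_or_ge (-1) t with h' | h'
  · simp [deriv_cutId_of_gt h']
  · exact (hC t ⟨h, h'⟩).trans (le_max_left _ _)

lemma deriv_inv_mul_cutId_mul {a : ℝ} (ha : a ≠ 0) (t : ℝ) :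
    deriv (fun t => a⁻¹ * cutId (a * t)) t = deriv cutId (a * t) := by
  rw [deriv_const_mul_field, deriv_comp_mul_left a cutId t, smul_eq_mul, inv_mul_cancel_left₀ ha]

end Cutoff

section SmoothConvergence

variable {E F G : Type*} [NormedAddCommGroup E] [NormedSpace ℝ E] [NormedAddCommGroup F]
  [NormedSpace ℝ F] [NormedAddCommGroup G] [NormedSpace ℝ G] {L s : Set E}

/-- All derivatives of `u ν` tend to `0`, uniformly on `L`. -/
def SmoothlyTendstoZero (L : Set E) (u : ℕ → E → F) : Prop :=
  ∀ k : ℕ, TendstoUniformlyOn (fun ν => iteratedFDeriv ℝ k (u ν)) 0 atTop L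

lemma smoothlyTendstoZero_iff {u : ℕ → E → F} : SmoothlyTendstoZero L u ↔
    ∀ k : ℕ, ∀ ε > 0, ∀ᶠ ν in atTop, ∀ y ∈ L, ‖iteratedFDeriv ℝ k (u ν) y‖ < ε := by
  simp [SmoothlyTendstoZero, Metric.tendstoUniformlyOn_iff, dist_zero_left]

lemma smoothlyTendstoZero_zero (L : Set E) : SmoothlyTendstoZero L (0 : ℕ → E → F) := by
  rw [smoothlyTendstoZero_iff]
  intro k ε hε
  filter_upwards with ν y _
  simpa [iteratedFDeriv_zero] using hε

namespace SmoothlyTendstoZero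

lemma of_bound {u : ℕ → E → F} {v : ℕ → E → G} (hu : SmoothlyTendstoZero L u)
    (h : ∀ k, ∃ C : ℝ, ∃ N : ℕ, ∀ ν, ∀ y ∈ L, ‖iteratedFDeriv ℝ k (v ν) y‖ ≤
      C * ∑ i ∈ Finset.range N, ‖iteratedFDeriv ℝ i (u ν) y‖) : SmoothlyTendstoZero L v := by
  rw [smoothlyTendstoZero_iff] at hu ⊢
  intro k ε hε
  obtain ⟨C, N, hC⟩ := h k
  have hD : 0 < (|C| + 1) * (N + 1) := by positivity
  have h_small : ∀ᶠ ν in atTop, ∀ i ∈ Finset.range N, ∀ y ∈ L,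
      ‖iteratedFDeriv ℝ i (u ν) y‖ < ε / ((|C| + 1) * (N + 1)) :=
    (Finset.eventually_all _).2 fun i _ => hu i _ (div_pos hε hD)
  filter_upwards [h_small] with ν hν y hy
  calc ‖iteratedFDeriv ℝ k (v ν) y‖
      ≤ C * ∑ i ∈ Finset.range N, ‖iteratedFDeriv ℝ i (u ν) y‖ := hC ν y hy
    _ ≤ |C| * ∑ i ∈ Finset.range N, ε / ((|C| + 1) * (N + 1)) := by
        gcongr with i hi
        · exact le_abs_self C
        · exact (hν i hi y hy).le
    _ = ε * (|C| * N / ((|C| + 1) * (N + 1))) := by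
        rw [Finset.sum_const, Finset.card_range, nsmul_eq_mul]
        ring
    _ < ε := mul_lt_of_lt_one_right hε ((div_lt_one hD).2 (by nlinarith [abs_nonneg C]))

lemma congr {u v : ℕ → E → F} (hu : SmoothlyTendstoZero L u) (hs : IsOpen s) (hL : L ⊆ s)
    (h : ∀ ν, EqOn (u ν) (v ν) s) : SmoothlyTendstoZero L v := by
  refine fun k => (hu k).congr (Eventually.of_forall fun ν y hy => ?_)
  exact (((h ν).eventuallyEq_of_mem (hs.mem_nhds (hL hy))).iteratedFDeriv ℝ k).self_of_nhds

lemma clm_comp {u : ℕ → E → F} (hu : SmoothlyTendstoZero L u) (hs : IsOpen s) (hL : L ⊆ s)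
    (hus : ∀ ν, ContDiffOn ℝ ∞ (u ν) s) (A : F →L[ℝ] G) :
    SmoothlyTendstoZero L (fun ν => A ∘ u ν) := by
  refine hu.of_bound fun k => ⟨‖A‖, k + 1, fun ν y hy => ?_⟩
  refine (A.norm_iteratedFDeriv_comp_left ((hus ν).contDiffAt (hs.mem_nhds (hL hy)))
    (by exact_mod_cast le_top)).trans (mul_le_mul_of_nonneg_left ?_ (norm_nonneg _))
  exact Finset.single_le_sum (f := fun i => ‖iteratedFDeriv ℝ i (u ν) y‖)
    (fun _ _ => norm_nonneg _) (Finset.self_mem_range_succ k)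

lemma fderiv {u : ℕ → E → F} (hu : SmoothlyTendstoZero L u) :
    SmoothlyTendstoZero L (fun ν => fderiv ℝ (u ν)) := by
  rw [smoothlyTendstoZero_iff] at hu ⊢
  intro k ε hε
  filter_upwards [hu (k + 1) ε hε] with ν hν y hy
  rw [norm_iteratedFDeriv_fderiv]
  exact hν y hy

lemma add {u v : ℕ → E → F} (hu : SmoothlyTendstoZero L u) (hv : SmoothlyTendstoZero L v)
    (hus : ∀ ν, ContDiff ℝ ∞ (u ν)) (hvs : ∀ ν, ContDiff ℝ ∞ (v ν)) :
    SmoothlyTendstoZero L (u + v) := by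
  rw [smoothlyTendstoZero_iff] at *
  intro k ε hε
  filter_upwards [hu k (ε / 2) (by positivity), hv k (ε / 2) (by positivity)] with ν hu' hv' y hy
  rw [Pi.add_apply, iteratedFDeriv_add_apply ((hus ν).contDiffAt.of_le (by exact_mod_cast le_top))
    ((hvs ν).contDiffAt.of_le (by exact_mod_cast le_top))]
  linarith [norm_add_le (iteratedFDeriv ℝ k (u ν) y) (iteratedFDeriv ℝ k (v ν) y), hu' y hy,
    hv' y hy]

lemma sum {α : Type*} {u : α → ℕ → E → F} (A : Finset α) (hu : ∀ i, SmoothlyTendstoZero L (u i))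
    (hus : ∀ i ν, ContDiff ℝ ∞ (u i ν)) : SmoothlyTendstoZero L (∑ i ∈ A, u i) := by
  classical
  induction A using Finset.induction_on with
  | empty => exact smoothlyTendstoZero_zero L
  | insert a A ha ih =>
    rw [Finset.sum_insert ha]
    refine (hu a).add ih (hus a) fun ν => ?_
    simp only [Finset.sum_apply, Finset.sum_fn]
    exact ContDiff.sum fun i _ => hus i ν

lemma mul {u : ℕ → E → ℂ} {a : E → ℂ} (hu : SmoothlyTendstoZero L u) (hs : IsOpen s) (hL : L ⊆ s)
    (hLc : IsCompact L) (hus : ∀ ν, ContDiffOn ℝ ∞ (u ν) s) (ha : ContDiffOn ℝ ∞ a s) :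
    SmoothlyTendstoZero L (fun ν => a * u ν) := by
  have h_bound : ∀ i : ℕ, ∃ B, ∀ y ∈ L, ‖iteratedFDeriv ℝ i a y‖ ≤ B := fun i => by
    have h_cont : ContinuousOn (iteratedFDerivWithin ℝ i a s) s :=
      ha.continuousOn_iteratedFDerivWithin (by exact_mod_cast le_top) hs.uniqueDiffOn
    refine hLc.exists_bound_of_continuousOn ((h_cont.congr fun y hy => ?_).mono hL)
    exact (iteratedFDerivWithin_of_isOpen i hs hy).symm
  choose B hB using h_bound
  refine hu.of_bound fun k => ⟨∑ i ∈ Finset.range (k + 1), k.choose i * |B i|, k + 1,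
    fun ν y hy => ?_⟩
  have h_leibniz := norm_iteratedFDerivWithin_mul_le ha (hus ν) hs.uniqueDiffOn (hL hy) (n := k)
    (by exact_mod_cast le_top)
  simp only [iteratedFDerivWithin_of_isOpen _ hs (hL hy)] at h_leibniz
  refine h_leibniz.trans ?_
  rw [Finset.sum_mul]
  gcongr with i
  · exact (hB i y hy).trans (le_abs_self _)
  · exact Finset.single_le_sum (f := fun i => ‖iteratedFDeriv ℝ i (u ν) y‖)
      (fun _ _ => norm_nonneg _) (Finset.mem_range.2 (by omega))

lemma dbarDir [NormedSpace ℂ E] {u : ℕ → E → ℂ} (hu : SmoothlyTendstoZero L u)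
    (hus : ∀ ν, ContDiff ℝ ∞ (u ν)) (w : E) : SmoothlyTendstoZero L (fun ν => dbarDir w (u ν)) := by
  let A : (E →L[ℝ] ℂ) →L[ℝ] ℂ := ContinuousLinearMap.apply ℝ ℂ w +
    Complex.I • ContinuousLinearMap.apply ℝ ℂ (Complex.I • w)
  exact hu.fderiv.clm_comp isOpen_univ (subset_univ _)
    (fun ν => ((hus ν).fderiv_right (by simp)).contDiffOn) A

end SmoothlyTendstoZero

end SmoothConvergence

/-- Operators on the smooth functions with the properties of linear differential operators with
smooth coefficients. -/
structure IsSmoothLocalOperator {E : Type*} [NormedAddCommGroup E] [NormedSpace ℝ E]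
    (Q : (E → ℂ) → E → ℂ) : Prop where
  contDiff : ∀ {u}, ContDiff ℝ ∞ u → ContDiff ℝ ∞ (Q u)
  map_add : ∀ {u v}, ContDiff ℝ ∞ u → ContDiff ℝ ∞ v → Q (u + v) = Q u + Q v
  map_const_smul : ∀ (a : ℂ) {u}, ContDiff ℝ ∞ u → Q (a • u) = a • Q u
  tsupport_subset : ∀ u, tsupport (Q u) ⊆ tsupport u
  tendsto : ∀ {L}, IsCompact L → ∀ {u : ℕ → E → ℂ}, (∀ ν, ContDiff ℝ ∞ (u ν)) →
    SmoothlyTendstoZero L u → SmoothlyTendstoZero L (fun ν => Q (u ν))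

namespace IsSmoothLocalOperator

variable {E : Type*} [NormedAddCommGroup E] [NormedSpace ℝ E] {Q Q' : (E → ℂ) → E → ℂ}

lemma id : IsSmoothLocalOperator (fun u : E → ℂ => u) :=
  ⟨fun h => h, fun _ _ => rfl, fun _ _ _ => rfl, fun _ => Subset.rfl, fun _ _ _ h => h⟩

lemma comp (h : IsSmoothLocalOperator Q) (h' : IsSmoothLocalOperator Q') :
    IsSmoothLocalOperator fun u => Q (Q' u) where
  contDiff hu := h.contDiff (h'.contDiff hu)
  map_add hu hv := by rw [h'.map_add hu hv, h.map_add (h'.contDiff hu) (h'.contDiff hv)]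
  map_const_smul a _ hu := by rw [h'.map_const_smul a hu, h.map_const_smul a (h'.contDiff hu)]
  tsupport_subset u := (h.tsupport_subset _).trans (h'.tsupport_subset u)
  tendsto hL _ hu hut := h.tendsto hL (fun ν => h'.contDiff (hu ν)) (h'.tendsto hL hu hut)

lemma const_smul (h : IsSmoothLocalOperator Q) (a : ℂ) :
    IsSmoothLocalOperator fun u => a • Q u where
  contDiff hu := contDiff_const.smul (h.contDiff hu)
  map_add hu hv := by rw [h.map_add hu hv, smul_add]
  map_const_smul b _ hu := by rw [h.map_const_smul b hu, smul_comm]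
  tsupport_subset u :=
    (closure_mono (Function.support_const_smul_subset a (Q u))).trans (h.tsupport_subset u)
  tendsto hL _ hu hut := (h.tendsto hL hu hut).mul isOpen_univ (subset_univ _) hL
    (fun ν => (h.contDiff (hu ν)).contDiffOn) (contDiffOn_const (c := a))

end IsSmoothLocalOperator

lemma AntiholomorphicField.isSmoothLocalOperator_divMul {E : Type*} [NormedAddCommGroup E]
    [NormedSpace ℝ E] [NormedSpace ℂ E] {ι : Type*} [Fintype ι] (X : AntiholomorphicField E ι) :
    IsSmoothLocalOperator X.divMul where
  contDiff hu := X.contDiff_divMul hu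
  map_add hu hv := X.divMul_add (hu.differentiable (by simp)) (hv.differentiable (by simp))
  map_const_smul a _ hu := X.divMul_const_smul a (hu.differentiable (by simp))
  tsupport_subset _ := X.tsupport_divMul_subset
  tendsto hL u hu hut := by
    have h_eq : (fun ν => X.divMul (u ν)) =
        ∑ l, fun ν => dbarDir (X.dir l) (X.coeff l * u ν) := by
      ext ν y
      simp [divMul]
    rw [h_eq]
    have hc l ν : ContDiff ℝ ∞ (X.coeff l * u ν) := (X.contDiff_coeff l).mul (hu ν)
    refine SmoothlyTendstoZero.sum Finset.univ (fun l => ?_) fun l ν => contDiff_dbarDir (hc l ν)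
    exact (hut.mul isOpen_univ (subset_univ _) hL (fun ν => (hu ν).contDiffOn)
      (X.contDiff_coeff l).contDiffOn).dbarDir (hc l) (X.dir l)

/-- A local model of a corner: smooth functions `r i` together with vector fields `X j` of type
`(0,1)` that form, on `W`, a dual family of the differentials of the `r i`. -/
structure CornerModel (E : Type*) [NormedAddCommGroup E] [NormedSpace ℝ E] [NormedSpace ℂ E]
    (ι : Type*) [Fintype ι] [DecidableEq ι] where
  r : ι → E → ℝ
  X : ι → AntiholomorphicField E ι
  W : Set E
  isOpen_W : IsOpen W
  contDiff_r : ∀ i, ContDiff ℝ ∞ (r i)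
  dual : ∀ y ∈ W, ∀ j i, (X j).lieDeriv (fun z => (r i z : ℂ)) y = if i = j then 1 else 0

namespace CornerModel

variable {E : Type*} [NormedAddCommGroup E] [NormedSpace ℝ E] [NormedSpace ℂ E]
  {ι : Type*} [Fintype ι] [DecidableEq ι] (m : CornerModel E ι) {u h : E → ℂ} {y : E}

/-- The set where all `r i` are negative. -/
def region : Set E := {y | ∀ i, m.r i y < 0}

lemma isOpen_region : IsOpen m.region := by
  simp only [region, ofPred_forall]
  exact isOpen_iInter_of_finite fun i => isOpen_lt (m.contDiff_r i).continuous continuous_const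

lemma contDiff_ofReal_comp_r {k : ℝ → ℝ} (hk : ContDiff ℝ ∞ k) (i : ι) :
    ContDiff ℝ ∞ fun y => (k (m.r i y) : ℂ) :=
  Complex.ofRealCLM.contDiff.comp (hk.comp (m.contDiff_r i))

lemma lieDeriv_real_comp {k : ℝ → ℝ} (hk : Differentiable ℝ k) (hy : y ∈ m.W) (j i : ι) :
    (m.X j).lieDeriv (fun z => (k (m.r i z) : ℂ)) y =
      if i = j then ((deriv k (m.r i y) : ℝ) : ℂ) else 0 := by
  have hr : DifferentiableAt ℝ (m.r i) y := (m.contDiff_r i).differentiable (by simp) y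
  rw [(m.X j).lieDeriv_real_comp hr (hk _), m.dual y hy, mul_ite, mul_one, mul_zero]

/-- A smooth cutoff function of the set where all `r i` with `i ≠ j` are negative, which tends to
its indicator function for `a → ∞`. -/
def cut (j : ι) (a : ℝ) : E → ℂ :=
  ∏ i ∈ Finset.univ.erase j, fun y => ((negCutoff (a * m.r i y) : ℝ) : ℂ)

lemma contDiff_negCutoff_mul (a : ℝ) : ContDiff ℝ ∞ fun t => negCutoff (a * t) :=
  contDiff_negCutoff.comp (contDiff_const.mul contDiff_id)

lemma contDiff_cut (j : ι) (a : ℝ) : ContDiff ℝ ∞ (m.cut j a) := by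
  unfold cut
  rw [Finset.prod_fn]
  exact contDiff_prod fun i _ => m.contDiff_ofReal_comp_r (contDiff_negCutoff_mul a) i

lemma norm_cut_le_one (j : ι) (a : ℝ) (y : E) : ‖m.cut j a y‖ ≤ 1 := by
  rw [cut, Finset.prod_apply, norm_prod]
  refine Finset.prod_le_one (fun _ _ => norm_nonneg _) fun i _ => ?_
  rw [Complex.norm_real]
  exact abs_negCutoff_le_one _

lemma lieDeriv_cut_eq_zero (j : ι) (a : ℝ) (hy : y ∈ m.W) :
    (m.X j).lieDeriv (m.cut j a) y = 0 := by
  have hk := contDiff_negCutoff_mul a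
  refine (m.X j).lieDeriv_prod_eq_zero _ (fun i _ => ?_) fun i hi => ?_
  · exact (m.contDiff_ofReal_comp_r hk i).differentiable (by simp) y
  · rw [m.lieDeriv_real_comp (hk.differentiable (by simp)) hy, if_neg (Finset.ne_of_mem_erase hi)]

/-- A smooth approximation of `r j` on `m.region`, supported in `m.region`. -/
def approx (j : ι) (a : ℝ) : E → ℂ :=
  (fun y => ((a⁻¹ * cutId (a * m.r j y) : ℝ) : ℂ)) * m.cut j a

lemma contDiff_inv_mul_cutId_mul (a : ℝ) : ContDiff ℝ ∞ fun t => a⁻¹ * cutId (a * t) :=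
  contDiff_const.mul (contDiff_cutId.comp (contDiff_const.mul contDiff_id))

lemma contDiff_approx (j : ι) (a : ℝ) : ContDiff ℝ ∞ (m.approx j a) :=
  (m.contDiff_ofReal_comp_r (contDiff_inv_mul_cutId_mul a) j).mul (m.contDiff_cut j a)

lemma norm_approx_le (j : ι) {a : ℝ} (ha : a ≠ 0) (y : E) : ‖m.approx j a y‖ ≤ |m.r j y| := by
  rw [approx, Pi.mul_apply, norm_mul, Complex.norm_real, Real.norm_eq_abs]
  calc |a⁻¹ * cutId (a * m.r j y)| * ‖m.cut j a y‖
      ≤ |a⁻¹ * cutId (a * m.r j y)| :=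
        mul_le_of_le_one_right (abs_nonneg _) (m.norm_cut_le_one j a y)
    _ ≤ |a⁻¹| * |a * m.r j y| := by
        rw [abs_mul]
        exact mul_le_mul_of_nonneg_left (abs_cutId_le _) (abs_nonneg _)
    _ = |m.r j y| := by rw [← abs_mul, inv_mul_cancel_left₀ ha]

lemma lieDeriv_approx (j : ι) {a : ℝ} (ha : a ≠ 0) (hy : y ∈ m.W) :
    (m.X j).lieDeriv (m.approx j a) y =
      ((deriv cutId (a * m.r j y) : ℝ) : ℂ) * m.cut j a y := by
  have hk := contDiff_inv_mul_cutId_mul a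
  rw [approx, (m.X j).lieDeriv_mul ((m.contDiff_ofReal_comp_r hk j).differentiable (by simp) y)
    ((m.contDiff_cut j a).differentiable (by simp) y), m.lieDeriv_cut_eq_zero j a hy,
    m.lieDeriv_real_comp (hk.differentiable (by simp)) hy, if_pos rfl,
    deriv_inv_mul_cutId_mul ha, mul_zero, zero_add, mul_comm]

lemma approx_eq_zero {j i : ι} {a : ℝ} (hi : -1 ≤ a * m.r i y) : m.approx j a y = 0 := by
  rcases eq_or_ne i j with rfl | hij
  · simp [approx, cutId_of_ge hi]
  · rw [approx, Pi.mul_apply, cut, Finset.prod_apply, Finset.prod_eq_zero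
      (Finset.mem_erase.2 ⟨hij, Finset.mem_univ i⟩) (by simp [negCutoff_of_ge hi]), mul_zero]

lemma tsupport_approx_subset (j : ι) {a : ℝ} (ha : 0 < a) : tsupport (m.approx j a) ⊆ m.region := by
  have h_subset : tsupport (m.approx j a) ⊆ ⋂ i, {y | a * m.r i y ≤ -1} :=
    closure_minimal (fun y hy => mem_iInter.2 fun i =>
        le_of_not_ge fun hi => hy (m.approx_eq_zero hi))
      (isClosed_iInter fun i => isClosed_le
        (continuous_const.mul (m.contDiff_r i).continuous) continuous_const)
  refine h_subset.trans fun y hy i => neg_of_mul_neg_right ?_ ha.le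
  exact (mem_iInter.1 hy i).trans_lt (by norm_num)

lemma eventually_approx_eq (j : ι) (hy : y ∈ m.region) :
    ∀ᶠ ν : ℕ in atTop, m.approx j (ν + 1) y = m.r j y ∧
      ((deriv cutId ((ν + 1) * m.r j y) : ℝ) : ℂ) * m.cut j (ν + 1) y = 1 := by
  have h_far : ∀ᶠ ν : ℕ in atTop, ∀ i, ((ν : ℝ) + 1) * m.r i y < -2 :=
    eventually_all.2 fun i => ((tendsto_atTop_add_const_right _ _
      tendsto_natCast_atTop_atTop).atTop_mul_const_of_neg (hy i)).eventually_lt_atBot _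
  filter_upwards [h_far] with ν hν
  have h_cut : m.cut j (ν + 1) y = 1 := by
    rw [cut, Finset.prod_apply]
    exact Finset.prod_eq_one fun i _ => by rw [negCutoff_of_le (hν i).le, Complex.ofReal_one]
  rw [approx, Pi.mul_apply, h_cut, cutId_of_le (hν j).le, deriv_cutId_of_lt (hν j),
    inv_mul_cancel_left₀ ν.cast_add_one_ne_zero]
  simp

lemma divMul_approx_mul (j : ι) {a : ℝ} (ha : a ≠ 0) (hu : ContDiff ℝ ∞ u)
    (huW : tsupport u ⊆ m.W) (y : E) :
    (m.X j).divMul (m.approx j a * u) y = m.approx j a y * (m.X j).divMul u y +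
      u y * (((deriv cutId (a * m.r j y) : ℝ) : ℂ) * m.cut j a y) := by
  rw [(m.X j).divMul_mul ((m.contDiff_approx j a).differentiable (by simp) y)
    (hu.differentiable (by simp) y)]
  by_cases hy : y ∈ tsupport u
  · rw [m.lieDeriv_approx j ha (huW hy)]
  · rw [image_eq_zero_of_notMem_tsupport hy, zero_mul, zero_mul]

lemma norm_divMul_approx_mul_le (j : ι) {a : ℝ} (ha : a ≠ 0) (hu : ContDiff ℝ ∞ u)
    (huW : tsupport u ⊆ m.W) {C : ℝ} (hC : ∀ t, |deriv cutId t| ≤ C) (y : E) :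
    ‖(m.X j).divMul (m.approx j a * u) y‖ ≤
      |m.r j y| * ‖(m.X j).divMul u y‖ + ‖u y‖ * C := by
  rw [m.divMul_approx_mul j ha hu huW]
  refine (norm_add_le _ _).trans ?_
  rw [norm_mul, norm_mul, norm_mul, Complex.norm_real, Real.norm_eq_abs]
  gcongr
  · exact m.norm_approx_le j ha y
  · exact (mul_le_of_le_one_right (abs_nonneg _) (m.norm_cut_le_one j a y)).trans (hC _)

lemma tsupport_divMul_approx_mul_subset (j : ι) {a : ℝ} (ha : 0 < a) :
    tsupport ((m.X j).divMul (m.approx j a * u)) ⊆ m.region ∩ tsupport u :=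
  (m.X j).tsupport_divMul_subset.trans (subset_inter
    (tsupport_mul_subset_left.trans (m.tsupport_approx_subset j ha)) tsupport_mul_subset_right)

lemma tendsto_divMul_approx_mul (j : ι) (hu : ContDiff ℝ ∞ u) (huW : tsupport u ⊆ m.W) (y : E) :
    Tendsto (fun ν : ℕ => (m.X j).divMul (m.approx j (ν + 1) * u) y) atTop
      (𝓝 (m.region.indicator (fun y => u y + m.r j y * (m.X j).divMul u y) y)) := by
  refine tendsto_const_nhds.congr' ?_
  by_cases hy : y ∈ m.region
  · filter_upwards [m.eventually_approx_eq j hy] with ν hν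
    rw [indicator_of_mem hy, m.divMul_approx_mul j ν.cast_add_one_ne_zero hu huW, hν.1, hν.2]
    ring
  · filter_upwards with ν
    rw [indicator_of_notMem hy]
    exact (image_eq_zero_of_notMem_tsupport fun h' =>
      hy (m.tsupport_divMul_approx_mul_subset j ν.cast_add_one_pos h').1).symm

/-- The test functions on the set `m.W`. -/
structure IsTestFunction (u : E → ℂ) : Prop where
  contDiff : ContDiff ℝ ∞ u
  hasCompactSupport : HasCompactSupport u
  tsupport_subset : tsupport u ⊆ m.W

/-- The functions against which the test function `u` is integrated over `m.region`. -/
structure IsAdmissible (u h : E → ℂ) : Prop where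
  exists_isOpen : ∃ O, IsOpen O ∧ DifferentiableOn ℂ h O ∧ m.region ∩ tsupport u ⊆ O
  exists_bound : ∃ C, ∀ y ∈ m.region ∩ tsupport u, ‖h y‖ ≤ C

variable {m}

lemma IsTestFunction.map {Q : (E → ℂ) → E → ℂ} (hu : m.IsTestFunction u)
    (hQ : IsSmoothLocalOperator Q) : m.IsTestFunction (Q u) where
  contDiff := hQ.contDiff hu.contDiff
  hasCompactSupport := hu.hasCompactSupport.mono' ((subset_tsupport _).trans (hQ.tsupport_subset u))
  tsupport_subset := (hQ.tsupport_subset u).trans hu.tsupport_subset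

lemma IsTestFunction.mul_left {g : E → ℂ} (hu : m.IsTestFunction u) (hg : ContDiff ℝ ∞ g) :
    m.IsTestFunction (g * u) where
  contDiff := hg.mul hu.contDiff
  hasCompactSupport := hu.hasCompactSupport.mul_left
  tsupport_subset := tsupport_mul_subset_right.trans hu.tsupport_subset

lemma IsAdmissible.mono {v : E → ℂ} (hh : m.IsAdmissible u h) (huv : tsupport v ⊆ tsupport u) :
    m.IsAdmissible v h := by
  obtain ⟨⟨O, hO, hd, hs⟩, C, hC⟩ := hh
  have h_subset := inter_subset_inter_right m.region huv
  exact ⟨⟨O, hO, hd, h_subset.trans hs⟩, C, fun y hy => hC y (h_subset hy)⟩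

variable [MeasurableSpace E] [BorelSpace E] {μ : Measure E}

lemma IsAdmissible.integrableOn [IsFiniteMeasureOnCompacts μ] {g : E → ℂ}
    (hh : m.IsAdmissible u h) (hg : Continuous g) (hgc : HasCompactSupport g)
    (hgu : tsupport g ⊆ tsupport u) : IntegrableOn (fun y => h y * g y) m.region μ := by
  obtain ⟨⟨O, _, hd, hs⟩, C, hC⟩ := hh.mono hgu
  exact integrableOn_mul_of_continuousOn_of_bound m.isOpen_region.measurableSet
    (hd.continuousOn.mono hs) hg hgc hC

variable [IsScalarTower ℝ ℂ E] [FiniteDimensional ℝ E] [μ.IsAddHaarMeasure]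

/-- No boundary terms occur since `r j` vanishes on the face `j` and `X j` is tangential to the
other faces. -/
lemma IsTestFunction.setIntegral_mul_add_eq_zero (hu : m.IsTestFunction u)
    (hh : m.IsAdmissible u h) (j : ι) :
    ∫ y in m.region, h y * (u y + m.r j y * (m.X j).divMul u y) ∂μ = 0 := by
  obtain ⟨⟨O, hO, hd, hs⟩, C, hC⟩ := hh
  obtain ⟨C₀, hC₀⟩ := exists_bound_deriv_cutId
  have h_pos (ν : ℕ) : (0 : ℝ) < ν + 1 := ν.cast_add_one_pos
  have h_supp (ν : ℕ) : tsupport ((m.X j).divMul (m.approx j (ν + 1) * u)) ⊆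
      m.region ∩ tsupport u :=
    m.tsupport_divMul_approx_mul_subset j (h_pos ν)
  have h_test (ν : ℕ) := hu.mul_left (m.contDiff_approx j (ν + 1))
  have h_div (ν : ℕ) := (h_test ν).map (m.X j).isSmoothLocalOperator_divMul
  have h_zero (ν : ℕ) : ∫ y, h y * (m.X j).divMul (m.approx j (ν + 1) * u) y ∂μ = 0 :=
    (m.X j).integral_mul_divMul_eq_zero hO hd (h_test ν).contDiff (h_test ν).hasCompactSupport
      ((subset_inter (tsupport_mul_subset_left.trans (m.tsupport_approx_subset j (h_pos ν)))
        tsupport_mul_subset_right).trans hs)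
  have h_meas (ν : ℕ) :=
    (integrable_mul_of_continuousOn (μ := μ) hO hd.continuousOn (h_div ν).contDiff.continuous
      (h_div ν).hasCompactSupport ((h_supp ν).trans hs)).aestronglyMeasurable
  let B : E → ℝ := fun y => |C| * (|m.r j y| * ‖(m.X j).divMul u y‖ + ‖u y‖ * C₀)
  have hB : Integrable B μ := by
    have hDu := hu.map (m.X j).isSmoothLocalOperator_divMul
    refine Integrable.const_mul (Integrable.add ?_ ?_) _
    · exact ((m.contDiff_r j).continuous.abs.mul hDu.contDiff.continuous.norm
        ).integrable_of_hasCompactSupport hDu.hasCompactSupport.norm.mul_left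
    · exact (hu.contDiff.continuous.norm.integrable_of_hasCompactSupport
        hu.hasCompactSupport.norm).mul_const C₀
  have h_lim := tendsto_integral_of_dominated_convergence B h_meas hB
    (fun ν => Eventually.of_forall fun y => ?_)
    (Eventually.of_forall fun y => (m.tendsto_divMul_approx_mul j hu.contDiff hu.tsupport_subset
      y).const_mul (h y))
  · simp only [h_zero, ← indicator_mul_right] at h_lim
    rw [← integral_indicator m.isOpen_region.measurableSet]
    exact tendsto_nhds_unique h_lim tendsto_const_nhds
  · have h_le := m.norm_divMul_approx_mul_le j (h_pos ν).ne' hu.contDiff hu.tsupport_subset hC₀ y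
    by_cases hy : y ∈ m.region ∩ tsupport u
    · rw [norm_mul]
      exact mul_le_mul ((hC y hy).trans (le_abs_self C)) h_le (norm_nonneg _) (abs_nonneg C)
    · rw [image_eq_zero_of_notMem_tsupport fun h' => hy (h_supp ν h'), mul_zero, norm_zero]
      exact mul_nonneg (abs_nonneg C) ((norm_nonneg _).trans h_le)

end CornerModel

namespace CornerModel

variable {E : Type*} [NormedAddCommGroup E] [NormedSpace ℝ E] [NormedSpace ℂ E]
  {ι : Type*} [Fintype ι] [DecidableEq ι] (m : CornerModel E ι) {u h : E → ℂ} {y : E}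

/-- The product of the functions `r i` with the multiplicities prescribed by `s`. -/
def monomial (s : Multiset ι) (y : E) : ℂ := (s.map fun i => (m.r i y : ℂ)).prod

lemma monomial_cons (i : ι) (s : Multiset ι) :
    m.monomial (i ::ₘ s) = (fun y => (m.r i y : ℂ)) * m.monomial s := by
  funext y
  simp [monomial]

lemma monomial_nsmul_univ (K : ℕ) (y : E) :
    m.monomial (K • Finset.univ.val) y = ∏ i, (m.r i y : ℂ) ^ K := by
  rw [monomial, Multiset.map_nsmul, Multiset.prod_nsmul, Finset.prod_pow]
  rfl

lemma contDiff_monomial (s : Multiset ι) : ContDiff ℝ ∞ (m.monomial s) := by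
  induction s using Multiset.induction_on with
  | empty => exact contDiff_const
  | cons i s ih =>
    rw [m.monomial_cons]
    exact (m.contDiff_ofReal_comp_r contDiff_id i).mul ih

lemma r_mul_lieDeriv_monomial (hy : y ∈ m.W) (j : ι) (s : Multiset ι) :
    m.r j y * (m.X j).lieDeriv (m.monomial s) y = s.count j * m.monomial s y := by
  induction s using Multiset.induction_on with
  | empty =>
    have h_one : m.monomial 0 = fun _ => 1 := by
      funext _
      simp [monomial]
    rw [h_one, (m.X j).lieDeriv_const, Multiset.count_zero, Nat.cast_zero, mul_zero, zero_mul]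
  | cons i s ih =>
    have hr : ContDiff ℝ ∞ fun y => (m.r i y : ℂ) := m.contDiff_ofReal_comp_r contDiff_id i
    rw [m.monomial_cons, (m.X j).lieDeriv_mul (hr.differentiable (by simp) y)
      ((m.contDiff_monomial s).differentiable (by simp) y), m.dual y hy, Pi.mul_apply,
      Multiset.count_cons]
    by_cases hij : i = j
    · rw [if_pos hij, if_pos hij.symm, hij]
      push_cast
      linear_combination (m.r j y : ℂ) * ih
    · rw [if_neg hij, if_neg (Ne.symm hij)]
      linear_combination (m.r i y : ℂ) * ih

variable [IsScalarTower ℝ ℂ E] [FiniteDimensional ℝ E] [MeasurableSpace E] [BorelSpace E]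
  {μ : Measure E} [μ.IsAddHaarMeasure] {m}

lemma IsTestFunction.setIntegral_monomial_cons (hu : m.IsTestFunction u) (hh : m.IsAdmissible u h)
    (j : ι) (s : Multiset ι) :
    ∫ y in m.region, h y * (m.monomial s y * u y) ∂μ =
      ∫ y in m.region, h y * (m.monomial (j ::ₘ s) y *
        (-((s.count j : ℂ) + 1)⁻¹ • (m.X j).divMul u) y) ∂μ := by
  have hDu := hu.map (m.X j).isSmoothLocalOperator_divMul
  have hs := m.contDiff_monomial s
  have h_expand : ∀ y, h y * ((m.monomial s * u) y +
      m.r j y * (m.X j).divMul (m.monomial s * u) y) =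
      (s.count j + 1) * (h y * (m.monomial s y * u y)) +
        h y * (m.monomial (j ::ₘ s) y * (m.X j).divMul u y) := by
    intro y
    rw [(m.X j).divMul_mul (hs.differentiable (by simp) y) (hu.contDiff.differentiable (by simp) y),
      m.monomial_cons, Pi.mul_apply, Pi.mul_apply]
    by_cases hy : y ∈ tsupport u
    · linear_combination h y * u y * m.r_mul_lieDeriv_monomial (hu.tsupport_subset hy) j s
    · rw [image_eq_zero_of_notMem_tsupport hy]
      ring
  have h_parts := (hu.mul_left hs).setIntegral_mul_add_eq_zero (μ := μ)
    (hh.mono tsupport_mul_subset_right) j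
  have h_int : IntegrableOn (fun y => h y * (m.monomial s y * u y)) m.region μ :=
    hh.integrableOn (hu.mul_left hs).contDiff.continuous (hu.mul_left hs).hasCompactSupport
      tsupport_mul_subset_right
  have h_int' : IntegrableOn (fun y => h y * (m.monomial (j ::ₘ s) y * (m.X j).divMul u y))
      m.region μ :=
    have hDu' := hDu.mul_left (m.contDiff_monomial (j ::ₘ s))
    hh.integrableOn hDu'.contDiff.continuous hDu'.hasCompactSupport
      (tsupport_mul_subset_right.trans (m.X j).tsupport_divMul_subset)
  simp only [h_expand] at h_parts
  rw [integral_add (h_int.const_mul _) h_int', integral_const_mul] at h_parts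
  simp only [Pi.smul_apply, smul_eq_mul, mul_left_comm _ (-((s.count j : ℂ) + 1)⁻¹)]
  rw [integral_const_mul]
  have h_ne : (s.count j : ℂ) + 1 ≠ 0 := Nat.cast_add_one_ne_zero _
  rw [eq_neg_of_add_eq_zero_right h_parts, neg_mul_neg, inv_mul_cancel_left₀ h_ne]

variable (m μ)

lemma exists_operator_monomial (s : Multiset ι) :
    ∃ Q, IsSmoothLocalOperator Q ∧ ∀ u h, m.IsTestFunction u → m.IsAdmissible u h →
      ∫ y in m.region, h y * u y ∂μ = ∫ y in m.region, h y * (m.monomial s y * Q u y) ∂μ := by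
  induction s using Multiset.induction_on with
  | empty => exact ⟨_, IsSmoothLocalOperator.id, fun u h _ _ => by simp [monomial]⟩
  | cons j s ih =>
    obtain ⟨Q, hQ, h_eq⟩ := ih
    refine ⟨_, ((m.X j).isSmoothLocalOperator_divMul.const_smul
      (-((s.count j : ℂ) + 1)⁻¹)).comp hQ, fun u h hu hh => ?_⟩
    rw [h_eq u h hu hh]
    exact (hu.map hQ).setIntegral_monomial_cons (hh.mono (hQ.tsupport_subset u)) j s

/-- An operator `Q` after S. Bell: multiplied with a function that vanishes to order `K` on each
face, `Q u` has the same integrals as `u` against the admissible functions. -/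
structure IsBellOperator (K : ℕ) (Q : (E → ℂ) → E → ℂ) : Prop where
  isSmoothLocalOperator : IsSmoothLocalOperator Q
  setIntegral_eq : ∀ u h, m.IsTestFunction u → m.IsAdmissible u h →
    ∫ y in m.region, h y * u y ∂μ = ∫ y in m.region, h y * ((∏ i, (m.r i y : ℂ) ^ K) * Q u y) ∂μ

lemma exists_isBellOperator (K : ℕ) : ∃ Q, m.IsBellOperator μ K Q := by
  obtain ⟨Q, hQ, h_eq⟩ := m.exists_operator_monomial μ (K • Finset.univ.val)
  simp only [m.monomial_nsmul_univ] at h_eq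
  exact ⟨Q, hQ, h_eq⟩

end CornerModel

section LevelSets

variable {E F : Type*} [NormedAddCommGroup E] [NormedSpace ℝ E] [NormedAddCommGroup F]
  [NormedSpace ℝ F]

lemma exists_contDiff_eventuallyEq [FiniteDimensional ℝ E] {g : E → F} {s : Set E} {p : E}
    (hs : IsOpen s) (hp : p ∈ s) (hg : ContDiffOn ℝ ∞ g s) :
    ∃ G : E → F, ContDiff ℝ ∞ G ∧ G =ᶠ[𝓝 p] g := by
  obtain ⟨ε, hε, hεs⟩ := Metric.nhds_basis_closedBall.mem_iff.1 (hs.mem_nhds hp)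
  let b : ContDiffBump p := ⟨ε / 2, ε, half_pos hε, half_lt_self hε⟩
  have hbs : tsupport b ⊆ s := b.tsupport_eq.trans_subset hεs
  refine ⟨fun y => b y • g y, contMDiff_iff_contDiff.1 (contMDiff_of_tsupport fun y hy => ?_), ?_⟩
  · have hys : y ∈ s := hbs (tsupport_smul_subset_left _ _ hy)
    exact (b.contDiff.contDiffAt.smul (hg.contDiffAt (hs.mem_nhds hys))).contMDiffAt
  · filter_upwards [b.eventuallyEq_one] with z hz
    rw [hz, Pi.one_apply, one_smul]

lemma exists_pos_apply_of_ne_zero {A : E →L[ℝ] ℝ} (hA : A ≠ 0) : ∃ v, 0 < A v := by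
  obtain ⟨v, hv⟩ := A.exists_ne_zero hA
  rcases hv.lt_or_gt with hv | hv
  · exact ⟨-v, by rwa [map_neg, neg_pos]⟩
  · exact ⟨v, hv⟩

lemma eventually_mul_le_sub {r : E → ℝ} {r' : E →L[ℝ] ℝ} {y v : E} (hr : HasStrictFDerivAt r r' y)
    (hv : 0 < r' v) :
    ∀ᶠ q : E × E in 𝓝 (y, y), ∀ t : ℝ, 0 < t → q.1 - q.2 = t • v →
      t * (r' v / 2) ≤ r q.1 - r q.2 := by
  filter_upwards [hr.isLittleO.def (c := r' v / (2 * (‖v‖ + 1))) (by positivity)] with q hq t ht hqt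
  rw [hqt, map_smul, smul_eq_mul, norm_smul, Real.norm_eq_abs, Real.norm_of_nonneg ht.le] at hq
  have h_half : r' v / (2 * (‖v‖ + 1)) * (t * ‖v‖) ≤ t * (r' v / 2) := by
    rw [div_mul_eq_mul_div, div_le_iff₀ (by positivity)]
    nlinarith [mul_pos ht hv]
  linarith [(abs_le.1 hq).1]

lemma eventually_le_half_of_pos_fderiv {r : E → ℝ} {y v : E} (hr : ContDiffAt ℝ 1 r y)
    (hy : r y ≤ 0) (hv : r y = 0 → 0 < fderiv ℝ r y v) :
    ∀ᶠ q : E × ℝ in 𝓝 y ×ˢ 𝓝[>] 0, r q.1 ≤ 0 →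
      r (q.1 - q.2 • v) < 0 ∧ r (q.1 - q.2 • v) ≤ r q.1 / 2 := by
  have h_base : Tendsto (fun q : E × ℝ => q.1) (𝓝 y ×ˢ 𝓝[>] 0) (𝓝 y) := tendsto_fst
  have h_time : Tendsto (fun q : E × ℝ => q.2) (𝓝 y ×ˢ 𝓝[>] 0) (𝓝[>] 0) := tendsto_snd
  have h_shift : Tendsto (fun q : E × ℝ => q.1 - q.2 • v) (𝓝 y ×ˢ 𝓝[>] 0) (𝓝 y) := by
    simpa using h_base.sub ((h_time.mono_right nhdsWithin_le_nhds).smul_const v)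
  rcases hy.lt_or_eq with hneg | hzero
  · filter_upwards [(hr.continuousAt.tendsto.comp h_shift).eventually_lt_const
        (show r y < 3 / 4 * r y by linarith),
      (hr.continuousAt.tendsto.comp h_base).eventually_const_lt
        (show 3 / 2 * r y < r y by linarith)] with q h_upper h_lower _
    rw [Function.comp_apply] at h_upper h_lower
    constructor <;> linarith
  · have h_decr := (h_base.prodMk_nhds h_shift).eventually
      (eventually_mul_le_sub (hr.hasStrictFDerivAt one_ne_zero) (hv hzero))
    filter_upwards [h_decr, h_time.eventually eventually_mem_nhdsWithin] with q hq hpos hle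
    have := hq q.2 hpos (sub_sub_cancel _ _)
    have := mul_pos (mem_Ioi.1 hpos) (half_pos (hv hzero))
    constructor <;> linarith

lemma eventually_neg_of_fderiv_neg {r : E → ℝ} {y w : E} (hr : DifferentiableAt ℝ r y)
    (hy : r y = 0) (hw : fderiv ℝ r y w < 0) : ∀ᶠ t : ℝ in 𝓝[>] 0, r (y + t • w) < 0 := by
  have h_slope := (hr.hasFDerivAt.hasLineDerivAt w).tendsto_slope_zero_right
  filter_upwards [h_slope.eventually_lt_const hw, eventually_mem_nhdsWithin] with t ht htp
  rw [hy, sub_zero, smul_eq_mul] at ht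
  exact neg_of_mul_neg_right ht (inv_nonneg.2 (mem_Ioi.1 htp).le)

lemma fderiv_nonpos_of_eventually_neg {r : E → ℝ} {y w : E} (hr : DifferentiableAt ℝ r y)
    (hy : r y = 0) (hw : ∀ᶠ t : ℝ in 𝓝[>] 0, r (y + t • w) < 0) : fderiv ℝ r y w ≤ 0 := by
  refine le_of_tendsto (hr.hasFDerivAt.hasLineDerivAt w).tendsto_slope_zero_right ?_
  filter_upwards [hw, eventually_mem_nhdsWithin] with t ht htp
  rw [hy, sub_zero, smul_eq_mul]
  exact mul_nonpos_of_nonneg_of_nonpos (inv_nonneg.2 (mem_Ioi.1 htp).le) ht.le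

lemma fderiv_pos_of_eventually_neg_iff {r r' : E → ℝ} {y v : E} (hr : DifferentiableAt ℝ r y)
    (hr' : DifferentiableAt ℝ r' y) (hy : r y = 0) (hy' : r' y = 0)
    (h_iff : ∀ᶠ z in 𝓝 y, r z < 0 ↔ r' z < 0) (h_ne : fderiv ℝ r y ≠ 0)
    (hv : 0 < fderiv ℝ r' y v) : 0 < fderiv ℝ r y v := by
  have h_nonpos : ∀ w, fderiv ℝ r' y w < 0 → fderiv ℝ r y w ≤ 0 := by
    intro w hw
    have h_line : Tendsto (fun t : ℝ => y + t • w) (𝓝[>] 0) (𝓝 y) := by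
      have h_cont : Continuous fun t : ℝ => y + t • w := by fun_prop
      simpa using (h_cont.tendsto 0).mono_left nhdsWithin_le_nhds
    refine fderiv_nonpos_of_eventually_neg hr hy ?_
    filter_upwards [eventually_neg_of_fderiv_neg hr' hy' hw, h_line.eventually h_iff] with t ht hzt
    exact hzt.2 ht
  obtain ⟨w, hw⟩ := exists_pos_apply_of_ne_zero h_ne
  have h_perturb : ∀ᶠ t : ℝ in 𝓝[>] 0, fderiv ℝ r' y (t • w - v) < 0 := by
    have h_cont : Continuous fun t : ℝ => fderiv ℝ r' y (t • w - v) := by fun_prop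
    refine nhdsWithin_le_nhds ((h_cont.tendsto 0).eventually_lt_const ?_)
    simpa using hv
  obtain ⟨t, ht, htp⟩ := (h_perturb.and eventually_mem_nhdsWithin).exists
  have h_le := h_nonpos _ ht
  rw [map_sub, map_smul, smul_eq_mul] at h_le
  linarith [mul_pos (mem_Ioi.1 htp) hw]

variable [MeasurableSpace E] [BorelSpace E] [FiniteDimensional ℝ E] (μ : Measure E)
  [μ.IsAddHaarMeasure]

lemma addHaar_eq_zero_of_sub_ne_smul {S : Set E} (hS : MeasurableSet S) (v : E)
    (h_ne : ∀ x ∈ S, ∀ y ∈ S, ∀ t : ℝ, 0 < t → x - y ≠ t • v) : μ S = 0 := by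
  refine Measure.addHaar_eq_zero_of_disjoint_translates μ (fun k : ℕ => (1 / ((k : ℝ) + 1)) • v)
    ?_ ((pairwise_disjoint_on _).2 fun k l hkl => disjoint_left.2 ?_) hS
  · refine (Metric.isBounded_closedBall (x := (0 : E)) (r := ‖v‖)).subset ?_
    rintro _ ⟨k, rfl⟩
    rw [mem_closedBall_zero_iff, norm_smul, Real.norm_of_nonneg Nat.one_div_pos_of_nat.le]
    exact mul_le_of_le_one_left (norm_nonneg v)
      (div_le_one_of_le₀ (le_add_of_nonneg_left k.cast_nonneg) k.cast_add_one_pos.le)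
  · rintro _ ⟨_, rfl, y, hy, rfl⟩ ⟨_, rfl, x, hx, h_eq⟩
    refine h_ne x hx y hy (1 / (k + 1) - 1 / (l + 1)) (sub_pos.2 (Nat.one_div_lt_one_div hkl)) ?_
    rw [sub_smul, sub_eq_sub_iff_add_eq_add, add_comm x]
    exact h_eq

lemma addHaar_zeroSet_eq_zero {r : E → ℝ} (hr : ContDiff ℝ 1 r) {s : Set E}
    (hs : ∀ y ∈ s, r y = 0 → fderiv ℝ r y ≠ 0) : μ {y ∈ s | r y = 0} = 0 := by
  refine measure_null_of_locally_null _ fun y ⟨hys, hy⟩ => ?_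
  obtain ⟨v, hv⟩ := exists_pos_apply_of_ne_zero (hs y hys hy)
  have h_decr := eventually_mul_le_sub (hr.contDiffAt.hasStrictFDerivAt (x := y) one_ne_zero) hv
  rw [nhds_prod_eq, eventually_prod_self_iff'] at h_decr
  obtain ⟨U, hU, h_decr⟩ := h_decr
  obtain ⟨V, hVU, hVo, hyV⟩ := mem_nhds_iff.1 (eventually_iff.1 hU)
  refine ⟨V ∩ {z | r z = 0}, mem_nhdsWithin.2 ⟨V, hVo, hyV, fun z hz => ⟨hz.1, hz.2.2⟩⟩, ?_⟩
  refine addHaar_eq_zero_of_sub_ne_smul μ (hVo.measurableSet.inter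
    (isClosed_eq hr.continuous continuous_const).measurableSet) v ?_
  rintro x ⟨hxV, hx⟩ z ⟨hzV, hz⟩ t ht h_eq
  have h_le := h_decr (x := x) (hVU hxV) (y := z) (hVU hzV) t ht h_eq
  rw [hx, hz, sub_zero] at h_le
  exact h_le.not_gt (mul_pos ht (half_pos hv))

end LevelSets

section ExistenceOfCornerModels

lemma exists_dual_vectors {K V ι : Type*} [Field K] [AddCommGroup V] [Module K V]
    [FiniteDimensional K V] [Fintype ι] [DecidableEq ι] (A : ι → V →ₗ[K] K)
    (hA : Module.finrank K (⨅ i, (A i).ker : Submodule K V) + Fintype.card ι =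
      Module.finrank K V) :
    ∃ w : ι → V, ∀ i l, A i (w l) = if i = l then 1 else 0 := by
  have h_rank := (LinearMap.pi A).finrank_range_add_finrank_ker
  rw [LinearMap.ker_pi] at h_rank
  have h_surj : (LinearMap.pi A).range = ⊤ := by
    apply Submodule.eq_top_of_finrank_eq
    rw [Module.finrank_fintype_fun_eq_card]
    omega
  choose w hw using fun l => LinearMap.range_eq_top.1 h_surj (Pi.single l 1)
  exact ⟨w, fun i l => by rw [← Pi.single_apply, ← hw l, LinearMap.pi_apply]⟩

variable {E : Type*} [NormedAddCommGroup E] [NormedSpace ℝ E]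
  {ι : Type*} [Fintype ι] [DecidableEq ι]

lemma contDiff_matrix_det {A : E → Matrix ι ι ℂ} (hA : ∀ i j, ContDiff ℝ ∞ fun y => A y i j) :
    ContDiff ℝ ∞ fun y => (A y).det := by
  simp only [Matrix.det_apply]
  exact ContDiff.sum fun σ _ => (contDiff_prod fun i _ => hA _ _).const_smul _

lemma contDiffOn_matrix_inv_apply {A : E → Matrix ι ι ℂ}
    (hA : ∀ i j, ContDiff ℝ ∞ fun y => A y i j) (i j : ι) :
    ContDiffOn ℝ ∞ (fun y => (A y)⁻¹ i j) {y | (A y).det ≠ 0} := by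
  simp only [Matrix.inv_def, Ring.inverse_eq_inv', Matrix.smul_apply, smul_eq_mul,
    Matrix.adjugate_apply]
  refine ((contDiff_matrix_det hA).contDiffOn.inv fun y hy => hy).mul
    (contDiff_matrix_det fun k l => ?_).contDiffOn
  rcases eq_or_ne k j with rfl | hk
  · simp only [Matrix.updateRow_self]
    exact contDiff_const
  · simp only [Matrix.updateRow_ne hk]
    exact hA k l

variable [NormedSpace ℂ E]

lemma exists_dual_antiholomorphicField [FiniteDimensional ℝ E] {r : ι → E → ℝ}
    (hr : ∀ i, ContDiff ℝ ∞ (r i)) {p : E} {w : ι → E}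
    (hw : ∀ i l, dbarDir (w l) (fun z => (r i z : ℂ)) p = if i = l then 1 else 0) :
    ∃ X : ι → AntiholomorphicField E ι, ∀ᶠ y in 𝓝 p, ∀ j i,
      (X j).lieDeriv (fun z => (r i z : ℂ)) y = if i = j then 1 else 0 := by
  let A : E → Matrix ι ι ℂ := fun y => Matrix.of fun i l =>
    dbarDir (w l) (fun z => (r i z : ℂ)) y
  have hA : ∀ i l, ContDiff ℝ ∞ fun y => A y i l := fun i l =>
    contDiff_dbarDir (Complex.ofRealCLM.contDiff.comp (hr i))
  have h_open : IsOpen {y | (A y).det ≠ 0} :=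
    isOpen_ne_fun (contDiff_matrix_det hA).continuous continuous_const
  have hp : p ∈ {y | (A y).det ≠ 0} := by
    have h_one : A p = 1 := by
      ext i l
      exact (hw i l).trans Matrix.one_apply.symm
    rw [mem_ofPred_eq, h_one, Matrix.det_one]
    exact one_ne_zero
  choose c hc hcA using fun j l => exists_contDiff_eventuallyEq h_open hp
    (contDiffOn_matrix_inv_apply hA l j)
  refine ⟨fun j => ⟨c j, w, hc j⟩, ?_⟩
  filter_upwards [h_open.eventually_mem hp, eventually_all.2 fun j => eventually_all.2 (hcA j)]
    with y hy hcy j i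
  have h_inv : (A y * (A y)⁻¹) i j = (1 : Matrix ι ι ℂ) i j := by
    rw [Matrix.mul_nonsing_inv _ (isUnit_iff_ne_zero.2 hy)]
  rw [← Matrix.one_apply, ← h_inv, Matrix.mul_apply]
  exact Finset.sum_congr rfl fun l _ => (congrArg (· * _) (hcy j l)).trans (mul_comm _ _)

variable [IsScalarTower ℝ ℂ E]

lemma dbarDir_ofReal {w y : E} {r : E → ℝ} (hr : DifferentiableAt ℝ r y) :
    dbarDir w (fun z => (r z : ℂ)) y =
      starRingEnd ℂ (StrongDual.extendRCLike (𝕜 := ℂ) (fderiv ℝ r y) w) := by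
  have h_deriv : HasFDerivAt (fun z => (r z : ℂ)) (Complex.ofRealCLM.comp (fderiv ℝ r y)) y :=
    Complex.ofRealCLM.hasFDerivAt.comp y hr.hasFDerivAt
  simp [dbarDir, h_deriv.fderiv, StrongDual.extendRCLike_apply]

lemma exists_cornerModel [FiniteDimensional ℝ E] {ρ : ι → E → ℝ} {p : E} {s : Set E}
    (hs : IsOpen s) (hp : p ∈ s) (hρ : ∀ i, ContDiffOn ℝ ∞ (ρ i) s)
    (h_generic : Module.finrank ℂ
      (⨅ i, (StrongDual.extendRCLike (𝕜 := ℂ) (fderiv ℝ (ρ i) p)).ker : Submodule ℂ E) +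
        Fintype.card ι = Module.finrank ℂ E) :
    ∃ m : CornerModel E ι, p ∈ m.W ∧ m.W ⊆ s ∧ ∀ i, EqOn (m.r i) (ρ i) m.W := by
  have : FiniteDimensional ℂ E := FiniteDimensional.right ℝ ℂ E
  choose r hr hrρ using fun i => exists_contDiff_eventuallyEq hs hp (hρ i)
  obtain ⟨w, hw⟩ := exists_dual_vectors
    (fun i => (StrongDual.extendRCLike (𝕜 := ℂ) (fderiv ℝ (ρ i) p)).toLinearMap) h_generic
  obtain ⟨X, hX⟩ := exists_dual_antiholomorphicField (w := w) (p := p) hr fun i l => by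
    rw [dbarDir_ofReal ((hr i).differentiable (by simp) p), (hrρ i).fderiv_eq]
    refine (congrArg (starRingEnd ℂ) (hw i l)).trans ?_
    rw [apply_ite (starRingEnd ℂ), map_one, map_zero]
  obtain ⟨W, hW, hWo, hpW⟩ := mem_nhds_iff.1
    ((hs.eventually_mem hp).and ((eventually_all.2 hrρ).and hX))
  exact ⟨⟨r, X, W, hWo, hr, fun y hy => (hW hy).2.2⟩, hpW, fun y hy => (hW hy).1,
    fun i y hy => (hW hy).2.1 i⟩

namespace CornerModel

variable (m : CornerModel E ι)

lemma fderiv_r_ne_zero {y : E} (hy : y ∈ m.W) (j : ι) : fderiv ℝ (m.r j) y ≠ 0 := by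
  intro h_zero
  have h_dual := m.dual y hy j j
  simp [AntiholomorphicField.lieDeriv, dbarDir_ofReal ((m.contDiff_r j).differentiable (by simp) y),
    h_zero, StrongDual.extendRCLike_apply] at h_dual

lemma addHaar_face_eq_zero [FiniteDimensional ℝ E] [MeasurableSpace E] [BorelSpace E]
    (μ : Measure E) [μ.IsAddHaarMeasure] (j : ι) : μ {y ∈ m.W | m.r j y = 0} = 0 :=
  addHaar_zeroSet_eq_zero μ ((m.contDiff_r j).of_le (by simp)) fun _ hy _ => m.fderiv_r_ne_zero hy j

end CornerModel

end ExistenceOfCornerModels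

section Charts

variable {d : ℕ} {M : Type*} [TopologicalSpace M] {e e' : OpenPartialHomeomorph M (Cn d)}

lemma mem_source_transition {y : Cn d} :
    y ∈ (e.symm.trans e').source ↔ y ∈ e.target ∧ e.symm y ∈ e'.source := by
  simp

lemma image_source_transition :
    (e' ∘ e.symm) '' (e.symm.trans e').source = (e'.symm.trans e).source := by
  simpa using (e.symm.trans e').image_source_eq_target

variable [ChartedSpace (Cn d) M]

lemma differentiableOn_transition (he : e ∈ holoCharts d M) (he' : e' ∈ holoCharts d M) :
    DifferentiableOn ℂ (e' ∘ e.symm) (e.symm.trans e').source := by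
  have h_mem := StructureGroupoid.compatible_of_mem_maximalAtlas he he'
  have h_analytic : ContDiffOn ℂ ω (e' ∘ e.symm) (e.symm.trans e').source := by
    simpa [contDiffPregroupoid] using (mem_groupoid_of_pregroupoid.1 h_mem).1
  exact h_analytic.differentiableOn (by simp)

lemma transition_mem_contDiffGroupoid_real (he : e ∈ holoCharts d M) (he' : e' ∈ holoCharts d M) :
    e.symm.trans e' ∈ contDiffGroupoid ∞ 𝓘(ℝ, Cn d) := by
  rw [contDiffGroupoid, mem_groupoid_of_pregroupoid]
  constructor
  · simpa [contDiffPregroupoid] using contDiffOn_transition he he'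
  · simpa [contDiffPregroupoid] using contDiffOn_transition he' he

lemma fderiv_comp_symm_eq_comp {r : M → ℝ} (he : e ∈ holoCharts d M) (he' : e' ∈ holoCharts d M)
    {q : M} (hq : q ∈ e.source) (hq' : q ∈ e'.source)
    (hr : DifferentiableAt ℝ (r ∘ e'.symm) (e' q)) :
    fderiv ℝ (r ∘ e.symm) (e q) =
      (fderiv ℝ (r ∘ e'.symm) (e' q)).comp (fderiv ℝ (e' ∘ e.symm) (e q)) := by
  have h_source : e q ∈ (e.symm.trans e').source :=
    mem_source_transition.2 ⟨e.map_source hq, by rwa [e.left_inv hq]⟩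
  have h_nhds := (e.symm.trans e').open_source.mem_nhds h_source
  have h_diff : DifferentiableAt ℝ (e' ∘ e.symm) (e q) :=
    ((contDiffOn_transition he he').contDiffAt h_nhds).differentiableAt (by simp)
  have h_factor : (r ∘ e.symm) =ᶠ[𝓝 (e q)] ((r ∘ e'.symm) ∘ (e' ∘ e.symm)) := by
    filter_upwards [h_nhds] with z hz
    simp [e'.left_inv (mem_source_transition.1 hz).2]
  have h_apply : (e' ∘ e.symm) (e q) = e' q := by simp [e.left_inv hq]
  rw [h_factor.fderiv_eq, fderiv_comp _ (by rwa [h_apply]) h_diff, h_apply]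

lemma fderiv_comp_symm_ne_zero {r : M → ℝ} (he : e ∈ holoCharts d M) (he' : e' ∈ holoCharts d M)
    {q : M} (hq : q ∈ e.source) (hq' : q ∈ e'.source)
    (hr : fderiv ℝ (r ∘ e.symm) (e q) ≠ 0) (hr' : DifferentiableAt ℝ (r ∘ e'.symm) (e' q)) :
    fderiv ℝ (r ∘ e'.symm) (e' q) ≠ 0 := by
  intro h
  rw [fderiv_comp_symm_eq_comp he he' hq hq' hr', h, ContinuousLinearMap.zero_comp] at hr
  exact hr rfl

lemma differentiableOn_comp_symm {f : M → ℂ} {U : Set M}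
    (hf : MDifferentiableOn 𝓘(ℂ, Cn d) 𝓘(ℂ, ℂ) f U) (he : e ∈ holoCharts d M) :
    DifferentiableOn ℂ (f ∘ e.symm) (e.target ∩ e.symm ⁻¹' U) := by
  have h_symm := (contMDiffOn_symm_of_mem_maximalAtlas he).mdifferentiableOn (by simp)
  exact mdifferentiableOn_iff_differentiableOn.1
    (hf.comp (h_symm.mono inter_subset_left) inter_subset_right)

variable [IsManifold 𝓘(ℂ, Cn d) ω M]

lemma isManifold_real : IsManifold 𝓘(ℝ, Cn d) ∞ M where
  compatible he he' := transition_mem_contDiffGroupoid_real (IsManifold.subset_maximalAtlas he)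
    (IsManifold.subset_maximalAtlas he')

lemma mem_maximalAtlas_real (he : e ∈ holoCharts d M) :
    e ∈ IsManifold.maximalAtlas 𝓘(ℝ, Cn d) ∞ M := by
  rw [IsManifold.mem_maximalAtlas_iff, mem_maximalAtlas_iff]
  exact fun e' he' =>
    ⟨transition_mem_contDiffGroupoid_real he (IsManifold.subset_maximalAtlas he'),
      transition_mem_contDiffGroupoid_real (IsManifold.subset_maximalAtlas he') he⟩

lemma contDiffOn_comp_symm {r : M → ℝ} {U : Set M}
    (hr : ContMDiffOn 𝓘(ℝ, Cn d) 𝓘(ℝ, ℝ) ∞ r U) (he : e ∈ holoCharts d M) :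
    ContDiffOn ℝ ∞ (r ∘ e.symm) (e.target ∩ e.symm ⁻¹' U) := by
  have : IsManifold 𝓘(ℝ, Cn d) ∞ M := isManifold_real
  have h_symm := contMDiffOn_symm_of_mem_maximalAtlas (mem_maximalAtlas_real he)
  exact contMDiffOn_iff_contDiffOn.1 (hr.comp (h_symm.mono inter_subset_left) inter_subset_right)

lemma contDiffAt_comp_symm_of_mem {r : M → ℝ} {U : Set M} (hU : IsOpen U)
    (hr : ContMDiffOn 𝓘(ℝ, Cn d) 𝓘(ℝ, ℝ) ∞ r U) (he : e ∈ holoCharts d M) {p : M} (hpU : p ∈ U)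
    (hpe : p ∈ e.source) : ContDiffAt ℝ ∞ (r ∘ e.symm) (e p) :=
  (contDiffOn_comp_symm hr he).contDiffAt ((e.isOpen_inter_preimage_symm hU).mem_nhds
    ⟨e.map_source hpe, by rwa [mem_preimage, e.left_inv hpe]⟩)

end Charts

section Determinants

lemma alternatingMap_apply_eq_det_smul {ι R V F : Type*} [Fintype ι] [DecidableEq ι] [CommRing R]
    [AddCommGroup V] [Module R V] [AddCommGroup F] [Module R F] (b : Module.Basis ι R V)
    (α : V [⋀^ι]→ₗ[R] F) (v : ι → V) : α v = b.det v • α b := by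
  suffices h : α = (LinearMap.toSpanSingleton R F (α b)).compAlternatingMap b.det by
    conv_lhs => rw [h]
    rfl
  refine b.ext_alternating fun σ hσ => ?_
  obtain ⟨τ, rfl⟩ : ∃ τ : Equiv.Perm ι, σ = τ := ⟨Equiv.ofBijective σ hσ.bijective_of_finite, rfl⟩
  have h_perm := α.map_perm b τ
  have h_perm_det := b.det.map_perm b τ
  simp only [Function.comp_def] at h_perm h_perm_det
  simp [h_perm, h_perm_det, b.det_self]

lemma alternatingMap_comp_eq_det_smul {ι R V F : Type*} [Finite ι] [CommRing R]
    [AddCommGroup V] [Module R V] [AddCommGroup F] [Module R F] (b : Module.Basis ι R V)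
    (α : V [⋀^ι]→ₗ[R] F) (B : V →ₗ[R] V) (v : ι → V) :
    α (B ∘ v) = LinearMap.det B • α v := by
  classical
  have := Fintype.ofFinite ι
  rw [alternatingMap_apply_eq_det_smul b, alternatingMap_apply_eq_det_smul b α v, b.det_comp,
    mul_smul]

lemma det_restrictScalars_real_nonneg {E : Type*} [NormedAddCommGroup E] [NormedSpace ℂ E]
    (B : E →L[ℂ] E) : 0 ≤ (B.restrictScalars ℝ).det := by
  have h_norm : (B.restrictScalars ℝ).det = Algebra.norm ℝ (LinearMap.det (B : E →ₗ[ℂ] E)) :=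
    LinearMap.det_restrictScalars (R := ℝ) (f := (B : E →ₗ[ℂ] E))
  rw [h_norm, Algebra.norm_complex_apply]
  exact Complex.normSq_nonneg _

end Determinants

section TopForms

variable {n : ℕ} {M : Type*} [TopologicalSpace M] [ChartedSpace (Cn (n + 1)) M]
  {φ : DiffForm (n + 1) M (n + 1 + n + 1)} {e e' : OpenPartialHomeomorph M (Cn (n + 1))}

lemma finrank_real_Cn (n : ℕ) : Module.finrank ℝ (Cn (n + 1)) = n + 1 + n + 1 := by
  rw [Module.finrank_pi_fintype]
  simp only [Complex.finrank_real_complex, Finset.sum_const, Finset.card_univ, Fintype.card_fin,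
    smul_eq_mul]
  ring

lemma topCoeff_eq_zero {y : Cn (n + 1)} (h : φ (e.symm y) = 0) : topCoeff φ e y = 0 := by
  simp [topCoeff, inChart, h]

lemma topCoeff_add (φ ψ : DiffForm (n + 1) M (n + 1 + n + 1))
    (e : OpenPartialHomeomorph M (Cn (n + 1))) :
    topCoeff (φ + ψ) e = topCoeff φ e + topCoeff ψ e := by
  funext y
  simp [topCoeff, inChart_add]

lemma topCoeff_smul (c : ℂ) (φ : DiffForm (n + 1) M (n + 1 + n + 1))
    (e : OpenPartialHomeomorph M (Cn (n + 1))) : topCoeff (c • φ) e = c • topCoeff φ e := by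
  funext y
  simp [topCoeff, inChart_smul]

lemma topCoeff_fun_smul (χ : M → ℝ) (φ : DiffForm (n + 1) M (n + 1 + n + 1))
    (e : OpenPartialHomeomorph M (Cn (n + 1))) :
    topCoeff (χ • φ) e = (fun y => (χ (e.symm y) : ℂ)) * topCoeff φ e := by
  funext y
  simp [topCoeff, inChart]

lemma contDiffOn_topCoeff (hφ : IsSmoothForm φ) (he : e ∈ holoCharts (n + 1) M) :
    ContDiffOn ℝ ∞ (topCoeff φ e) e.target :=
  (ContinuousAlternatingMap.apply ℝ (Cn (n + 1)) ℂ (realFrame n)).contDiff.comp_contDiffOn (hφ e he)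

lemma topCoeff_transition [IsManifold 𝓘(ℂ, Cn (n + 1)) ω M]
    (φ : DiffForm (n + 1) M (n + 1 + n + 1)) (he : e ∈ holoCharts (n + 1) M)
    (he' : e' ∈ holoCharts (n + 1) M) {y : Cn (n + 1)} (hy : y ∈ (e.symm.trans e').source) :
    topCoeff φ e y = (fderiv ℝ (e' ∘ e.symm) y).det • topCoeff φ e' ((e' ∘ e.symm) y) := by
  rw [topCoeff, inChart_eq_pullback φ he he' hy]
  exact alternatingMap_comp_eq_det_smul (Module.finBasisOfFinrankEq ℝ _ (finrank_real_Cn n))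
    (inChart φ e' ((e' ∘ e.symm) y)).toAlternatingMap (fderiv ℝ (e' ∘ e.symm) y).toLinearMap
    (realFrame n)

lemma integral_target_eq_integral_source_transition (hφ : tsupport φ ⊆ e'.source)
    (G : M → ℂ) :
    ∫ y in e.target, G (e.symm y) * topCoeff φ e y =
      ∫ y in (e.symm.trans e').source, G (e.symm y) * topCoeff φ e y := by
  refine setIntegral_eq_of_subset_of_forall_sdiff_eq_zero e.open_target.measurableSet
    (fun y hy => (mem_source_transition.1 hy).1) fun y hy => ?_
  rw [topCoeff_eq_zero, mul_zero]
  exact image_eq_zero_of_notMem_tsupport fun h =>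
    hy.2 (mem_source_transition.2 ⟨hy.1, hφ h⟩)

/-- Holomorphic coordinate changes have non-negative real Jacobian determinant, so no absolute value
is left in the change of variables. -/
lemma integral_target_eq_integral_target [IsManifold 𝓘(ℂ, Cn (n + 1)) ω M]
    (he : e ∈ holoCharts (n + 1) M) (he' : e' ∈ holoCharts (n + 1) M)
    (hφ : tsupport φ ⊆ e.source) (hφ' : tsupport φ ⊆ e'.source) (G : M → ℂ) :
    ∫ y in e.target, G (e.symm y) * topCoeff φ e y =
      ∫ y in e'.target, G (e'.symm y) * topCoeff φ e' y := by
  set f : Cn (n + 1) → Cn (n + 1) := e' ∘ e.symm with hf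
  have h_open := (e.symm.trans e').open_source
  have h_deriv : ∀ y ∈ (e.symm.trans e').source, DifferentiableAt ℂ f y := fun y hy =>
    (differentiableOn_transition he he').differentiableAt (h_open.mem_nhds hy)
  have h_inj : InjOn f (e.symm.trans e').source := (e.symm.trans e').injOn
  rw [integral_target_eq_integral_source_transition hφ',
    integral_target_eq_integral_source_transition hφ, ← image_source_transition (e := e),
    integral_image_eq_integral_abs_det_fderiv_smul volume h_open.measurableSet
      (fun y hy => ((h_deriv y hy).restrictScalars ℝ).hasFDerivAt.hasFDerivWithinAt) h_inj]
  refine setIntegral_congr_fun h_open.measurableSet fun y hy => ?_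
  have h_det : 0 ≤ (fderiv ℝ f y).det := by
    rw [((h_deriv y hy).hasFDerivAt.restrictScalars ℝ).fderiv]
    exact det_restrictScalars_real_nonneg _
  have h_symm : e'.symm (f y) = e.symm y := e'.left_inv (mem_source_transition.1 hy).2
  simp only [topCoeff_transition φ he he' hy, abs_of_nonneg h_det, h_symm, mul_smul_comm, ← hf]

end TopForms

section ExtendedCoefficient

variable {n : ℕ} {M : Type*} [TopologicalSpace M] [ChartedSpace (Cn (n + 1)) M]
  {φ : DiffForm (n + 1) M (n + 1 + n + 1)} {e : OpenPartialHomeomorph M (Cn (n + 1))}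

/-- The coefficient of a form of top degree in a chart, extended by zero to `ℂⁿ⁺¹`, so that it is a
test function on `ℂⁿ⁺¹` if the form is supported in the domain of the chart. -/
def extCoeff (φ : DiffForm (n + 1) M (n + 1 + n + 1)) (e : OpenPartialHomeomorph M (Cn (n + 1))) :
    Cn (n + 1) → ℂ := e.target.indicator (topCoeff φ e)

lemma extCoeff_of_mem {y : Cn (n + 1)} (hy : y ∈ e.target) : extCoeff φ e y = topCoeff φ e y :=
  indicator_of_mem hy _

lemma extCoeff_add (φ ψ : DiffForm (n + 1) M (n + 1 + n + 1))
    (e : OpenPartialHomeomorph M (Cn (n + 1))) :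
    extCoeff (φ + ψ) e = extCoeff φ e + extCoeff ψ e := by
  rw [extCoeff, topCoeff_add]
  exact indicator_add _ _ _

lemma extCoeff_smul (c : ℂ) (φ : DiffForm (n + 1) M (n + 1 + n + 1))
    (e : OpenPartialHomeomorph M (Cn (n + 1))) : extCoeff (c • φ) e = c • extCoeff φ e := by
  rw [extCoeff, topCoeff_smul]
  exact indicator_const_smul e.target c (topCoeff φ e)

lemma tsupport_extCoeff_subset {K : Set M} (hK : IsCompact K) (hKe : K ⊆ e.source)
    (hφ : ∀ x ∉ K, φ x = 0) : tsupport (extCoeff φ e) ⊆ e '' K := by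
  have h_compact : IsCompact (e '' K) := hK.image_of_continuousOn (e.continuousOn.mono hKe)
  refine closure_minimal (Function.support_subset_iff'.2 fun y hy => ?_) h_compact.isClosed
  refine indicator_apply_eq_zero.2 fun hyt => topCoeff_eq_zero (hφ _ fun h => ?_)
  exact hy ⟨_, h, e.right_inv hyt⟩

variable [T2Space M]

lemma isCompact_tsupport_of_mem_testForms {d k : ℕ} [ChartedSpace (Cn d) M] {φ : DiffForm d M k}
    (hφ : φ ∈ testForms d M k) : IsCompact (tsupport φ) := by
  obtain ⟨-, K, hK, hφK⟩ := hφ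
  exact hK.of_isClosed_subset (isClosed_tsupport φ)
    (closure_minimal (Function.support_subset_iff'.2 hφK) hK.isClosed)

lemma tsupport_extCoeff_subset_image (hφ : φ ∈ testForms (n + 1) M (n + 1 + n + 1))
    (hφe : tsupport φ ⊆ e.source) : tsupport (extCoeff φ e) ⊆ e '' tsupport φ :=
  tsupport_extCoeff_subset (isCompact_tsupport_of_mem_testForms hφ) hφe
    fun _ => image_eq_zero_of_notMem_tsupport

lemma hasCompactSupport_extCoeff (hφ : φ ∈ testForms (n + 1) M (n + 1 + n + 1))
    (hφe : tsupport φ ⊆ e.source) : HasCompactSupport (extCoeff φ e) :=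
  ((isCompact_tsupport_of_mem_testForms hφ).image_of_continuousOn
    (e.continuousOn.mono hφe)).of_isClosed_subset (isClosed_tsupport _)
      (tsupport_extCoeff_subset_image hφ hφe)

lemma contDiff_extCoeff (hφ : φ ∈ testForms (n + 1) M (n + 1 + n + 1))
    (he : e ∈ holoCharts (n + 1) M) (hφe : tsupport φ ⊆ e.source) :
    ContDiff ℝ ∞ (extCoeff φ e) := by
  refine contMDiff_iff_contDiff.1 (contMDiff_of_tsupport fun y hy => ?_)
  obtain ⟨x, hx, rfl⟩ := tsupport_extCoeff_subset_image hφ hφe hy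
  have h_nhds := e.open_target.mem_nhds (e.map_source (hφe hx))
  refine (((contDiffOn_topCoeff hφ.1 he).contDiffAt h_nhds).congr_of_eventuallyEq ?_).contMDiffAt
  filter_upwards [h_nhds] with z hz using extCoeff_of_mem hz

end ExtendedCoefficient

section Multiplication

lemma smul_mem_testForms {d k : ℕ} {M : Type*} [TopologicalSpace M] [ChartedSpace (Cn d) M]
    [IsManifold 𝓘(ℂ, Cn d) ω M] {χ : M → ℝ} (hχ : ContMDiff 𝓘(ℝ, Cn d) 𝓘(ℝ, ℝ) ∞ χ)
    {φ : DiffForm d M k} (hφ : φ ∈ testForms d M k) : χ • φ ∈ testForms d M k := by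
  obtain ⟨hs, K, hK, hφK⟩ := hφ
  refine ⟨fun e he => ?_, K, hK, fun x hx => by ext v; simp [hφK x hx]⟩
  have h_smooth : ContDiffOn ℝ ∞ (χ ∘ e.symm) e.target := by
    simpa using contDiffOn_comp_symm (U := univ) hχ.contMDiffOn he
  have h_chart : inChart (χ • φ) e = fun y => (χ ∘ e.symm) y • inChart φ e y := by
    funext y; ext v; simp [inChart]
  rw [h_chart]
  exact h_smooth.smul (hs e he)

lemma SmoothlyTendstoZero.extCoeff_smul {n : ℕ} {M : Type*} [TopologicalSpace M]
    [ChartedSpace (Cn (n + 1)) M] [IsManifold 𝓘(ℂ, Cn (n + 1)) ω M] {χ : M → ℝ}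
    (hχ : ContMDiff 𝓘(ℝ, Cn (n + 1)) 𝓘(ℝ, ℝ) ∞ χ)
    {φ : ℕ → DiffForm (n + 1) M (n + 1 + n + 1)} (hs : ∀ ν, IsSmoothForm (φ ν))
    (hφ : TendstoZero φ) {e : OpenPartialHomeomorph M (Cn (n + 1))}
    (he : e ∈ holoCharts (n + 1) M) {L : Set (Cn (n + 1))} (hL : IsCompact L)
    (hLe : L ⊆ e.target) : SmoothlyTendstoZero L (fun ν => extCoeff (χ • φ ν) e) := by
  have h_form : SmoothlyTendstoZero L (fun ν => inChart (φ ν) e) := hφ.2 e he L hLe hL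
  have h_coeff : SmoothlyTendstoZero L (fun ν => topCoeff (φ ν) e) :=
    h_form.clm_comp e.open_target hLe (fun ν => hs ν e he)
      (ContinuousAlternatingMap.apply ℝ (Cn (n + 1)) ℂ (realFrame n))
  have h_smooth : ContDiffOn ℝ ∞ (χ ∘ e.symm) e.target := by
    simpa using contDiffOn_comp_symm (U := univ) hχ.contMDiffOn he
  have h_mul := h_coeff.mul e.open_target hLe hL (fun ν => contDiffOn_topCoeff (hs ν) he)
    (a := fun y => (χ (e.symm y) : ℂ)) (Complex.ofRealCLM.contDiff.comp_contDiffOn h_smooth)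
  refine h_mul.congr e.open_target hLe fun ν y hy => ?_
  rw [extCoeff_of_mem hy, topCoeff_fun_smul]

end Multiplication

section DefiningFunctions

lemma nonpos_of_mem_closure {X : Type*} [TopologicalSpace X] {D U : Set X} {r : X → ℝ}
    (hU : IsOpen U) (hr : ContinuousOn r U) (hD : ∀ x ∈ U, x ∈ D ↔ r x < 0) {q : X} (hq : q ∈ U)
    (hqD : q ∈ closure D) : r q ≤ 0 := by
  by_contra! h
  have h_pos : ∀ᶠ x in 𝓝 q, 0 < r x := (hr.continuousAt (hU.mem_nhds hq)).eventually_const_lt h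
  obtain ⟨x, ⟨hx_pos, hxU⟩, hxD⟩ := mem_closure_iff_nhds.1 hqD _ (h_pos.and (hU.mem_nhds hq))
  exact hx_pos.not_gt ((hD x hxU).1 hxD)

lemma eq_zero_of_mem_frontier {X : Type*} [TopologicalSpace X] {D U : Set X} {r : X → ℝ}
    (hU : IsOpen U) (hr : ContinuousOn r U) (hDo : IsOpen D) (hD : ∀ x ∈ U, x ∈ D ↔ r x < 0)
    {q : X} (hq : q ∈ U) (hqD : q ∈ frontier D) : r q = 0 := by
  rw [hDo.frontier_eq] at hqD
  exact le_antisymm (nonpos_of_mem_closure hU hr hD hq hqD.1)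
    (not_lt.1 fun h => hqD.2 ((hD q hq).2 h))

variable {d : ℕ} {M : Type*} [TopologicalSpace M] [ChartedSpace (Cn d) M]

namespace IsLocalDefiningFunction

variable {D : Set M} {p : M} {r r' : M → ℝ} {e : OpenPartialHomeomorph M (Cn d)}

lemma eq_zero (h : IsLocalDefiningFunction d D p r) (hD : IsOpen D) (hp : p ∈ frontier D) :
    r p = 0 := by
  obtain ⟨⟨U, hU, hpU, hr, hUD⟩, -⟩ := h
  exact eq_zero_of_mem_frontier hU hr.continuousOn hD hUD hpU hp

lemma eventually_mem_iff (h : IsLocalDefiningFunction d D p r) (hpe : p ∈ e.source) :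
    ∀ᶠ z in 𝓝 (e p), e.symm z ∈ D ↔ (r ∘ e.symm) z < 0 := by
  obtain ⟨⟨U, hU, hpU, -, hUD⟩, -⟩ := h
  have h_cont := e.continuousAt_symm (e.map_source hpe)
  rw [ContinuousAt, e.left_inv hpe] at h_cont
  filter_upwards [h_cont (hU.mem_nhds hpU)] with z hz using hUD _ hz

variable [IsManifold 𝓘(ℂ, Cn d) ω M]

lemma contDiffAt_comp_symm (h : IsLocalDefiningFunction d D p r) (he : e ∈ holoCharts d M)
    (hpe : p ∈ e.source) : ContDiffAt ℝ ∞ (r ∘ e.symm) (e p) := by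
  obtain ⟨⟨U, hU, hpU, hr, -⟩, -⟩ := h
  exact contDiffAt_comp_symm_of_mem hU hr he hpU hpe

lemma fderiv_comp_symm_ne_zero (h : IsLocalDefiningFunction d D p r) (he : e ∈ holoCharts d M)
    (hpe : p ∈ e.source) : fderiv ℝ (r ∘ e.symm) (e p) ≠ 0 :=
  BoundaryCurrents.fderiv_comp_symm_ne_zero (IsManifold.chart_mem_maximalAtlas p) he
    (mem_chart_source _ p) hpe h.2 ((h.contDiffAt_comp_symm he hpe).differentiableAt (by simp))

lemma fderiv_comp_symm_pos (h : IsLocalDefiningFunction d D p r)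
    (h' : IsLocalDefiningFunction d D p r') (hD : IsOpen D) (hp : p ∈ frontier D)
    (he : e ∈ holoCharts d M) (hpe : p ∈ e.source) {v : Cn d}
    (hv : 0 < fderiv ℝ (r' ∘ e.symm) (e p) v) : 0 < fderiv ℝ (r ∘ e.symm) (e p) v := by
  refine fderiv_pos_of_eventually_neg_iff
    ((h.contDiffAt_comp_symm he hpe).differentiableAt (by simp))
    ((h'.contDiffAt_comp_symm he hpe).differentiableAt (by simp)) ?_ ?_ ?_
    (h.fderiv_comp_symm_ne_zero he hpe) hv
  · simpa [e.left_inv hpe] using h.eq_zero hD hp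
  · simpa [e.left_inv hpe] using h'.eq_zero hD hp
  · filter_upwards [h.eventually_mem_iff hpe, h'.eventually_mem_iff hpe] with z hz hz'
      using hz.symm.trans hz'

end IsLocalDefiningFunction

lemma mem_ker_extendRCLike_iff {E : Type*} [NormedAddCommGroup E] [NormedSpace ℝ E]
    [NormedSpace ℂ E] [IsScalarTower ℝ ℂ E] {A : StrongDual ℝ E} {w : E} :
    w ∈ (StrongDual.extendRCLike (𝕜 := ℂ) A).ker ↔ ∀ c : ℂ, A (c • w) = 0 := by
  rw [LinearMap.mem_ker]
  refine ⟨fun hw c => ?_, fun hw => ?_⟩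
  · have h_re := StrongDual.re_extendRCLike_apply (𝕜 := ℂ) A (c • w)
    rw [← h_re, map_smul]
    simp [show StrongDual.extendRCLike (𝕜 := ℂ) A w = 0 from hw]
  · have h_one := hw 1
    rw [one_smul] at h_one
    change StrongDual.extendRCLike (𝕜 := ℂ) A w = 0
    simp [StrongDual.extendRCLike_apply, h_one, hw]

variable [IsManifold 𝓘(ℂ, Cn d) ω M]

lemma complexTangentSpace_eq_ker {D : Set M} {p : M} {r : M → ℝ}
    (h : IsLocalDefiningFunction d D p r) (hD : IsOpen D) (hp : p ∈ frontier D) :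
    complexTangentSpace d D p = (StrongDual.extendRCLike (𝕜 := ℂ)
      (fderiv ℝ (r ∘ (chartAt (Cn d) p).symm) (chartAt (Cn d) p p))).ker := by
  ext w
  rw [mem_ker_extendRCLike_iff]
  refine ⟨fun hw => hw r h, fun hw r' h' c => ?_⟩
  have h_nonpos : ∀ x, fderiv ℝ (r ∘ (chartAt (Cn d) p).symm) (chartAt (Cn d) p p) x = 0 →
      fderiv ℝ (r' ∘ (chartAt (Cn d) p).symm) (chartAt (Cn d) p p) x ≤ 0 := fun x hx =>
    not_lt.1 fun hx' => (h.fderiv_comp_symm_pos h' hD hp (IsManifold.chart_mem_maximalAtlas p)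
      (mem_chart_source _ p) hx').ne' hx
  refine le_antisymm (h_nonpos _ (hw c)) ?_
  have h_neg := h_nonpos (-(c • w)) (by rw [map_neg, hw c, neg_zero])
  rwa [map_neg, neg_nonpos] at h_neg

end DefiningFunctions

section BoundaryGeometry

variable {d N : ℕ} {M : Type*} [TopologicalSpace M] [ChartedSpace (Cn d) M]
  [IsManifold 𝓘(ℂ, Cn d) ω M]

lemma PointsOutward.eventually_nhds {D : Set M} {e : OpenPartialHomeomorph M (Cn d)} {v : Cn d}
    {p : M} (h : PointsOutward d D e v p) (he : e ∈ holoCharts d M) (hpe : p ∈ e.source) :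
    ∀ᶠ q in 𝓝 p, PointsOutward d D e v q := by
  obtain ⟨r, hr, hv⟩ := h
  have h_cont : ContinuousAt (fun q => fderiv ℝ (r ∘ e.symm) (e q) v) p :=
    (((hr.contDiffAt_comp_symm he hpe).continuousAt_fderiv (by simp)).comp
      (e.continuousAt hpe)).clm_apply continuousAt_const
  obtain ⟨⟨U, hU, hpU, hrU, hUD⟩, -⟩ := hr
  filter_upwards [h_cont.eventually_const_lt hv, hU.mem_nhds hpU, e.open_source.mem_nhds hpe]
    with q hqv hqU hqe
  refine ⟨r, ⟨⟨U, hU, hqU, hrU, hUD⟩, ?_⟩, hqv⟩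
  have hc : chartAt (Cn d) q ∈ holoCharts d M := IsManifold.chart_mem_maximalAtlas q
  refine fderiv_comp_symm_ne_zero he hc hqe (mem_chart_source _ q) (fun h_zero => ?_)
    ((contDiffAt_comp_symm_of_mem hU hrU hc hqU (mem_chart_source _ q)).differentiableAt (by simp))
  simp [h_zero] at hqv

variable {D : Fin N → Set M} {Ω : Set M}

namespace IsDomainWithGenericCorners

lemma exists_localDefiningFunctions (hΩ : IsDomainWithGenericCorners d D Ω) (p : M) :
    ∃ (S : Finset (Fin N)) (r : S → M → ℝ), (∀ j, j ∈ S ↔ p ∈ frontier (D j)) ∧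
      (∀ j : S, IsLocalDefiningFunction d (D j) p (r j)) ∧
      Module.finrank ℂ (⨅ j : S, (StrongDual.extendRCLike (𝕜 := ℂ)
        (fderiv ℝ (r j ∘ (chartAt (Cn d) p).symm) (chartAt (Cn d) p p))).ker :
          Submodule ℂ (Cn d)) + Fintype.card S = Module.finrank ℂ (Cn d) := by
  classical
  let S : Finset (Fin N) := Finset.univ.filter fun j => p ∈ frontier (D j)
  have hS : ∀ j, j ∈ S ↔ p ∈ frontier (D j) := by simp [S]
  choose r hr using fun j : S => (hΩ.isSmoothDomain j).smooth p ((hS j).1 j.2)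
  refine ⟨S, r, hS, hr, ?_⟩
  have h_generic := hΩ.generic S p fun j => (hS j).1
  rw [iInf_subtype', iInf_congr fun j : S => complexTangentSpace_eq_ker (hr j)
    (hΩ.isSmoothDomain j).isOpen ((hS j).1 j.2)] at h_generic
  simpa using h_generic

lemma exists_pointsOutward (hΩ : IsDomainWithGenericCorners d D Ω) (p : M) :
    ∃ v, ∀ j, p ∈ frontier (D j) → PointsOutward d (D j) (chartAt (Cn d) p) v p := by
  obtain ⟨S, r, hS, hr, h_generic⟩ := hΩ.exists_localDefiningFunctions p
  obtain ⟨w, hw⟩ := exists_dual_vectors (fun j : S => (StrongDual.extendRCLike (𝕜 := ℂ)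
    (fderiv ℝ (r j ∘ (chartAt (Cn d) p).symm) (chartAt (Cn d) p p))).toLinearMap) h_generic
  refine ⟨∑ l, w l, fun j hj => ⟨r ⟨j, (hS j).2 hj⟩, hr _, ?_⟩⟩
  have h_sum : ∑ l, StrongDual.extendRCLike (𝕜 := ℂ) (fderiv ℝ (r ⟨j, (hS j).2 hj⟩ ∘
      (chartAt (Cn d) p).symm) (chartAt (Cn d) p p)) (w l) = 1 :=
    (Finset.sum_congr rfl fun l _ => hw ⟨j, (hS j).2 hj⟩ l).trans (by simp)
  rw [← StrongDual.re_extendRCLike_apply (𝕜 := ℂ), map_sum, h_sum]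
  exact zero_lt_one

lemma exists_eventually_pointsOutward (hΩ : IsDomainWithGenericCorners d D Ω) (p : M) :
    ∃ v, ∀ᶠ q in 𝓝 p, ∀ j, q ∈ frontier (D j) →
      PointsOutward d (D j) (chartAt (Cn d) p) v q := by
  obtain ⟨v, hv⟩ := hΩ.exists_pointsOutward p
  refine ⟨v, eventually_all.2 fun j => ?_⟩
  by_cases hj : p ∈ frontier (D j)
  · filter_upwards [(hv j hj).eventually_nhds (IsManifold.chart_mem_maximalAtlas p)
      (mem_chart_source _ p)] with q hq _ using hq
  · filter_upwards [isClosed_frontier.isOpen_compl.mem_nhds hj] with q hq hq' using absurd hq' hq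

end IsDomainWithGenericCorners

end BoundaryGeometry

section LocalCorner

variable {d N : ℕ} {M : Type*} [TopologicalSpace M]

/-- A description of the domain `⋂ j, D j` by a corner model in the chart `e`; `S` is the set of
those `j` whose boundary `∂D j` may meet the coordinate neighbourhood. -/
structure LocalCorner (D : Fin N → Set M) (e : OpenPartialHomeomorph M (Cn d)) where
  S : Finset (Fin N)
  m : CornerModel (Cn d) S
  W_subset : m.W ⊆ e.target
  mem_iff : ∀ (j : S), ∀ y ∈ m.W, e.symm y ∈ D j ↔ m.r j y < 0
  mem_of_notMem : ∀ j ∉ S, ∀ y ∈ m.W, e.symm y ∈ D j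

/-- The coordinate neighbourhood of a local description. -/
def LocalCorner.dom {D : Fin N → Set M} {e : OpenPartialHomeomorph M (Cn d)}
    (P : LocalCorner D e) : Set M :=
  e.source ∩ e ⁻¹' P.m.W

variable [ChartedSpace (Cn d) M] [IsManifold 𝓘(ℂ, Cn d) ω M]

lemma IsDomainWithGenericCorners.exists_localCorner {D : Fin N → Set M} {Ω : Set M}
    (hΩ : IsDomainWithGenericCorners d D Ω) {p : M} (hp : p ∈ closure Ω) :
    ∃ P : LocalCorner D (chartAt (Cn d) p), p ∈ P.dom := by
  have hD : ∀ j, IsOpen (D j) := fun j => (hΩ.isSmoothDomain j).isOpen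
  obtain ⟨S, r, hS, hr, h_generic⟩ := hΩ.exists_localDefiningFunctions p
  have h_mem : ∀ j : {j // j ∉ S}, p ∈ D j := fun j => by
    by_contra h
    rw [hΩ.eq_iInter] at hp
    exact j.2 ((hS j).2 ((hD j).frontier_eq ▸ ⟨closure_mono (iInter_subset _ _) hp, h⟩))
  choose U hU hpU hrU hUD using fun j => (hr j).1
  set e := chartAt (Cn d) p
  set V : Set M := (⋂ j, U j) ∩ ⋂ j : {j // j ∉ S}, D j
  have hV : IsOpen V := (isOpen_iInter_of_finite hU).inter (isOpen_iInter_of_finite fun j => hD j)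
  have hpV : e p ∈ e.target ∩ e.symm ⁻¹' V := by
    refine ⟨mem_chart_target _ p, ?_⟩
    rw [mem_preimage, e.left_inv (mem_chart_source _ p)]
    exact ⟨mem_iInter.2 hpU, mem_iInter.2 h_mem⟩
  have hρ : ∀ j, ContDiffOn ℝ ∞ (r j ∘ e.symm) (e.target ∩ e.symm ⁻¹' V) := fun j =>
    (contDiffOn_comp_symm (hrU j) (IsManifold.chart_mem_maximalAtlas p)).mono
      fun y hy => ⟨hy.1, mem_iInter.1 hy.2.1 j⟩
  obtain ⟨m, hpW, hWV, hm⟩ :=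
    exists_cornerModel (e.isOpen_inter_preimage_symm hV) hpV hρ h_generic
  exact ⟨{  S := S
            m := m
            W_subset := fun y hy => (hWV hy).1
            mem_iff := fun j y hy => by
              rw [hm j hy]
              exact hUD j _ (mem_iInter.1 (hWV hy).2.1 j)
            mem_of_notMem := fun j hj y hy => mem_iInter.1 (hWV hy).2.2 ⟨j, hj⟩ },
    mem_chart_source _ p, hpW⟩

end LocalCorner

namespace LocalCorner

variable {d N : ℕ} {M : Type*} [TopologicalSpace M] {D : Fin N → Set M}
  {e : OpenPartialHomeomorph M (Cn d)} (P : LocalCorner D e)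

lemma isOpen_dom : IsOpen P.dom := e.isOpen_inter_preimage P.m.isOpen_W

lemma continuousOn_r_comp (j : P.S) : ContinuousOn (P.m.r j ∘ e) P.dom :=
  (P.m.contDiff_r j).continuous.comp_continuousOn (e.continuousOn.mono inter_subset_left)

lemma mem_iff_of_mem_dom (j : P.S) {q : M} (hq : q ∈ P.dom) :
    q ∈ D j ↔ (P.m.r j ∘ e) q < 0 := by
  simpa [e.left_inv hq.1] using P.mem_iff j (e q) hq.2

lemma mem_iInter_iff {y : Cn d} (hy : y ∈ P.m.W) : e.symm y ∈ ⋂ j, D j ↔ y ∈ P.m.region := by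
  rw [mem_iInter]
  refine ⟨fun h j => (P.mem_iff j y hy).1 (h j), fun h j => ?_⟩
  by_cases hj : j ∈ P.S
  · exact (P.mem_iff ⟨j, hj⟩ y hy).2 (h ⟨j, hj⟩)
  · exact P.mem_of_notMem j hj y hy

lemma r_nonpos {q : M} (hq : q ∈ P.dom) (hqD : q ∈ closure (⋂ j, D j)) (j : P.S) :
    P.m.r j (e q) ≤ 0 :=
  nonpos_of_mem_closure P.isOpen_dom (P.continuousOn_r_comp j)
    (fun _ hx => P.mem_iff_of_mem_dom j hx) hq (closure_mono (iInter_subset _ (j : Fin N)) hqD)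

/-- The restriction of a local description to an open set `V`. -/
def restrict {V : Set M} (hV : IsOpen V) : LocalCorner D e where
  S := P.S
  m := { P.m with
    W := P.m.W ∩ (e.target ∩ e.symm ⁻¹' V)
    isOpen_W := P.m.isOpen_W.inter (e.isOpen_inter_preimage_symm hV)
    dual := fun y hy => P.m.dual y hy.1 }
  W_subset := fun _ hy => hy.2.1
  mem_iff := fun j y hy => P.mem_iff j y hy.1
  mem_of_notMem := fun j hj y hy => P.mem_of_notMem j hj y hy.1

/-- The function `f`, in the chart `e` and multiplied with the powers `r_j ^ K` of the defining
functions, extended by `0`. -/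
def weight (f : M → ℂ) (K : ℕ) : Cn d → ℂ :=
  (P.m.region ∩ P.m.W).indicator fun y => f (e.symm y) * ∏ j, (P.m.r j y : ℂ) ^ K

/-- The growth of `f` on the coordinate neighbourhood is controlled by the defining functions. -/
def Controls (f : M → ℂ) (K : ℕ) (C : ℝ) : Prop :=
  ∀ y ∈ P.m.region ∩ P.m.W, ‖f (e.symm y)‖ * ∏ j, |P.m.r j y| ^ K ≤ C

end LocalCorner

section Growth

lemma eventually_abs_le_mul_infDist_of_lipschitzOnWith {X : Type*} [PseudoMetricSpace X] {g : X → ℝ}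
    {A : NNReal} {U F : Set X} {p : X} (hg : LipschitzOnWith A g U) (hU : U ∈ 𝓝 p) (hp : p ∈ F)
    (hgF : ∀ q ∈ U ∩ F, g q = 0) : ∀ᶠ q in 𝓝 p, |g q| ≤ A * Metric.infDist q F := by
  obtain ⟨ρ, hρ, hρU⟩ := Metric.mem_nhds_iff.1 hU
  filter_upwards [Metric.ball_mem_nhds p (half_pos hρ)] with q hq
  have h_infDist : Metric.infDist q F < ρ / 2 := (Metric.infDist_le_dist_of_mem hp).trans_lt hq
  have h_tendsto : Tendsto (fun t : ℝ => A * t) (𝓝[>] Metric.infDist q F)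
      (𝓝 (A * Metric.infDist q F)) :=
    ((continuous_const_mul (A : ℝ)).tendsto _).mono_left nhdsWithin_le_nhds
  refine ge_of_tendsto h_tendsto ?_
  filter_upwards [Ioo_mem_nhdsGT h_infDist] with t ⟨ht, htρ⟩
  obtain ⟨q', hq'F, hqq'⟩ := (Metric.infDist_lt_iff ⟨p, hp⟩).1 ht
  have hq'U : q' ∈ U := hρU <| by
    calc dist q' p ≤ dist q q' + dist q p := dist_triangle_left _ _ _
      _ < ρ / 2 + ρ / 2 := add_lt_add (hqq'.trans htρ) hq
      _ = ρ := add_halves ρ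
  calc |g q| = dist (g q) (g q') := by rw [hgF q' ⟨hq'U, hq'F⟩, Real.dist_0_eq_abs]
    _ ≤ A * dist q q' := hg.dist_le_mul q (hρU (Metric.ball_subset_ball (half_le_self hρ.le) hq))
        q' hq'U
    _ ≤ A * t := by gcongr

variable {d N : ℕ} {M : Type*} {D : Fin N → Set M}

namespace LocalCorner

section

variable [TopologicalSpace M] {e : OpenPartialHomeomorph M (Cn d)}

lemma prod_r_eq_zero (P : LocalCorner D e) (hD : IsOpen (⋂ j, D j)) {q : M} (hq : q ∈ P.dom)
    (hqD : q ∈ frontier (⋂ j, D j)) : ∏ j, P.m.r j (e q) = 0 := by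
  rw [hD.frontier_eq] at hqD
  have h_region : e q ∉ P.m.region := by
    rw [← P.mem_iInter_iff hq.2, e.left_inv hq.1]
    exact hqD.2
  obtain ⟨j, hj⟩ : ∃ j, 0 ≤ P.m.r j (e q) := by
    by_contra! h
    exact h_region h
  exact Finset.prod_eq_zero (Finset.mem_univ j) ((P.r_nonpos hq hqD.1 j).antisymm hj)

lemma exists_controls_of_eventually (P : LocalCorner D e) {p : M} (hp : p ∈ P.dom) {f : M → ℂ}
    {K : ℕ} {C : ℝ}
    (h : ∀ᶠ q in 𝓝 p, q ∈ ⋂ j, D j → ‖f q‖ * ∏ j, |P.m.r j (e q)| ^ K ≤ C) :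
    ∃ P' : LocalCorner D e, p ∈ P'.dom ∧ P'.Controls f K C := by
  obtain ⟨V, hVC, hV, hpV⟩ := mem_nhds_iff.1 h
  refine ⟨P.restrict hV, ⟨hp.1, hp.2, e.map_source hp.1, ?_⟩, ?_⟩
  · rwa [mem_preimage, e.left_inv hp.1]
  · rintro y ⟨hy_region, hyW, hy_target, hyV⟩
    have h_bound := hVC hyV ((P.mem_iInter_iff hyW).2 hy_region)
    rwa [e.right_inv hy_target] at h_bound

end

variable [MetricSpace M] {e : OpenPartialHomeomorph M (Cn d)}

lemma eventually_prod_abs_le_mul_infDist (P : LocalCorner D e) (hD : IsOpen (⋂ j, D j)) {p : M}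
    (hp : p ∈ P.dom) (hpD : p ∈ frontier (⋂ j, D j)) {L : NNReal} {U : Set M} (hU : U ∈ 𝓝 p)
    (he : LipschitzOnWith L e U) :
    ∃ A : NNReal, ∀ᶠ q in 𝓝 p,
      ∏ j, |P.m.r j (e q)| ≤ A * Metric.infDist q (frontier (⋂ j, D j)) := by
  have h_smooth : ContDiff ℝ 1 fun y => ∏ j, P.m.r j y :=
    contDiff_prod fun j _ => (P.m.contDiff_r j).of_le (by simp)
  obtain ⟨A, t, ht, hA⟩ := h_smooth.contDiffAt.exists_lipschitzOnWith (x := e p)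
  refine ⟨A * L, ?_⟩
  simp only [← Finset.abs_prod]
  refine eventually_abs_le_mul_infDist_of_lipschitzOnWith (U := U ∩ e ⁻¹' t ∩ P.dom)
    (g := fun q => ∏ j, P.m.r j (e q)) ?_ ?_ hpD fun q hq => P.prod_r_eq_zero hD hq.1.2 hq.2
  · exact (hA.comp (he.mono inter_subset_left) fun _ hq => hq.2).mono inter_subset_left
  · exact inter_mem (inter_mem hU (e.continuousAt hp.1 ht)) (P.isOpen_dom.mem_nhds hp)

end LocalCorner

namespace IsDomainWithGenericCorners

variable {Ω : Set M}

lemma isOpen [TopologicalSpace M] [ChartedSpace (Cn d) M]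
    (hΩ : IsDomainWithGenericCorners d D Ω) : IsOpen Ω := by
  rw [hΩ.eq_iInter]
  exact isOpen_iInter_of_finite fun j => (hΩ.isSmoothDomain j).isOpen

lemma exists_localCorner_controls [MetricSpace M] [ChartedSpace (Cn d) M]
    [IsManifold 𝓘(ℂ, Cn d) ω M] (hM : IsLocallyEuclideanMetric d M)
    (hΩ : IsDomainWithGenericCorners d D Ω) {f : M → ℂ}
    (hf : HolomorphicOfPolynomialGrowth d Ω f) {p : M} (hp : p ∈ closure Ω) :
    ∃ P : LocalCorner D (chartAt (Cn d) p), p ∈ P.dom ∧ ∃ K C, P.Controls f K C := by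
  have hΩo := hΩ.isOpen
  obtain ⟨P, hpP⟩ := hΩ.exists_localCorner hp
  obtain rfl := hΩ.eq_iInter
  suffices ∃ K C, ∀ᶠ q in 𝓝 p, q ∈ ⋂ j, D j →
      ‖f q‖ * ∏ j, |P.m.r j (chartAt (Cn d) p q)| ^ K ≤ C by
    obtain ⟨K, C, hC⟩ := this
    obtain ⟨P', hpP', hP'⟩ := P.exists_controls_of_eventually hpP hC
    exact ⟨P', hpP', K, C, hP'⟩
  by_cases hpΩ : p ∈ ⋂ j, D j
  · have h_cont : ContinuousAt (fun q => ‖f q‖) p :=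
      (hf.1.continuousOn.continuousAt (hΩo.mem_nhds hpΩ)).norm
    refine ⟨0, ‖f p‖ + 1, (h_cont.eventually_lt_const (lt_add_one _)).mono fun q hq _ => ?_⟩
    simpa using hq.le
  obtain ⟨C, k, hC⟩ := hf.2
  obtain ⟨U, hU, L, hL⟩ := hM p
  have h_lip : LipschitzOnWith L.toNNReal (chartAt (Cn d) p) U :=
    LipschitzOnWith.of_dist_le_mul fun x hx y hy => (hL x hx y hy).1.trans
      (mul_le_mul_of_nonneg_right (Real.le_coe_toNNReal L) dist_nonneg)
  have hpF : p ∈ frontier (⋂ j, D j) := hΩo.frontier_eq ▸ ⟨hp, hpΩ⟩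
  obtain ⟨A, hA⟩ := P.eventually_prod_abs_le_mul_infDist hΩo hpP hpF hU h_lip
  refine ⟨k, A ^ k * C, hA.mono fun q hq hqΩ => ?_⟩
  calc ‖f q‖ * ∏ j, |P.m.r j (chartAt (Cn d) p q)| ^ k
      = ‖f q‖ * (∏ j, |P.m.r j (chartAt (Cn d) p q)|) ^ k := by rw [Finset.prod_pow]
    _ ≤ ‖f q‖ * (A * Metric.infDist q (frontier (⋂ j, D j))) ^ k := by gcongr
    _ = A ^ k * (‖f q‖ * Metric.infDist q (frontier (⋂ j, D j)) ^ k) := by ring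
    _ ≤ A ^ k * C := by gcongr; exact hC q hqΩ

end IsDomainWithGenericCorners

end Growth

section Weight

namespace LocalCorner

variable {d N : ℕ} {M : Type*} [TopologicalSpace M] {D : Fin N → Set M}
  {e : OpenPartialHomeomorph M (Cn d)} {P : LocalCorner D e} {f : M → ℂ} {K : ℕ} {C : ℝ}

variable (P f K) in
lemma weight_mul_eq_indicator {g : Cn d → ℂ} (hg : tsupport g ⊆ P.m.W) (y : Cn d) :
    P.weight f K y * g y =
      P.m.region.indicator (fun y => f (e.symm y) * ((∏ j, (P.m.r j y : ℂ) ^ K) * g y)) y := by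
  by_cases hyW : y ∈ P.m.W
  · by_cases hy : y ∈ P.m.region
    · rw [weight, indicator_of_mem (mem_inter hy hyW), indicator_of_mem hy, mul_assoc]
    · rw [weight, indicator_of_notMem fun h => hy h.1, indicator_of_notMem hy, zero_mul]
  · have hgy : g y = 0 := image_eq_zero_of_notMem_tsupport fun h => hyW (hg h)
    rw [hgy, mul_zero, indicator_apply_eq_zero.2 fun _ => by rw [hgy, mul_zero, mul_zero]]

lemma norm_weight_le (hC : P.Controls f K C) (y : Cn d) : ‖P.weight f K y‖ ≤ |C| := by
  by_cases hy : y ∈ P.m.region ∩ P.m.W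
  · rw [weight, indicator_of_mem hy, norm_mul, norm_prod]
    simp only [norm_pow, Complex.norm_real, Real.norm_eq_abs]
    exact (hC y hy).trans (le_abs_self C)
  · rw [weight, indicator_of_notMem hy, norm_zero]
    exact abs_nonneg C

lemma tendsto_integral_weight_mul (hC : P.Controls f K C) {g : ℕ → Cn d → ℂ} {L : Set (Cn d)}
    (hL : IsCompact L) (hgL : ∀ ν, tsupport (g ν) ⊆ L) (hg : TendstoUniformlyOn g 0 atTop L) :
    Tendsto (fun ν => ∫ y, P.weight f K y * g ν y) atTop (𝓝 0) := by
  refine Metric.tendsto_nhds.2 fun ε hε => ?_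
  obtain ⟨η, hη, hηε⟩ := exists_pos_mul_lt hε (|C| * volume.real L)
  filter_upwards [Metric.tendstoUniformlyOn_iff.1 hg η hη] with ν hν
  rw [dist_zero_right, ← setIntegral_eq_integral_of_forall_compl_eq_zero (s := L) fun y hy => by
    rw [image_eq_zero_of_notMem_tsupport fun h => hy (hgL ν h), mul_zero]]
  rw [mul_right_comm] at hηε
  refine (norm_setIntegral_le_of_norm_le_const hL.measure_lt_top fun y hy => ?_).trans_lt hηε
  have h_lt := hν y hy
  rw [Pi.zero_apply, dist_zero_left] at h_lt
  rw [norm_mul]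
  exact mul_le_mul (norm_weight_le hC y) h_lt.le (norm_nonneg _) (abs_nonneg _)

variable {Q : (Cn d → ℂ) → Cn d → ℂ} {u : Cn d → ℂ}

lemma integral_weight_eq (hQ : P.m.IsBellOperator volume K Q) (hu : P.m.IsTestFunction u)
    (f : M → ℂ) :
    ∫ y, P.weight f K y * Q u y =
      ∫ y in P.m.region, f (e.symm y) * ((∏ i, (P.m.r i y : ℂ) ^ K) * Q u y) := by
  rw [← integral_indicator P.m.isOpen_region.measurableSet]
  exact integral_congr_ae (Eventually.of_forall
    (P.weight_mul_eq_indicator f K (hu.map hQ.isSmoothLocalOperator).tsupport_subset))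

lemma integral_weight_eq_of_isAdmissible (hQ : P.m.IsBellOperator volume K Q)
    (hu : P.m.IsTestFunction u) (hfu : P.m.IsAdmissible u fun y => f (e.symm y)) :
    ∫ y, P.weight f K y * Q u y = ∫ y in P.m.region, f (e.symm y) * u y := by
  rw [integral_weight_eq hQ hu, hQ.setIntegral_eq u _ hu hfu]

lemma norm_mul_prod_pow_mul_le {a w : ℂ} {B : ℝ} {y : Cn d}
    (h : ‖a‖ * ∏ j, |P.m.r j y| ^ K ≤ B) :
    ‖a * ((∏ j, (P.m.r j y : ℂ) ^ K) * w)‖ ≤ B * ‖w‖ := by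
  rw [norm_mul, norm_mul, norm_prod, ← mul_assoc]
  simp only [norm_pow, Complex.norm_real, Real.norm_eq_abs]
  gcongr

lemma tendsto_setIntegral_of_isAdmissible (hQ : P.m.IsBellOperator volume K Q)
    (hu : P.m.IsTestFunction u) {l : Filter ℝ} [l.IsCountablyGenerated] {h : ℝ → Cn d → ℂ}
    {B : ℝ} (h_adm : ∀ᶠ ε in l, P.m.IsAdmissible u (h ε))
    (hB : ∀ᶠ ε in l, ∀ y ∈ P.m.region ∩ tsupport u, ‖h ε y‖ * ∏ j, |P.m.r j y| ^ K ≤ B)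
    (h_lim : ∀ y ∈ P.m.region ∩ tsupport u, Tendsto (fun ε => h ε y) l (𝓝 (f (e.symm y)))) :
    Tendsto (fun ε => ∫ y in P.m.region, h ε y * u y) l
      (𝓝 (∫ y, P.weight f K y * Q u y)) := by
  have hQu := hu.map hQ.isSmoothLocalOperator
  have hQu_supp := hQ.isSmoothLocalOperator.tsupport_subset u
  have hQu_zero : ∀ y ∉ tsupport u, Q u y = 0 := fun y hy =>
    image_eq_zero_of_notMem_tsupport fun h => hy (hQu_supp h)
  have h_prod : Continuous fun y => ∏ j, (P.m.r j y : ℂ) ^ K :=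
    continuous_finsetProd _ fun j _ => (P.m.contDiff_ofReal_comp_r contDiff_id j).continuous.pow K
  have h_region := P.m.isOpen_region.measurableSet
  rw [integral_weight_eq hQ hu]
  refine (tendsto_integral_filter_of_dominated_convergence (fun y => B * ‖Q u y‖)
    ?_ ?_ ?_ ?_).congr' (h_adm.mono fun ε hε => (hQ.setIntegral_eq u (h ε) hu hε).symm)
  · filter_upwards [h_adm] with ε hε
    exact (hε.integrableOn (h_prod.mul hQu.contDiff.continuous) hQu.hasCompactSupport.mul_left
      (tsupport_mul_subset_right.trans hQu_supp)).aestronglyMeasurable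
  · filter_upwards [hB] with ε hε
    refine ae_restrict_of_forall_mem h_region fun y hy => ?_
    by_cases hyu : y ∈ tsupport u
    · exact norm_mul_prod_pow_mul_le (hε y ⟨hy, hyu⟩)
    · simp [hQu_zero y hyu]
  · exact ((hQu.contDiff.continuous.integrable_of_hasCompactSupport
      hQu.hasCompactSupport).norm.const_mul _).integrableOn
  · refine ae_restrict_of_forall_mem h_region fun y hy => ?_
    by_cases hyu : y ∈ tsupport u
    · exact (h_lim y ⟨hy, hyu⟩).mul_const _
    · simp only [hQu_zero y hyu, mul_zero]
      exact tendsto_const_nhds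

variable [ChartedSpace (Cn d) M]

lemma differentiableOn_region (P : LocalCorner D e) (he : e ∈ holoCharts d M)
    (hf : MDifferentiableOn 𝓘(ℂ, Cn d) 𝓘(ℂ, ℂ) f (⋂ j, D j)) :
    DifferentiableOn ℂ (fun y => f (e.symm y)) (P.m.region ∩ P.m.W) :=
  (differentiableOn_comp_symm hf he).mono fun _ hy =>
    ⟨P.W_subset hy.2, (P.mem_iInter_iff hy.2).2 hy.1⟩

lemma aestronglyMeasurable_weight (he : e ∈ holoCharts d M)
    (hf : MDifferentiableOn 𝓘(ℂ, Cn d) 𝓘(ℂ, ℂ) f (⋂ j, D j)) :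
    AEStronglyMeasurable (P.weight f K) volume := by
  have h_meas : MeasurableSet (P.m.region ∩ P.m.W) :=
    (P.m.isOpen_region.inter P.m.isOpen_W).measurableSet
  refine (aestronglyMeasurable_indicator_iff h_meas).2 (ContinuousOn.aestronglyMeasurable ?_ h_meas)
  exact (P.differentiableOn_region he hf).continuousOn.mul
    (continuous_finsetProd _ fun j _ =>
      (P.m.contDiff_ofReal_comp_r contDiff_id j).continuous.pow K).continuousOn

lemma integrable_weight_mul (he : e ∈ holoCharts d M)
    (hf : MDifferentiableOn 𝓘(ℂ, Cn d) 𝓘(ℂ, ℂ) f (⋂ j, D j)) (hC : P.Controls f K C)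
    {g : Cn d → ℂ} (hg : Continuous g) (hgc : HasCompactSupport g) :
    Integrable fun y => P.weight f K y * g y :=
  (hg.integrable_of_hasCompactSupport hgc).bdd_mul (aestronglyMeasurable_weight he hf)
    (Eventually.of_forall (norm_weight_le hC))

lemma isAdmissible_comp_symm (he : e ∈ holoCharts d M)
    (hf : MDifferentiableOn 𝓘(ℂ, Cn d) 𝓘(ℂ, ℂ) f (⋂ j, D j)) {u : Cn d → ℂ}
    (hu : tsupport u ⊆ P.m.W) {B : ℝ} (hB : ∀ y ∈ P.m.region ∩ tsupport u, ‖f (e.symm y)‖ ≤ B) :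
    P.m.IsAdmissible u fun y => f (e.symm y) :=
  ⟨⟨_, P.m.isOpen_region.inter P.m.isOpen_W, P.differentiableOn_region he hf,
    inter_subset_inter_right _ hu⟩, B, hB⟩

end LocalCorner

end Weight

section Shift

/-- The translation by `-ε v` in the chart `e`. Its value at `q` is meaningful only if
`q ∈ e.source` and `e q - ε v ∈ e.target`. -/
def chartShift {d : ℕ} {M : Type*} [TopologicalSpace M] (e : OpenPartialHomeomorph M (Cn d))
    (v : Cn d) (ε : ℝ) (q : M) : M := e.symm (e q - ε • v)

namespace LocalCorner

variable {d N : ℕ} {M : Type*} [TopologicalSpace M] {D : Fin N → Set M}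
  {c e : OpenPartialHomeomorph M (Cn d)}

/-- The translation by `-ε v` in the chart `e` is defined at `q`, stays in the coordinate
neighbourhood of `P`, and moves `q` into the domain, away from each face by a definite
proportion. -/
structure IsShiftedInside (P : LocalCorner D c) (e : OpenPartialHomeomorph M (Cn d)) (v : Cn d)
    (ε : ℝ) (q : M) : Prop where
  mem_target : e q - ε • v ∈ e.target
  mem_dom : chartShift e v ε q ∈ P.dom
  mem_iInter : chartShift e v ε q ∈ ⋂ j, D j
  r_le : ∀ j, P.m.r j (c (chartShift e v ε q)) ≤ P.m.r j (c q) / 2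

lemma mem_frontier_of_r_eq_zero (P : LocalCorner D c) (hD : ∀ j, IsOpen (D j)) {q : M}
    (hq : q ∈ P.dom) (hqD : q ∈ closure (⋂ j, D j)) {j : P.S} (hj : P.m.r j (c q) = 0) :
    q ∈ frontier (D j) := by
  rw [(hD j).frontier_eq]
  exact ⟨closure_mono (iInter_subset _ _) hqD, fun h => ((P.mem_iff_of_mem_dom j hq).1 h).ne hj⟩

variable [ChartedSpace (Cn d) M]

lemma volume_frontier_inter_dom_eq_zero (P : LocalCorner D c) (hc : c ∈ holoCharts d M)
    (he : e ∈ holoCharts d M) (hD : IsOpen (⋂ j, D j)) :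
    volume (e.target ∩ e.symm ⁻¹' (P.dom ∩ frontier (⋂ j, D j))) = 0 := by
  let Z : Set (Cn d) := (c.symm.trans e).source ∩ ⋃ j, {z ∈ P.m.W | P.m.r j z = 0}
  have hZ : volume Z = 0 := measure_mono_null inter_subset_right
    (measure_iUnion_null fun j => P.m.addHaar_face_eq_zero volume j)
  refine measure_mono_null ?_ (addHaar_image_eq_zero_of_differentiableOn_of_addHaar_eq_zero volume
    (((differentiableOn_transition hc he).restrictScalars ℝ).mono inter_subset_left) hZ)
  rintro z ⟨hz, hzP, hzD⟩
  obtain ⟨j, -, hj⟩ := Finset.prod_eq_zero_iff.1 (P.prod_r_eq_zero hD hzP hzD)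
  refine ⟨c (e.symm z), ⟨mem_source_transition.2 ⟨c.map_source hzP.1, ?_⟩,
    mem_iUnion.2 ⟨j, hzP.2, hj⟩⟩, ?_⟩
  · rw [c.left_inv hzP.1]
    exact e.map_target hz
  · simp [c.left_inv hzP.1, e.right_inv hz]

variable [IsManifold 𝓘(ℂ, Cn d) ω M]

lemma isLocalDefiningFunction_r_comp (P : LocalCorner D c) (hc : c ∈ holoCharts d M) {q : M}
    (hq : q ∈ P.dom) (j : P.S) : IsLocalDefiningFunction d (D j) q (P.m.r j ∘ c) := by
  have : IsManifold 𝓘(ℝ, Cn d) ∞ M := isManifold_real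
  have h_smooth : ContMDiffOn 𝓘(ℝ, Cn d) 𝓘(ℝ, ℝ) ∞ (P.m.r j ∘ c) P.dom :=
    (P.m.contDiff_r j).contMDiff.comp_contMDiffOn
      ((contMDiffOn_of_mem_maximalAtlas (mem_maximalAtlas_real hc)).mono inter_subset_left)
  have h_chart : chartAt (Cn d) q ∈ holoCharts d M := IsManifold.chart_mem_maximalAtlas q
  refine ⟨⟨P.dom, P.isOpen_dom, hq, h_smooth, fun x hx => P.mem_iff_of_mem_dom j hx⟩,
    fderiv_comp_symm_ne_zero hc h_chart hq.1 (mem_chart_source _ q) ?_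
      ((contDiffAt_comp_symm_of_mem P.isOpen_dom h_smooth h_chart hq
        (mem_chart_source _ q)).differentiableAt (by simp))⟩
  have h_eq : (P.m.r j ∘ c) ∘ c.symm =ᶠ[𝓝 (c q)] P.m.r j := by
    filter_upwards [c.open_target.mem_nhds (c.map_source hq.1)] with z hz
    simp [c.right_inv hz]
  rw [h_eq.fderiv_eq]
  exact P.m.fderiv_r_ne_zero hq.2 j

lemma eventually_r_comp_le_half (P : LocalCorner D c) (hc : c ∈ holoCharts d M)
    (he : e ∈ holoCharts d M) (hD : ∀ j, IsOpen (D j)) {q : M} (hq : q ∈ P.dom)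
    (hqe : q ∈ e.source) (hqD : q ∈ closure (⋂ j, D j)) {v : Cn d}
    (hv : ∀ j, q ∈ frontier (D j) → PointsOutward d (D j) e v q) (j : P.S) :
    ∀ᶠ s : Cn d × ℝ in 𝓝 (e q) ×ˢ 𝓝[>] 0, ((P.m.r j ∘ c) ∘ e.symm) s.1 ≤ 0 →
      ((P.m.r j ∘ c) ∘ e.symm) (s.1 - s.2 • v) < 0 ∧
      ((P.m.r j ∘ c) ∘ e.symm) (s.1 - s.2 • v) ≤ ((P.m.r j ∘ c) ∘ e.symm) s.1 / 2 := by
  have h_def := P.isLocalDefiningFunction_r_comp hc hq j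
  refine eventually_le_half_of_pos_fderiv ((h_def.contDiffAt_comp_symm he hqe).of_le (by simp))
    ?_ fun h_zero => ?_
  · simpa only [Function.comp_apply, e.left_inv hqe] using P.r_nonpos hq hqD j
  · simp only [Function.comp_apply, e.left_inv hqe] at h_zero
    have hqj := P.mem_frontier_of_r_eq_zero hD hq hqD h_zero
    obtain ⟨r', hr', hr'v⟩ := hv j hqj
    exact h_def.fderiv_comp_symm_pos hr' (hD j) hqj he hqe hr'v

lemma eventually_isShiftedInside (P : LocalCorner D c) (hc : c ∈ holoCharts d M)
    (he : e ∈ holoCharts d M) (hD : ∀ j, IsOpen (D j)) {q₀ : M} (hq₀ : q₀ ∈ P.dom)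
    (hq₀e : q₀ ∈ e.source) (hq₀D : q₀ ∈ closure (⋂ j, D j)) {v : Cn d}
    (hv : ∀ j, q₀ ∈ frontier (D j) → PointsOutward d (D j) e v q₀) :
    ∀ᶠ s : ℝ × M in 𝓝[>] 0 ×ˢ 𝓝 q₀, s.2 ∈ closure (⋂ j, D j) →
      P.IsShiftedInside e v s.1 s.2 := by
  have h_base : Tendsto (fun s : ℝ × M => e s.2) (𝓝[>] 0 ×ˢ 𝓝 q₀) (𝓝 (e q₀)) :=
    (e.continuousAt hq₀e).tendsto.comp tendsto_snd
  have h_shift : Tendsto (fun s : ℝ × M => e s.2 - s.1 • v) (𝓝[>] 0 ×ˢ 𝓝 q₀) (𝓝 (e q₀)) := by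
    have h_time : Tendsto (fun s : ℝ × M => s.1) (𝓝[>] 0 ×ˢ 𝓝 q₀) (𝓝 0) :=
      tendsto_fst.mono_right nhdsWithin_le_nhds
    simpa using h_base.sub (h_time.smul_const v)
  have h_nhds : e.target ∩ e.symm ⁻¹' P.dom ∈ 𝓝 (e q₀) :=
    (e.isOpen_inter_preimage_symm P.isOpen_dom).mem_nhds
      ⟨e.map_source hq₀e, by rwa [mem_preimage, e.left_inv hq₀e]⟩
  have h_half := (h_base.prodMk tendsto_fst).eventually
    (eventually_all.2 (P.eventually_r_comp_le_half hc he hD hq₀ hq₀e hq₀D hv))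
  have h_source : ∀ᶠ s : ℝ × M in 𝓝[>] 0 ×ˢ 𝓝 q₀, s.2 ∈ P.dom ∩ e.source :=
    tendsto_snd.eventually ((P.isOpen_dom.inter e.open_source).mem_nhds ⟨hq₀, hq₀e⟩)
  filter_upwards [h_shift.eventually h_nhds, h_half, h_source]
    with s ⟨h_target, h_dom⟩ hs ⟨hsP, hse⟩ hsD
  simp only [Function.comp_apply, e.left_inv hse] at hs
  have h_nonpos := P.r_nonpos hsP hsD
  refine ⟨h_target, h_dom, ?_, fun j => (hs j (h_nonpos j)).2⟩
  have h_mem := (P.mem_iInter_iff h_dom.2).2 fun j => (hs j (h_nonpos j)).1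
  rwa [c.left_inv h_dom.1] at h_mem

lemma eventually_forall_isShiftedInside (P : LocalCorner D c) (hc : c ∈ holoCharts d M)
    (he : e ∈ holoCharts d M) (hD : ∀ j, IsOpen (D j)) {K : Set M} (hK : IsCompact K)
    (hKP : K ⊆ P.dom) (hKe : K ⊆ e.source) {v : Cn d}
    (hv : ∀ j, ∀ p ∈ frontier (D j) ∩ K, PointsOutward d (D j) e v p) :
    ∀ᶠ ε : ℝ in 𝓝[>] 0, ∀ q ∈ closure (⋂ j, D j) ∩ K, P.IsShiftedInside e v ε q := by
  have h_local := (hK.inter_left isClosed_closure).mem_prod_nhdsSet_of_forall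
    fun q (hq : q ∈ closure (⋂ j, D j) ∩ K) => P.eventually_isShiftedInside hc he hD (hKP hq.2)
      (hKe hq.2) hq.1 fun j hj => hv j q ⟨hj, hq.2⟩
  filter_upwards [Eventually.curry h_local] with ε hε q hq using hε.self_of_nhdsSet q hq hq.1

end LocalCorner

lemma volume_frontier_eq_zero {d N : ℕ} {M : Type*} [TopologicalSpace M] [ChartedSpace (Cn d) M]
    {D : Fin N → Set M} {e : OpenPartialHomeomorph M (Cn d)}
    (hD : IsOpen (⋂ j, D j))
    (h_cover : ∀ p ∈ frontier (⋂ j, D j), ∃ c ∈ holoCharts d M, ∃ P : LocalCorner D c, p ∈ P.dom)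
    (he : e ∈ holoCharts d M) :
    volume (e.target ∩ e.symm ⁻¹' frontier (⋂ j, D j)) = 0 := by
  refine measure_null_of_locally_null _ fun y hy => ?_
  obtain ⟨c, hc, P, hP⟩ := h_cover _ hy.2
  refine ⟨_, mem_nhdsWithin.2 ⟨_, e.isOpen_inter_preimage_symm P.isOpen_dom, ⟨hy.1, hP⟩,
    Subset.rfl⟩, measure_mono_null ?_ (P.volume_frontier_inter_dom_eq_zero hc he hD)⟩
  rintro z ⟨⟨hz, hzP⟩, -, hzD⟩
  exact ⟨hz, hzP, hzD⟩

end Shift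

section LocalPairing

namespace LocalCorner

variable {n N : ℕ} {M : Type*} [TopologicalSpace M] [ChartedSpace (Cn (n + 1)) M]
  {D : Fin N → Set M} {c e : OpenPartialHomeomorph M (Cn (n + 1))} {P : LocalCorner D c}
  {f : M → ℂ} {K : ℕ} {C : ℝ} {Q : (Cn (n + 1) → ℂ) → Cn (n + 1) → ℂ}
  {φ ψ : DiffForm (n + 1) M (n + 1 + n + 1)}

variable (P f K Q) in
/-- The pairing of `f` with a form `φ` supported near a corner, the growth of `f` being compensated
by the `K`-th powers of the defining functions, to which integration by parts has led. -/
def regularizedPairing (φ : DiffForm (n + 1) M (n + 1 + n + 1)) : ℂ :=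
  ∫ y, P.weight f K y * Q (extCoeff φ c) y

lemma tsupport_extCoeff_smul_subset {χ : M → ℝ} {L : Set M} (hL : IsCompact L)
    (hφL : ∀ x ∉ L, φ x = 0) (hχ : tsupport χ ⊆ c.source) :
    tsupport (extCoeff (χ • φ) c) ⊆ c '' (tsupport χ ∩ L) := by
  refine tsupport_extCoeff_subset (hL.inter_left (isClosed_tsupport χ))
    (inter_subset_left.trans hχ) fun x hx => ?_
  rw [Pi.smul_apply']
  by_cases hxL : x ∈ L
  · rw [image_eq_zero_of_notMem_tsupport fun h => hx ⟨h, hxL⟩]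
    exact zero_smul ℝ (φ x)
  · rw [hφL x hxL]
    exact smul_zero (A := (Cn (n + 1)) [⋀^Fin (n + 1 + n + 1)]→L[ℝ] ℂ) (χ x)

variable [T2Space M]

lemma apply_symm_mem_of_mem_tsupport_extCoeff (hφ : φ ∈ testForms (n + 1) M (n + 1 + n + 1))
    (hφP : tsupport φ ⊆ P.dom) {y : Cn (n + 1)}
    (hy : y ∈ P.m.region ∩ tsupport (extCoeff φ c)) :
    y ∈ c.target ∧ c.symm y ∈ (⋂ j, D j) ∩ tsupport φ := by
  obtain ⟨q, hq, rfl⟩ :=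
    tsupport_extCoeff_subset_image hφ (hφP.trans inter_subset_left) hy.2
  obtain ⟨hqc, hqW⟩ := hφP hq
  refine ⟨c.map_source hqc, (P.mem_iInter_iff hqW).2 hy.1, ?_⟩
  rwa [c.left_inv hqc]

lemma tsupport_extCoeff_subset_W (hφ : φ ∈ testForms (n + 1) M (n + 1 + n + 1))
    (hφP : tsupport φ ⊆ P.dom) : tsupport (extCoeff φ c) ⊆ P.m.W := fun y hy => by
  obtain ⟨q, hq, rfl⟩ := tsupport_extCoeff_subset_image hφ (hφP.trans inter_subset_left) hy
  exact (hφP hq).2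

lemma setIntegral_target_indicator_eq (hφ : φ ∈ testForms (n + 1) M (n + 1 + n + 1))
    (hφP : tsupport φ ⊆ P.dom) (G : M → ℂ) :
    ∫ y in c.target, (⋂ j, D j).indicator G (c.symm y) * topCoeff φ c y =
      ∫ y in P.m.region, G (c.symm y) * extCoeff φ c y := by
  have h_zero : ∀ y ∉ P.m.W, extCoeff φ c y = 0 := fun y hy =>
    image_eq_zero_of_notMem_tsupport fun h => hy (tsupport_extCoeff_subset_W hφ hφP h)
  have h_region := P.m.isOpen_region.measurableSet
  rw [setIntegral_eq_of_subset_of_forall_sdiff_eq_zero c.open_target.measurableSet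
      (inter_subset_right.trans P.W_subset : P.m.region ∩ P.m.W ⊆ c.target) ?_,
    setIntegral_eq_of_subset_of_forall_sdiff_eq_zero h_region
      (inter_subset_left : P.m.region ∩ P.m.W ⊆ P.m.region) ?_]
  · refine setIntegral_congr_fun (h_region.inter P.m.isOpen_W.measurableSet) fun y hy => ?_
    simp only [indicator_of_mem ((P.mem_iInter_iff hy.2).2 hy.1),
      extCoeff_of_mem (P.W_subset hy.2)]
  · intro y hy
    rw [h_zero y fun hyW => hy.2 ⟨hy.1, hyW⟩, mul_zero]
  · intro y hy
    by_cases hyW : y ∈ P.m.W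
    · rw [indicator_of_notMem fun h => hy.2 ⟨(P.mem_iInter_iff hyW).1 h, hyW⟩, zero_mul]
    · rw [← extCoeff_of_mem hy.1, h_zero y hyW, mul_zero]

lemma isTestFunction_extCoeff (hc : c ∈ holoCharts (n + 1) M)
    (hφ : φ ∈ testForms (n + 1) M (n + 1 + n + 1)) (hφP : tsupport φ ⊆ P.dom) :
    P.m.IsTestFunction (extCoeff φ c) where
  contDiff := contDiff_extCoeff hφ hc (hφP.trans inter_subset_left)
  hasCompactSupport := hasCompactSupport_extCoeff hφ (hφP.trans inter_subset_left)
  tsupport_subset := tsupport_extCoeff_subset_W hφ hφP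

lemma regularizedPairing_add (hc : c ∈ holoCharts (n + 1) M)
    (hf : MDifferentiableOn 𝓘(ℂ, Cn (n + 1)) 𝓘(ℂ, ℂ) f (⋂ j, D j)) (hC : P.Controls f K C)
    (hQ : IsSmoothLocalOperator Q) (hφ : φ ∈ testForms (n + 1) M (n + 1 + n + 1))
    (hφP : tsupport φ ⊆ P.dom) (hψ : ψ ∈ testForms (n + 1) M (n + 1 + n + 1))
    (hψP : tsupport ψ ⊆ P.dom) :
    P.regularizedPairing f K Q (φ + ψ) =
      P.regularizedPairing f K Q φ + P.regularizedPairing f K Q ψ := by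
  have hφu := isTestFunction_extCoeff hc hφ hφP
  have hψu := isTestFunction_extCoeff hc hψ hψP
  have h_int {u : Cn (n + 1) → ℂ} (hu : P.m.IsTestFunction u) :
      Integrable fun y => P.weight f K y * Q u y :=
    integrable_weight_mul hc hf hC (hu.map hQ).contDiff.continuous (hu.map hQ).hasCompactSupport
  rw [regularizedPairing, regularizedPairing, regularizedPairing,
    ← integral_add (h_int hφu) (h_int hψu), extCoeff_add, hQ.map_add hφu.contDiff hψu.contDiff]
  simp only [Pi.add_apply, mul_add]

lemma regularizedPairing_smul (hc : c ∈ holoCharts (n + 1) M) (hQ : IsSmoothLocalOperator Q)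
    (hφ : φ ∈ testForms (n + 1) M (n + 1 + n + 1)) (hφP : tsupport φ ⊆ P.dom) (a : ℂ) :
    P.regularizedPairing f K Q (a • φ) = a * P.regularizedPairing f K Q φ := by
  rw [regularizedPairing, regularizedPairing, extCoeff_smul,
    hQ.map_const_smul a (isTestFunction_extCoeff hc hφ hφP).contDiff, ← integral_const_mul]
  simp only [Pi.smul_apply, smul_eq_mul, mul_left_comm]

lemma regularizedPairing_eq_setIntegral (hc : c ∈ holoCharts (n + 1) M)
    (hf : MDifferentiableOn 𝓘(ℂ, Cn (n + 1)) 𝓘(ℂ, ℂ) f (⋂ j, D j))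
    (hQ : P.m.IsBellOperator volume K Q) (hφ : φ ∈ testForms (n + 1) M (n + 1 + n + 1))
    (hφP : tsupport φ ⊆ P.dom) {B : ℝ} (hB : ∀ q ∈ (⋂ j, D j) ∩ tsupport φ, ‖f q‖ ≤ B) :
    P.regularizedPairing f K Q φ = ∫ y in P.m.region, f (c.symm y) * extCoeff φ c y :=
  have hu := isTestFunction_extCoeff hc hφ hφP
  integral_weight_eq_of_isAdmissible hQ hu (isAdmissible_comp_symm hc hf hu.tsupport_subset
    fun _ hy => hB _ (apply_symm_mem_of_mem_tsupport_extCoeff hφ hφP hy).2)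

variable [IsManifold 𝓘(ℂ, Cn (n + 1)) ω M]

lemma setIntegral_eq_setIntegral_region (hc : c ∈ holoCharts (n + 1) M)
    (he : e ∈ holoCharts (n + 1) M) (hD : IsOpen (⋂ j, D j))
    (hφ : φ ∈ testForms (n + 1) M (n + 1 + n + 1)) (hφP : tsupport φ ⊆ P.dom)
    (hφe : tsupport φ ⊆ e.source) (G : M → ℂ) :
    ∫ y in e.target ∩ e.symm ⁻¹' (⋂ j, D j), G (e.symm y) * topCoeff φ e y =
      ∫ y in P.m.region, G (c.symm y) * extCoeff φ c y := by
  rw [← setIntegral_target_indicator_eq hφ hφP,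
    ← integral_target_eq_integral_target he hc hφe (hφP.trans inter_subset_left),
    setIntegral_eq_of_subset_of_forall_sdiff_eq_zero e.open_target.measurableSet
      (inter_subset_left : e.target ∩ e.symm ⁻¹' (⋂ j, D j) ⊆ e.target) fun y hy => by
        rw [indicator_of_notMem (s := ⋂ j, D j) fun h => hy.2 ⟨hy.1, h⟩, zero_mul]]
  refine setIntegral_congr_fun (e.isOpen_inter_preimage_symm hD).measurableSet fun y hy => ?_
  have hyD : e.symm y ∈ ⋂ j, D j := hy.2
  simp only [indicator_of_mem hyD]

lemma tendsto_regularizedPairing_smul (hc : c ∈ holoCharts (n + 1) M) (hC : P.Controls f K C)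
    (hQ : IsSmoothLocalOperator Q) {χ : M → ℝ}
    (hχ : ContMDiff 𝓘(ℝ, Cn (n + 1)) 𝓘(ℝ, ℝ) ∞ χ) (hχP : tsupport χ ⊆ P.dom)
    {φ : ℕ → DiffForm (n + 1) M (n + 1 + n + 1)}
    (hφ : ∀ ν, φ ν ∈ testForms (n + 1) M (n + 1 + n + 1)) (hφ₀ : TendstoZero φ) :
    Tendsto (fun ν => P.regularizedPairing f K Q (χ • φ ν)) atTop (𝓝 0) := by
  obtain ⟨K₀, hK₀, hφK₀⟩ := hφ₀.1
  have h_compact : IsCompact (tsupport χ ∩ K₀) := hK₀.inter_left (isClosed_tsupport χ)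
  have h_source : tsupport χ ∩ K₀ ⊆ c.source :=
    inter_subset_left.trans (hχP.trans inter_subset_left)
  have hL := h_compact.image_of_continuousOn (c.continuousOn.mono h_source)
  have hLc : c '' (tsupport χ ∩ K₀) ⊆ c.target :=
    image_subset_iff.2 fun x hx => c.map_source (h_source hx)
  have h_smooth (ν : ℕ) : ContDiff ℝ ∞ (extCoeff (χ • φ ν) c) :=
    contDiff_extCoeff (smul_mem_testForms hχ (hφ ν)) hc
      ((tsupport_smul_subset_left χ (φ ν)).trans (hχP.trans inter_subset_left))
  have h_lim := hQ.tendsto hL h_smooth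
    (SmoothlyTendstoZero.extCoeff_smul hχ (fun ν => (hφ ν).1) hφ₀ hc hL hLc)
  refine tendsto_integral_weight_mul hC hL (fun ν => (hQ.tsupport_subset _).trans
    (tsupport_extCoeff_smul_subset hK₀ (hφK₀ ν) (hχP.trans inter_subset_left))) ?_
  refine Metric.tendstoUniformlyOn_iff.2 fun ε hε => ?_
  filter_upwards [smoothlyTendstoZero_iff.1 h_lim 0 ε hε] with ν hν y hy
  simpa using hν y hy

end LocalCorner

end LocalPairing

section ShiftLimit

lemma tendsto_chartShift {d : ℕ} {M : Type*} [TopologicalSpace M]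
    {e : OpenPartialHomeomorph M (Cn d)} {q : M} (hq : q ∈ e.source) (v : Cn d) :
    Tendsto (fun ε => chartShift e v ε q) (𝓝[>] 0) (𝓝 q) := by
  have h_cont : Continuous fun ε : ℝ => e q - ε • v := by fun_prop
  have h_shift : Tendsto (fun ε : ℝ => e q - ε • v) (𝓝[>] 0) (𝓝 (e q)) := by
    simpa using (h_cont.tendsto 0).mono_left nhdsWithin_le_nhds
  have h_symm := (e.continuousAt_symm (e.map_source hq)).tendsto.comp h_shift
  rwa [e.left_inv hq] at h_symm

namespace LocalCorner

section Charts

variable {d N : ℕ} {M : Type*} [TopologicalSpace M] {D : Fin N → Set M}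
  {c e : OpenPartialHomeomorph M (Cn d)} {P : LocalCorner D c} {f : M → ℂ} {K : ℕ} {C : ℝ}
  {v : Cn d} {ε : ℝ}

lemma norm_comp_chartShift_mul_prod_le (hC : P.Controls f K C) {q : M} (hq : q ∈ P.dom)
    (hqD : q ∈ ⋂ j, D j) (h : P.IsShiftedInside e v ε q) :
    ‖f (chartShift e v ε q)‖ * ∏ j, |P.m.r j (c q)| ^ K ≤ (∏ _j : P.S, (2 : ℝ) ^ K) * C := by
  obtain ⟨h_source, hW⟩ := h.mem_dom
  have h_region : c q ∈ P.m.region := by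
    rw [← P.mem_iInter_iff hq.2, c.left_inv hq.1]
    exact hqD
  have h_region_shift : c (chartShift e v ε q) ∈ P.m.region := by
    rw [← P.mem_iInter_iff hW, c.left_inv h_source]
    exact h.mem_iInter
  have h_control := hC _ ⟨h_region_shift, hW⟩
  rw [c.left_inv h_source] at h_control
  have h_abs (j : P.S) : |P.m.r j (c q)| ≤ 2 * |P.m.r j (c (chartShift e v ε q))| := by
    rw [abs_of_neg (h_region j), abs_of_neg (h_region_shift j)]
    linarith [h.r_le j]
  calc ‖f (chartShift e v ε q)‖ * ∏ j, |P.m.r j (c q)| ^ K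
      ≤ ‖f (chartShift e v ε q)‖ * ∏ j, (2 * |P.m.r j (c (chartShift e v ε q))|) ^ K := by
        gcongr with j
        exact h_abs j
    _ = (∏ _j : P.S, (2 : ℝ) ^ K) *
          (‖f (chartShift e v ε q)‖ * ∏ j, |P.m.r j (c (chartShift e v ε q))| ^ K) := by
        simp only [mul_pow, Finset.prod_mul_distrib]
        ring
    _ ≤ (∏ _j : P.S, (2 : ℝ) ^ K) * C := by gcongr

variable [ChartedSpace (Cn d) M]

lemma continuousOn_comp_chartShift (he : e ∈ holoCharts d M)
    (hf : MDifferentiableOn 𝓘(ℂ, Cn d) 𝓘(ℂ, ℂ) f (⋂ j, D j)) {s : Set M} (hs : s ⊆ e.source)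
    (h : ∀ q ∈ s, P.IsShiftedInside e v ε q) :
    ContinuousOn (fun q => f (chartShift e v ε q)) s :=
  (differentiableOn_comp_symm hf he).continuousOn.comp
    ((e.continuousOn.mono hs).sub continuousOn_const)
    fun q hq => ⟨(h q hq).mem_target, (h q hq).mem_iInter⟩

lemma exists_norm_comp_chartShift_le (he : e ∈ holoCharts d M)
    (hf : MDifferentiableOn 𝓘(ℂ, Cn d) 𝓘(ℂ, ℂ) f (⋂ j, D j)) {L : Set M} (hL : IsCompact L)
    (hLe : L ⊆ e.source)
    (h : ∀ q ∈ closure (⋂ j, D j) ∩ L, P.IsShiftedInside e v ε q) :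
    ∃ B, ∀ q ∈ (⋂ j, D j) ∩ L, ‖f (chartShift e v ε q)‖ ≤ B := by
  obtain ⟨B, hB⟩ := (hL.inter_left isClosed_closure).exists_bound_of_continuousOn
    (continuousOn_comp_chartShift he hf (inter_subset_right.trans hLe) h)
  exact ⟨B, fun q hq => hB q ⟨subset_closure hq.1, hq.2⟩⟩

lemma exists_isOpen_differentiableOn_comp_chartShift (hc : c ∈ holoCharts d M)
    (he : e ∈ holoCharts d M) (hD : IsOpen (⋂ j, D j))
    (hf : MDifferentiableOn 𝓘(ℂ, Cn d) 𝓘(ℂ, ℂ) f (⋂ j, D j)) (v : Cn d) (ε : ℝ) :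
    ∃ O, IsOpen O ∧ DifferentiableOn ℂ (fun y => f (chartShift e v ε (c.symm y))) O ∧
      ∀ q ∈ c.source ∩ e.source, e q - ε • v ∈ e.target →
        chartShift e v ε q ∈ ⋂ j, D j → c q ∈ O := by
  have h_shift : DifferentiableOn ℂ (fun y => (e ∘ c.symm) y - ε • v) (c.symm.trans e).source :=
    (differentiableOn_transition hc he).sub_const _
  refine ⟨_, h_shift.continuousOn.isOpen_inter_preimage (c.symm.trans e).open_source
    (e.isOpen_inter_preimage_symm hD), (differentiableOn_comp_symm hf he).comp
    (h_shift.mono inter_subset_left) fun _ hy => hy.2, fun q hq h_target h_mem => ⟨?_, ?_⟩⟩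
  · refine mem_source_transition.2 ⟨c.map_source hq.1, ?_⟩
    rw [c.left_inv hq.1]
    exact hq.2
  · rw [mem_preimage, Function.comp_apply, c.left_inv hq.1]
    exact ⟨h_target, h_mem⟩

end Charts

variable {n N : ℕ} {M : Type*} [TopologicalSpace M] [T2Space M] [ChartedSpace (Cn (n + 1)) M]
  {D : Fin N → Set M} {c e : OpenPartialHomeomorph M (Cn (n + 1))} {P : LocalCorner D c}
  {f : M → ℂ} {φ : DiffForm (n + 1) M (n + 1 + n + 1)} {v : Cn (n + 1)}

lemma isAdmissible_comp_chartShift (hc : c ∈ holoCharts (n + 1) M) (he : e ∈ holoCharts (n + 1) M)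
    (hD : IsOpen (⋂ j, D j))
    (hf : MDifferentiableOn 𝓘(ℂ, Cn (n + 1)) 𝓘(ℂ, ℂ) f (⋂ j, D j))
    (hφ : φ ∈ testForms (n + 1) M (n + 1 + n + 1)) (hφP : tsupport φ ⊆ P.dom)
    (hφe : tsupport φ ⊆ e.source) {ε : ℝ}
    (h : ∀ q ∈ closure (⋂ j, D j) ∩ tsupport φ, P.IsShiftedInside e v ε q) :
    P.m.IsAdmissible (extCoeff φ c) fun y => f (chartShift e v ε (c.symm y)) := by
  obtain ⟨O, hO, h_diff, h_mem⟩ :=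
    exists_isOpen_differentiableOn_comp_chartShift hc he hD hf v ε
  obtain ⟨B, hB⟩ :=
    exists_norm_comp_chartShift_le he hf (isCompact_tsupport_of_mem_testForms hφ) hφe h
  refine ⟨⟨O, hO, h_diff, fun y hy => ?_⟩, B, fun y hy =>
    hB _ (apply_symm_mem_of_mem_tsupport_extCoeff hφ hφP hy).2⟩
  obtain ⟨hyc, hyD, hyφ⟩ := apply_symm_mem_of_mem_tsupport_extCoeff hφ hφP hy
  have h_shifted := h _ ⟨subset_closure hyD, hyφ⟩
  rw [← c.right_inv hyc]
  exact h_mem _ ⟨c.map_target hyc, hφe hyφ⟩ h_shifted.mem_target h_shifted.mem_iInter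

lemma tendsto_setIntegral_comp_chartShift {K : ℕ} {C : ℝ}
    {Q : (Cn (n + 1) → ℂ) → Cn (n + 1) → ℂ} (hc : c ∈ holoCharts (n + 1) M)
    (he : e ∈ holoCharts (n + 1) M) (hD : IsOpen (⋂ j, D j))
    (hf : MDifferentiableOn 𝓘(ℂ, Cn (n + 1)) 𝓘(ℂ, ℂ) f (⋂ j, D j)) (hC : P.Controls f K C)
    (hQ : P.m.IsBellOperator volume K Q) (hφ : φ ∈ testForms (n + 1) M (n + 1 + n + 1))
    (hφP : tsupport φ ⊆ P.dom) (hφe : tsupport φ ⊆ e.source)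
    (h : ∀ᶠ ε in 𝓝[>] 0, ∀ q ∈ closure (⋂ j, D j) ∩ tsupport φ, P.IsShiftedInside e v ε q) :
    Tendsto (fun ε => ∫ y in P.m.region, f (chartShift e v ε (c.symm y)) * extCoeff φ c y)
      (𝓝[>] 0) (𝓝 (P.regularizedPairing f K Q φ)) := by
  refine tendsto_setIntegral_of_isAdmissible hQ (isTestFunction_extCoeff hc hφ hφP)
    (B := (∏ _j : P.S, (2 : ℝ) ^ K) * C)
    (h.mono fun ε => isAdmissible_comp_chartShift hc he hD hf hφ hφP hφe) ?_ fun y hy => ?_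
  · filter_upwards [h] with ε hε y hy
    obtain ⟨hyc, hyD, hyφ⟩ := apply_symm_mem_of_mem_tsupport_extCoeff hφ hφP hy
    simpa only [c.right_inv hyc] using norm_comp_chartShift_mul_prod_le hC (hφP hyφ) hyD
      (hε _ ⟨subset_closure hyD, hyφ⟩)
  · obtain ⟨-, hyD, hyφ⟩ := apply_symm_mem_of_mem_tsupport_extCoeff hφ hφP hy
    exact (hf.continuousOn.continuousAt (hD.mem_nhds hyD)).tendsto.comp
      (tendsto_chartShift (hφe hyφ) v)

end LocalCorner

end ShiftLimit

section Atlas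

lemma exists_smooth_partition_of_isCompact {d : ℕ} {M : Type*} [TopologicalSpace M] [T2Space M]
    [SigmaCompactSpace M] [ChartedSpace (Cn d) M] [IsManifold 𝓘(ℂ, Cn d) ω M] {K : Set M}
    (hK : IsCompact K) {U : K → Set M} (hU : ∀ p : K, U p ∈ 𝓝 (p : M)) :
    ∃ (t : Finset K) (χ : t → M → ℝ), (∀ i, ContMDiff 𝓘(ℝ, Cn d) 𝓘(ℝ, ℝ) ∞ (χ i)) ∧
      (∀ i, tsupport (χ i) ⊆ U i) ∧ ∀ x ∈ K, ∑ i, χ i x = 1 := by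
  have : IsManifold 𝓘(ℝ, Cn d) ∞ M := isManifold_real
  obtain ⟨t, ht⟩ := hK.elim_nhds_subcover' (fun p hp => interior (U ⟨p, hp⟩))
    fun p hp => interior_mem_nhds.2 (hU ⟨p, hp⟩)
  obtain ⟨χ, hχ⟩ := SmoothPartitionOfUnity.exists_isSubordinate 𝓘(ℝ, Cn d) hK.isClosed
    (fun i : t => interior (U i)) (fun i => isOpen_interior)
    (ht.trans (iUnion₂_subset fun p hp => subset_iUnion_of_subset ⟨p, hp⟩ Subset.rfl))
  refine ⟨t, fun i => χ i, fun i => (χ i).contMDiff, fun i => (hχ i).trans interior_subset,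
    fun x hx => ?_⟩
  rw [← finsum_eq_sum_of_fintype]
  exact χ.sum_eq_one hx

variable {n N : ℕ} {M : Type*} [TopologicalSpace M] [ChartedSpace (Cn (n + 1)) M]

/-- A finite family of local corners covering the closure of a domain, with a subordinate partition
of unity `χ` and, for each corner, an operator `Q` compensating the growth of `f` there. -/
structure CornerAtlas (D : Fin N → Set M) (f : M → ℂ) where
  centers : Finset (closure (⋂ j, D j))
  P : ∀ i : centers, LocalCorner D (chartAt (Cn (n + 1)) (i : closure (⋂ j, D j)).1)
  K : centers → ℕ
  C : centers → ℝ
  controls : ∀ i, (P i).Controls f (K i) (C i)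
  Q : centers → (Cn (n + 1) → ℂ) → Cn (n + 1) → ℂ
  isBellOperator : ∀ i, (P i).m.IsBellOperator volume (K i) (Q i)
  χ : centers → M → ℝ
  contMDiff_χ : ∀ i, ContMDiff 𝓘(ℝ, Cn (n + 1)) 𝓘(ℝ, ℝ) ∞ (χ i)
  tsupport_χ : ∀ i, tsupport (χ i) ⊆ (P i).dom
  sum_χ : ∀ x ∈ closure (⋂ j, D j), ∑ i, χ i x = 1

lemma nonempty_cornerAtlas {M : Type*} [MetricSpace M] [SigmaCompactSpace M]
    [ChartedSpace (Cn (n + 1)) M] [IsManifold 𝓘(ℂ, Cn (n + 1)) ω M]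
    (hM : IsLocallyEuclideanMetric (n + 1) M) {D : Fin N → Set M} {Ω : Set M}
    (hΩ : IsDomainWithGenericCorners (n + 1) D Ω) {f : M → ℂ}
    (hf : HolomorphicOfPolynomialGrowth (n + 1) Ω f) : Nonempty (CornerAtlas (n := n) D f) := by
  obtain rfl := hΩ.eq_iInter
  choose P hP K C hC using fun p : closure (⋂ j, D j) =>
    hΩ.exists_localCorner_controls hM hf p.2
  obtain ⟨t, χ, hχ_smooth, hχ_supp, hχ_sum⟩ := exists_smooth_partition_of_isCompact (d := n + 1)
    hΩ.isCompact_closure fun p => (P p).isOpen_dom.mem_nhds (hP p)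
  choose Q hQ using fun i : t => (P i).m.exists_isBellOperator volume (K i)
  exact ⟨{
    centers := t
    P i := P i
    K i := K i
    C i := C i
    controls i := hC i
    Q := Q
    isBellOperator := hQ
    χ := χ
    contMDiff_χ := hχ_smooth
    tsupport_χ := hχ_supp
    sum_χ := hχ_sum }⟩

lemma integrableOn_mul_topCoeff [T2Space M] {φ : DiffForm (n + 1) M (n + 1 + n + 1)}
    {e : OpenPartialHomeomorph M (Cn (n + 1))} (he : e ∈ holoCharts (n + 1) M)
    (hφ : φ ∈ testForms (n + 1) M (n + 1 + n + 1)) (hφe : tsupport φ ⊆ e.source) {Ω : Set M}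
    (hΩ : IsOpen Ω) {G : M → ℂ} {B : ℝ} (hG : ContinuousOn G (Ω ∩ tsupport φ))
    (hB : ∀ q ∈ Ω ∩ tsupport φ, ‖G q‖ ≤ B) :
    IntegrableOn (fun y => G (e.symm y) * topCoeff φ e y) (e.target ∩ e.symm ⁻¹' Ω) := by
  have h_meas : MeasurableSet (e.target ∩ e.symm ⁻¹' Ω) :=
    (e.isOpen_inter_preimage_symm hΩ).measurableSet
  have h_symm : MapsTo e.symm ((e.target ∩ e.symm ⁻¹' Ω) ∩ tsupport (extCoeff φ e))
      (Ω ∩ tsupport φ) := fun y hy => by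
    obtain ⟨q, hq, rfl⟩ := tsupport_extCoeff_subset_image hφ hφe hy.2
    refine ⟨hy.1.2, ?_⟩
    rwa [e.left_inv (hφe hq)]
  refine IntegrableOn.congr_fun (integrableOn_mul_of_continuousOn_of_bound h_meas
    (hG.comp (e.continuousOn_symm.mono fun y hy => hy.1.1) h_symm)
    (contDiff_extCoeff hφ he hφe).continuous (hasCompactSupport_extCoeff hφ hφe)
    fun y hy => hB _ (h_symm hy)) (fun y hy => ?_) h_meas
  simp only [Function.comp_apply, extCoeff_of_mem hy.1]

namespace CornerAtlas

variable {D : Fin N → Set M} {f : M → ℂ}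
  (A : CornerAtlas (n := n) D f) {φ : DiffForm (n + 1) M (n + 1 + n + 1)}
  {e : OpenPartialHomeomorph M (Cn (n + 1))}

lemma tsupport_smul_subset_dom (φ : DiffForm (n + 1) M (n + 1 + n + 1)) (i : A.centers) :
    tsupport (A.χ i • φ) ⊆ (A.P i).dom :=
  (tsupport_smul_subset_left (A.χ i) φ).trans (A.tsupport_χ i)

lemma tsupport_smul_subset (φ : DiffForm (n + 1) M (n + 1 + n + 1)) (i : A.centers) :
    tsupport (A.χ i • φ) ⊆ tsupport φ :=
  tsupport_smul_subset_right (A.χ i) φ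

lemma sum_topCoeff_smul {y : Cn (n + 1)} (hy : e.symm y ∈ closure (⋂ j, D j)) :
    ∑ i, topCoeff (A.χ i • φ) e y = topCoeff φ e y := by
  simp only [topCoeff_fun_smul, Pi.mul_apply, ← Finset.sum_mul]
  rw [← Complex.ofReal_sum, A.sum_χ _ hy, Complex.ofReal_one, one_mul]

variable [IsManifold 𝓘(ℂ, Cn (n + 1)) ω M]

lemma smul_mem (hφ : φ ∈ testForms (n + 1) M (n + 1 + n + 1)) (i : A.centers) :
    A.χ i • φ ∈ testForms (n + 1) M (n + 1 + n + 1) :=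
  smul_mem_testForms (A.contMDiff_χ i) hφ

variable [T2Space M]

/-- The distribution obtained by adding up the regularized pairings of `f` with the pieces of a test
form. -/
def extension (hf : MDifferentiableOn 𝓘(ℂ, Cn (n + 1)) 𝓘(ℂ, ℂ) f (⋂ j, D j)) :
    Distribution0 n M where
  toLinearMap :=
    { toFun φ := ∑ i, (A.P i).regularizedPairing f (A.K i) (A.Q i) (A.χ i • φ.1)
      map_add' φ ψ := by
        rw [← Finset.sum_add_distrib]
        refine Finset.sum_congr rfl fun i _ => ?_
        rw [Submodule.coe_add, smul_add]
        exact LocalCorner.regularizedPairing_add (IsManifold.chart_mem_maximalAtlas _) hf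
          (A.controls i) (A.isBellOperator i).isSmoothLocalOperator (A.smul_mem φ.2 i)
          (A.tsupport_smul_subset_dom φ.1 i) (A.smul_mem ψ.2 i) (A.tsupport_smul_subset_dom ψ.1 i)
      map_smul' a φ := by
        rw [RingHom.id_apply, smul_eq_mul, Finset.mul_sum]
        refine Finset.sum_congr rfl fun i _ => ?_
        have h_comm : A.χ i • (a • φ).1 = a • (A.χ i • φ.1) :=
          funext fun x => smul_comm (A.χ i x) a (φ.1 x)
        rw [h_comm]
        exact LocalCorner.regularizedPairing_smul (IsManifold.chart_mem_maximalAtlas _)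
          (A.isBellOperator i).isSmoothLocalOperator (A.smul_mem φ.2 i)
          (A.tsupport_smul_subset_dom φ.1 i) a }
  seqContinuous φ hφ := by
    simpa using tendsto_finsetSum Finset.univ fun i _ =>
      LocalCorner.tendsto_regularizedPairing_smul (IsManifold.chart_mem_maximalAtlas _)
        (A.controls i) (A.isBellOperator i).isSmoothLocalOperator (A.contMDiff_χ i)
        (A.tsupport_χ i) (fun ν => (φ ν).2) hφ

lemma setIntegral_eq_sum (hD : IsOpen (⋂ j, D j)) (hφ : φ ∈ testForms (n + 1) M (n + 1 + n + 1))
    (he : e ∈ holoCharts (n + 1) M) (hφe : tsupport φ ⊆ e.source) {G : M → ℂ} {B : A.centers → ℝ}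
    (hG : ∀ i, ContinuousOn G ((⋂ j, D j) ∩ tsupport (A.χ i • φ)))
    (hB : ∀ i, ∀ q ∈ (⋂ j, D j) ∩ tsupport (A.χ i • φ), ‖G q‖ ≤ B i) :
    ∫ y in e.target ∩ e.symm ⁻¹' (⋂ j, D j), G (e.symm y) * topCoeff φ e y =
      ∑ i, ∫ y in (A.P i).m.region,
        G ((chartAt (Cn (n + 1)) i.1.1).symm y) * extCoeff (A.χ i • φ) (chartAt _ i.1.1) y := by
  have h_supp (i : A.centers) := (A.tsupport_smul_subset φ i).trans hφe
  calc ∫ y in e.target ∩ e.symm ⁻¹' (⋂ j, D j), G (e.symm y) * topCoeff φ e y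
      = ∫ y in e.target ∩ e.symm ⁻¹' (⋂ j, D j),
          ∑ i, G (e.symm y) * topCoeff (A.χ i • φ) e y := by
        refine setIntegral_congr_fun (e.isOpen_inter_preimage_symm hD).measurableSet
          fun y hy => ?_
        simp only [← Finset.mul_sum]
        rw [A.sum_topCoeff_smul (subset_closure hy.2)]
    _ = ∑ i, ∫ y in e.target ∩ e.symm ⁻¹' (⋂ j, D j),
          G (e.symm y) * topCoeff (A.χ i • φ) e y :=
        integral_finsetSum _ fun i _ =>
          integrableOn_mul_topCoeff he (A.smul_mem hφ i) (h_supp i) hD (hG i) (hB i)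
    _ = _ := Finset.sum_congr rfl fun i _ => LocalCorner.setIntegral_eq_setIntegral_region
        (IsManifold.chart_mem_maximalAtlas _) he hD (A.smul_mem hφ i)
        (A.tsupport_smul_subset_dom φ i) (h_supp i) G

variable (hf : MDifferentiableOn 𝓘(ℂ, Cn (n + 1)) 𝓘(ℂ, ℂ) f (⋂ j, D j))
include hf

lemma extension_eq_setIntegral (hD : IsOpen (⋂ j, D j))
    (φ : testForms (n + 1) M (n + 1 + n + 1)) (he : e ∈ holoCharts (n + 1) M)
    (hφe : tsupport φ.1 ⊆ e.source) {B : ℝ} (hB : ∀ q ∈ (⋂ j, D j) ∩ tsupport φ.1, ‖f q‖ ≤ B) :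
    (A.extension hf).toLinearMap φ =
      ∫ y in e.target ∩ e.symm ⁻¹' (⋂ j, D j), f (e.symm y) * topCoeff φ.1 e y := by
  have h_bound (i : A.centers) : ∀ q ∈ (⋂ j, D j) ∩ tsupport (A.χ i • φ.1), ‖f q‖ ≤ B :=
    fun q hq => hB q ⟨hq.1, A.tsupport_smul_subset φ.1 i hq.2⟩
  rw [A.setIntegral_eq_sum hD φ.2 he hφe (fun i => hf.continuousOn.mono inter_subset_left) h_bound]
  exact Finset.sum_congr rfl fun i _ => LocalCorner.regularizedPairing_eq_setIntegral
    (IsManifold.chart_mem_maximalAtlas _) hf (A.isBellOperator i) (A.smul_mem φ.2 i)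
    (A.tsupport_smul_subset_dom φ.1 i) (h_bound i)

lemma tendsto_extension (hD : ∀ j, IsOpen (D j)) (φ : testForms (n + 1) M (n + 1 + n + 1))
    (he : e ∈ holoCharts (n + 1) M) (hφe : tsupport φ.1 ⊆ e.source) {v : Cn (n + 1)}
    (hv : ∀ j, ∀ p ∈ frontier (D j) ∩ tsupport φ.1, PointsOutward (n + 1) (D j) e v p) :
    Tendsto (fun ε : ℝ => ∫ y in e.target ∩ e.symm ⁻¹' (⋂ j, D j),
      f (e.symm (y - ε • v)) * topCoeff φ.1 e y) (𝓝[>] 0)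
      (𝓝 ((A.extension hf).toLinearMap φ)) := by
  have hΩ : IsOpen (⋂ j, D j) := isOpen_iInter_of_finite hD
  have h_supp (i : A.centers) := (A.tsupport_smul_subset φ.1 i).trans hφe
  have h_compact (i : A.centers) := isCompact_tsupport_of_mem_testForms (A.smul_mem φ.2 i)
  have h_shifted (i : A.centers) := (A.P i).eventually_forall_isShiftedInside
    (IsManifold.chart_mem_maximalAtlas _) he hD (h_compact i)
    (A.tsupport_smul_subset_dom φ.1 i) (h_supp i)
    fun j p hp => hv j p ⟨hp.1, A.tsupport_smul_subset φ.1 i hp.2⟩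
  refine (tendsto_finsetSum Finset.univ fun i _ => LocalCorner.tendsto_setIntegral_comp_chartShift
    (IsManifold.chart_mem_maximalAtlas _) he hΩ hf (A.controls i) (A.isBellOperator i)
    (A.smul_mem φ.2 i) (A.tsupport_smul_subset_dom φ.1 i) (h_supp i) (h_shifted i)).congr' ?_
  filter_upwards [eventually_all.2 h_shifted] with ε hε
  choose B hB using fun i =>
    LocalCorner.exists_norm_comp_chartShift_le he hf (h_compact i) (h_supp i) (hε i)
  rw [← A.setIntegral_eq_sum hΩ φ.2 he hφe (fun i => LocalCorner.continuousOn_comp_chartShift he hf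
    (inter_subset_right.trans (h_supp i)) fun q hq => hε i q ⟨subset_closure hq.1, hq.2⟩) hB]
  refine setIntegral_congr_fun (e.isOpen_inter_preimage_symm hΩ).measurableSet fun y hy => ?_
  simp only [chartShift, e.right_inv hy.1]

end CornerAtlas

end Atlas

section CanonicalExtensions

variable {n N : ℕ} {M : Type*} [TopologicalSpace M] [ChartedSpace (Cn (n + 1)) M]
  [IsManifold 𝓘(ℂ, Cn (n + 1)) ω M] {D : Fin N → Set M} {Ω : Set M} {f : M → ℂ}

lemma IsDomainWithGenericCorners.ae_eq_closure (hΩ : IsDomainWithGenericCorners (n + 1) D Ω)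
    {e : OpenPartialHomeomorph M (Cn (n + 1))} (he : e ∈ holoCharts (n + 1) M) :
    (e.target ∩ e.symm ⁻¹' Ω : Set (Cn (n + 1))) =ᵐ[volume]
      (e.target ∩ e.symm ⁻¹' closure Ω : Set (Cn (n + 1))) := by
  have h_open := hΩ.isOpen
  obtain rfl := hΩ.eq_iInter
  have h_null := volume_frontier_eq_zero h_open (fun p hp => by
    obtain ⟨P, hP⟩ := hΩ.exists_localCorner (frontier_subset_closure hp)
    exact ⟨_, IsManifold.chart_mem_maximalAtlas p, P, hP⟩) he
  refine (inter_subset_inter_right _ (preimage_mono subset_closure)).eventuallyLE.antisymm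
    (ae_le_set.2 (measure_mono_null ?_ h_null))
  rintro y ⟨⟨hy, hy_closure⟩, hy_notMem⟩
  refine ⟨hy, ?_⟩
  rw [mem_preimage, h_open.frontier_eq]
  exact ⟨hy_closure, fun h => hy_notMem ⟨hy, h⟩⟩

variable [T2Space M]

section Uniqueness

variable [SigmaCompactSpace M]

lemma IsDomainWithGenericCorners.exists_eq_sum_pointsOutward
    (hΩ : IsDomainWithGenericCorners (n + 1) D Ω) (φ : testForms (n + 1) M (n + 1 + n + 1)) :
    ∃ (t : Finset (tsupport φ.1)) (ψ : t → testForms (n + 1) M (n + 1 + n + 1))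
      (v : t → Cn (n + 1)), φ = ∑ p, ψ p ∧
      ∀ p : t, tsupport (ψ p).1 ⊆ (chartAt (Cn (n + 1)) p.1.1).source ∧
      (∀ j, ∀ q ∈ frontier (D j) ∩ tsupport (ψ p).1,
        PointsOutward (n + 1) (D j) (chartAt (Cn (n + 1)) p.1.1) (v p) q) ∧
      ∀ x, φ.1 x = 0 → (ψ p).1 x = 0 := by
  choose v hv using hΩ.exists_eventually_pointsOutward
  have h_compact := isCompact_tsupport_of_mem_testForms φ.2
  obtain ⟨t, χ, hχ_smooth, hχ_supp, hχ_sum⟩ := exists_smooth_partition_of_isCompact (d := n + 1)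
    h_compact fun p : tsupport φ.1 =>
      inter_mem (chart_source_mem_nhds (Cn (n + 1)) p.1) (hv p)
  have h_supp (p : t) : tsupport (χ p • φ.1) ⊆ tsupport (χ p) := tsupport_smul_subset_left (χ p) φ.1
  refine ⟨t, fun p => ⟨χ p • φ.1, smul_mem_testForms (hχ_smooth p) φ.2⟩, fun p => v p.1, ?_,
    fun p => ⟨fun q hq => (hχ_supp p (h_supp p hq)).1,
      fun j q hq => (hχ_supp p (h_supp p hq.2)).2 j hq.1, fun x hx => ?_⟩⟩
  · refine Subtype.ext (funext fun x => ?_)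
    simp only [Submodule.coe_sum, Finset.sum_apply, Pi.smul_apply', ← Finset.sum_smul]
    by_cases hx : x ∈ tsupport φ.1
    · rw [hχ_sum x hx, one_smul]
    · rw [image_eq_zero_of_notMem_tsupport hx, smul_zero]
  · change χ p x • φ.1 x = 0
    rw [hx]
    exact smul_zero (A := (Cn (n + 1)) [⋀^Fin (n + 1 + n + 1)]→L[ℝ] ℂ) (χ p x)

lemma IsCanonicalExtension.unique (hΩ : IsDomainWithGenericCorners (n + 1) D Ω)
    {T T' : Distribution0 n M} (hT : IsCanonicalExtension D Ω f T)
    (hT' : IsCanonicalExtension D Ω f T') : T = T' := by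
  have h_eq : T.toLinearMap = T'.toLinearMap := by
    ext φ
    obtain ⟨t, ψ, v, h_sum, hψ⟩ := hΩ.exists_eq_sum_pointsOutward φ
    rw [h_sum, map_sum, map_sum]
    refine Finset.sum_congr rfl fun p _ => ?_
    obtain ⟨h_supp, h_out, -⟩ := hψ p
    exact tendsto_nhds_unique
      (hT.tendsto _ (IsManifold.chart_mem_maximalAtlas _) (ψ p) (v p) h_supp h_out)
      (hT'.tendsto _ (IsManifold.chart_mem_maximalAtlas _) (ψ p) (v p) h_supp h_out)
  cases T
  cases T'
  congr

lemma IsCanonicalExtension.eq_zero (hΩ : IsDomainWithGenericCorners (n + 1) D Ω)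
    {T : Distribution0 n M} (hT : IsCanonicalExtension D Ω f T)
    {φ : testForms (n + 1) M (n + 1 + n + 1)} (hφ : ∀ x ∈ Ω, φ.1 x = 0) :
    T.toLinearMap φ = 0 := by
  obtain ⟨t, ψ, v, h_sum, hψ⟩ := hΩ.exists_eq_sum_pointsOutward φ
  rw [h_sum, map_sum]
  refine Finset.sum_eq_zero fun p _ => ?_
  obtain ⟨h_supp, h_out, h_zero⟩ := hψ p
  refine tendsto_nhds_unique
    (hT.tendsto _ (IsManifold.chart_mem_maximalAtlas _) (ψ p) (v p) h_supp h_out)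
    (tendsto_const_nhds.congr fun ε => (setIntegral_eq_zero_of_forall_eq_zero fun y hy => ?_).symm)
  rw [topCoeff_eq_zero (h_zero _ (hφ _ hy.2)), mul_zero]

lemma IsCanonicalExtension.weinstockCondition (hΩ : IsDomainWithGenericCorners (n + 1) D Ω)
    {T : Distribution0 n M} (hT : IsCanonicalExtension D Ω f T) :
    WeinstockCondition Ω (boundaryCurrent T) := fun ψ hψ => by
  have h_pairing : (boundaryCurrent T).toLinearMap ψ = T.toLinearMap (dbar n M ψ) := by
    simp [boundaryCurrent, dbarCurrent]
  rw [h_pairing]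
  exact hT.eq_zero hΩ fun x hx => hψ x (subset_closure hx)

end Uniqueness

namespace CornerAtlas

variable (A : CornerAtlas (n := n) D f) {e : OpenPartialHomeomorph M (Cn (n + 1))}
  (hf : MDifferentiableOn 𝓘(ℂ, Cn (n + 1)) 𝓘(ℂ, ℂ) f (⋂ j, D j))
include hf

lemma extension_eq_setIntegral_target (hD : IsOpen (⋂ j, D j))
    (φ : testForms (n + 1) M (n + 1 + n + 1)) (he : e ∈ holoCharts (n + 1) M)
    (hφ : tsupport φ.1 ⊆ (⋂ j, D j) ∩ e.source) :
    (A.extension hf).toLinearMap φ = ∫ y in e.target, f (e.symm y) * topCoeff φ.1 e y := by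
  obtain ⟨B, hB⟩ := (isCompact_tsupport_of_mem_testForms φ.2).exists_bound_of_continuousOn
    (hf.continuousOn.mono (hφ.trans inter_subset_left))
  rw [A.extension_eq_setIntegral hf hD φ he (hφ.trans inter_subset_right) fun q hq => hB q hq.2]
  refine (setIntegral_eq_of_subset_of_forall_sdiff_eq_zero e.open_target.measurableSet
    inter_subset_left fun y hy => ?_).symm
  rw [topCoeff_eq_zero (image_eq_zero_of_notMem_tsupport fun h => hy.2 ⟨hy.1, (hφ h).1⟩), mul_zero]

lemma extension_eq_setIntegral_closure (hΩ : IsDomainWithGenericCorners (n + 1) D (⋂ j, D j))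
    (φ : testForms (n + 1) M (n + 1 + n + 1)) (he : e ∈ holoCharts (n + 1) M)
    (hφe : tsupport φ.1 ⊆ e.source) {g : M → ℂ} (hg : ContinuousOn g (closure (⋂ j, D j)))
    (hgf : EqOn g f (⋂ j, D j)) :
    (A.extension hf).toLinearMap φ =
      ∫ y in e.target ∩ e.symm ⁻¹' closure (⋂ j, D j), g (e.symm y) * topCoeff φ.1 e y := by
  obtain ⟨B, hB⟩ := hΩ.isCompact_closure.exists_bound_of_continuousOn hg
  rw [A.extension_eq_setIntegral hf hΩ.isOpen φ he hφe
      fun q hq => by rw [← hgf hq.1]; exact hB q (subset_closure hq.1),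
    ← setIntegral_congr_set (hΩ.ae_eq_closure he)]
  refine setIntegral_congr_fun (e.isOpen_inter_preimage_symm hΩ.isOpen).measurableSet
    fun y hy => ?_
  simp only [hgf hy.2]

lemma isCanonicalExtension (hΩ : IsDomainWithGenericCorners (n + 1) D (⋂ j, D j)) :
    IsCanonicalExtension D (⋂ j, D j) f (A.extension hf) where
  restrict_eq _ he φ hφ := A.extension_eq_setIntegral_target hf hΩ.isOpen φ he hφ
  tendsto _ he φ _ hφe hv :=
    A.tendsto_extension hf (fun j => (hΩ.isSmoothDomain j).isOpen) φ he hφe hv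
  eq_of_continuousOn _ hg hgf _ he φ hφe :=
    A.extension_eq_setIntegral_closure hf hΩ φ he hφe hg hgf

end CornerAtlas

end CanonicalExtensions

end

end BoundaryCurrents

theorem proposition2 {n N : ℕ} {M : Type*} [MetricSpace M] [SigmaCompactSpace M]
    [ChartedSpace (BoundaryCurrents.Cn (n + 1)) M]
    [IsManifold 𝓘(ℂ, BoundaryCurrents.Cn (n + 1)) ω M]
    (hM : BoundaryCurrents.IsLocallyEuclideanMetric (n + 1) M)
    (D : Fin N → Set M) (Ω : Set M)
    (hΩ : BoundaryCurrents.IsDomainWithGenericCorners (n + 1) D Ω)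
    (f : M → ℂ) (hf : BoundaryCurrents.HolomorphicOfPolynomialGrowth (n + 1) Ω f) :
    (∃! T : BoundaryCurrents.Distribution0 n M,
      BoundaryCurrents.IsCanonicalExtension D Ω f T) ∧
    ∀ T : BoundaryCurrents.Distribution0 n M, BoundaryCurrents.IsCanonicalExtension D Ω f T →
      BoundaryCurrents.WeinstockCondition Ω (BoundaryCurrents.boundaryCurrent T) := by
  obtain rfl := hΩ.eq_iInter
  obtain ⟨A⟩ := BoundaryCurrents.nonempty_cornerAtlas hM hΩ hf
  have h_ext := A.isCanonicalExtension hf.1 hΩ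
  exact ⟨⟨A.extension hf.1, h_ext, fun T hT => hT.unique hΩ h_ext⟩,
    fun T hT => hT.weinstockCondition hΩ⟩
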